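/- Fix $T>0$, integers $l,d$, and real numbers $\gamma>1/4$ and $0<\kappa<\gamma$ with $3\kappa+\gamma>1$. Sums over repeated indices are implied. **Increments.** For $g:[0,T]\to V$ put $(\delta g)_{st}=g_t-g_s$, and for $h:[0,T]^2\to V$ put $(\delta h)_{sut}=h_{st}-h_{su}-h_{ut}$. For $\mu>0$ let $\mathcal C_2^\mu(V)$ be the set of $f:[0,T]^2\to V$ with $f_{ss}=0$ and $\|f\|_\mu=\sup_{s,t}|f_{st}|/|t-s|^\mu<\infty$, let $\mathcal C_1^\mu(V)$ be the set of continuous $g:[0,T]\to V$ with $\|g\|_\mu:=\|\delta g\|_\mu<\infty$, and $\mathcal C_2^{1+}=\bigcup_{\mu>1}\mathcal C_2^\mu$. For $h:[0,T]^3\to V$, $\Lambda(h)$ denotes the element $g\in\mathcal C_2^{1+}(V)$ with $\delta g=h$, when it exists (it is then unique). A product $fg$ of increments means $(fg)_{st}=f_sg_{st}$ if $f$ is a path and $g$ is a function of two times, and $(fg)_{sut}=f_{su}g_{ut}$ if both are functions of two times. **Driver.** A driver is $X=(x,\mathbf x^2,\mathbf x^3)$ with $x\in\mathcal C_1^\gamma(\mathbb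 R^d)$, $\mathbf x^2\in\mathcal C_2^{2\gamma}(\mathbb R^{d,d})$, $\mathbf x^3\in\mathcal C_2^{3\gamma}(\mathbb R^{d,d,d})$ such that, for all $s,u,t\in[0,T]$ and all $i,j,k$, Chen's relations $$(\delta\mathbf x^{2})^{ij}_{sut}=(\delta x^i)_{su}(\delta x^j)_{ut},\qquad (\delta\mathbf x^{3})^{ijk}_{sut}=(\mathbf x^2_{su})^{ij}(\delta x^k)_{ut}+(\delta x^i)_{su}(\mathbf x^2_{ut})^{jk}$$ hold, and such that $\tfrac12\big((\mathbf x^2_{st})^{ij}+(\mathbf x^2_{st})^{ji}\big)=\tfrac12(\delta x^i)_{st}(\delta x^j)_{st}$ for $s<t$. Put $|X|_\gamma=\|x\|_\gamma+\|\mathbf x^2\|_{2\gamma}+\|\mathbf x^3\|_{3\gamma}$. **Weakly controlled paths.** A weakly controlled path in $\mathbb R^n$ based on $X$ is a triple $(z,\zeta^1,\zeta^2)$ with $z\in\mathcal C_1^\kappa(\mathbb R^n)$, $\zeta^1\in\mathcal C_1^\kappa(\mathbb R^{n,d})$, $\zeta^2\in\mathcal C_1^\kappa(\mathbb R^{n,d,d})$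 and $$\delta z^i=(\zeta^1)^{ij}\delta x^j+(\zeta^2)^{ijk}(\mathbf x^2)^{kj}+r^i,\qquad \delta(\zeta^1)^{ij}=(\zeta^2)^{ijk}\delta x^k+\rho^{ij},\qquad r\in\mathcal C_2^{3\kappa},\ \rho\in\mathcal C_2^{2\kappa}.$$ It belongs to $\mathcal Q_{\kappa,a,b}(\mathbb R^n)$ if moreover $z_0=a$ and $\zeta^1_0=b$. If $\varphi$ is a $C^2$ function of $z$, then $\varphi(z)$ is equipped with $(\hat\zeta^1)^{j}=\partial_p\varphi(z)(\zeta^1)^{pj}$ and $(\hat\zeta^2)^{jk}=\partial_p\varphi(z)(\zeta^2)^{pjk}+\partial_{pq}\varphi(z)(\zeta^1)^{pj}(\zeta^1)^{qk}$ (for vector-valued $\varphi$, component by component). If $(m,\mu^1,\mu^2)$ is a weakly controlled path in $\mathbb R^{l,d}$ with remainders $r,\rho$, set $$\mathcal J(m\,dx)^i=m^{ij}\delta x^j+(\mu^1)^{ijk}(\mathbf x^2)^{kj}+(\mu^2)^{ijk_1k_2}(\mathbf x^3)^{k_2k_1j}+\Lambda\big(r^{ij}\delta x^j+\rho^{ijk}(\mathbf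 x^2)^{kj}+\delta(\mu^2)^{ijk_1k_2}(\mathbf x^3)^{k_2k_1j}\big);$$ a path $z$ with $\delta z=\mathcal J(m\,dx)$ is regarded as the controlled path $(z,m,\mu^1)$. **Equation.** Let $\sigma:\mathbb R^l\to\mathbb R^{l,d}$ be of class $C^4_b$ (that is, $C^4$, bounded together with its derivatives up to order $4$). A solution of $dy=\sigma(y)\,dx$, $y_0=a$, is an element $(y,\zeta^1,\zeta^2)$ of $\mathcal Q_{\kappa,a,\sigma(a)}(\mathbb R^l)$ such that $\sigma(y)$ is a weakly controlled path and, as controlled paths, $y$ is the integral of $\sigma(y)$: $\delta y=\mathcal J(\sigma(y)\,dx)$ (the term $\Lambda$ in it being defined), $\zeta^1=\sigma(y)$, and $\zeta^2$ is the first derivative component $\hat\zeta^1$ of $\sigma(y)$, i.e. $(\zeta^2)^{ijk}=\partial_p\sigma^{ij}(y)(\zeta^1)^{pk}$. **Theorem.** (i) For every driver $X$ and every $a\in\mathbb R^l$ the equation $dy=\sigma(y)\,dx$, $y_0=a$, has exactly one solution in $\mathcal Q_{\kappa,a,\sigma(a)}(\mathbb R^l)$. (ii) The map $(a,x,\mathbf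 x^2,\mathbf x^3)\mapsto y$ with values in $\mathcal C_1^\kappa(\mathbb R^l)$ is Lipschitz continuous, uniformly in $a$ and locally uniformly in the driver: for every $M\ge0$ there is a constant $c>0$ (depending only on $M,\sigma,\gamma,\kappa,T,l,d$) such that for all drivers $X,\tilde X$ with $|X|_\gamma\le M$, $|\tilde X|_\gamma\le M$, all $a,\tilde a\in\mathbb R^l$, and the solutions $y,\tilde y$ of the corresponding equations, $$\|y-\tilde y\|_\kappa\le c\,\big\{|a-\tilde a|+\|x-\tilde x\|_\gamma+\|\mathbf x^2-\tilde{\mathbf x}^2\|_{2\gamma}+\|\mathbf x^3-\tilde{\mathbf x}^3\|_{3\gamma}\big\}.$$ -/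

import Mathlib

open scoped NNReal ENNReal

namespace RoughDiff

/-- `ℝ^ι` with the Euclidean norm; arrays such as `ℝ^{l,d}` are `Vec (Fin l × Fin d)`. -/
abbrev Vec (ι : Type) [Fintype ι] : Type := EuclideanSpace ℝ ι

/-- The time interval `[0,T]`. -/
abbrev Time (T : ℝ) : Type := Set.Icc (0 : ℝ) T

section Increments

variable {T : ℝ} {V : Type} [NormedAddCommGroup V]

/-- `(δ g)_{st} = g_t - g_s`. -/
def delta1 (g : Time T → V) (s t : Time T) : V := g t - g s

/-- `(δ h)_{sut} = h_{st} - h_{su} - h_{ut}`. -/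
def delta2 (h : Time T → Time T → V) (s u t : Time T) : V := h s t - h s u - h u t

/-- `‖f‖_μ = sup_{s,t} |f_{st}| / |t - s|^μ`, with values in `[0,∞]` (here `0 / 0 = 0`, and
`c / 0 = ∞` for `c ≠ 0`). -/
noncomputable def norm2 (μ : ℝ) (f : Time T → Time T → V) : ℝ≥0∞ :=
  ⨆ (s : Time T) (t : Time T), ‖f s t‖ₑ / ENNReal.ofReal (|(t : ℝ) - (s : ℝ)| ^ μ)

/-- The Hölder seminorm of a path: `‖g‖_μ = ‖δ g‖_μ`. -/
noncomputable def norm1 (μ : ℝ) (g : Time T → V) : ℝ≥0∞ := norm2 μ (delta1 g)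

/-- `f ∈ C_2^μ(V)`. -/
def MemC2 (μ : ℝ) (f : Time T → Time T → V) : Prop := (∀ s, f s s = 0) ∧ norm2 μ f < ∞

/-- `g ∈ C_1^μ(V)`. -/
def MemC1 (μ : ℝ) (g : Time T → V) : Prop := Continuous g ∧ norm1 μ g < ∞

/-- `f ∈ C_2^{1+}(V) = ⋃_{μ > 1} C_2^μ(V)`. -/
def MemC2OnePlus (f : Time T → Time T → V) : Prop := ∃ μ : ℝ, 1 < μ ∧ MemC2 μ f

/-- `g = Λ(h)`: `g` is the element of `C_2^{1+}(V)` with `δ g = h`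
(there is at most one, see `IsLambda.unique`). -/
def IsLambda (h : Time T → Time T → Time T → V) (g : Time T → Time T → V) : Prop :=
  MemC2OnePlus g ∧ delta2 g = h

theorem MemC2.bound {μ : ℝ} {f : Time T → Time T → V} (hf : MemC2 μ f) :
    ∃ C : ℝ, ∀ s t, ‖f s t‖ ≤ C * |(t : ℝ) - (s : ℝ)| ^ μ := by
  refine ⟨(norm2 μ f).toReal, fun s t => ?_⟩
  by_cases hst : s = t
  · subst hst
    rw [hf.1, norm_zero]
    exact mul_nonneg ENNReal.toReal_nonneg (Real.rpow_nonneg (abs_nonneg _) _)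
  · have hpos : 0 < |(t : ℝ) - (s : ℝ)| ^ μ :=
      Real.rpow_pos_of_pos (abs_pos.2 fun h => hst (Subtype.ext (sub_eq_zero.1 h).symm)) _
    have h1 : ‖f s t‖ₑ / ENNReal.ofReal (|(t : ℝ) - (s : ℝ)| ^ μ) ≤ norm2 μ f :=
      le_iSup₂ (f := fun s t : Time T =>
        ‖f s t‖ₑ / ENNReal.ofReal (|(t : ℝ) - (s : ℝ)| ^ μ)) s t
    rw [ENNReal.div_le_iff (by simpa using hpos) ENNReal.ofReal_ne_top] at h1
    have h2 := ENNReal.toReal_mono (ENNReal.mul_ne_top hf.2.ne ENNReal.ofReal_ne_top) h1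
    rwa [toReal_enorm, ENNReal.toReal_mul, ENNReal.toReal_ofReal hpos.le] at h2

/-- `Λ` is single-valued. -/
theorem IsLambda.unique {h : Time T → Time T → Time T → V} {g g' : Time T → Time T → V}
    (hg : IsLambda h g) (hg' : IsLambda h g') : g = g' := by
  obtain ⟨⟨μ, hμ, hm⟩, he⟩ := hg
  obtain ⟨⟨ν, hν, hn⟩, he'⟩ := hg'
  obtain ⟨C, hC⟩ := hm.bound
  obtain ⟨D, hD⟩ := hn.bound
  have key : ∀ (n : ℕ) (s t : Time T), ‖g s t - g' s t‖ ≤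
      2 ^ n * (C * (|(t : ℝ) - s| / 2 ^ n) ^ μ + D * (|(t : ℝ) - s| / 2 ^ n) ^ ν) := by
    intro n
    induction n with
    | zero =>
      intro s t
      simpa using (norm_sub_le _ _).trans (add_le_add (hC s t) (hD s t))
    | succ n ih =>
      intro s t
      have hs := s.2
      have ht := t.2
      let u : Time T := ⟨((s : ℝ) + t) / 2, by
        constructor <;> linarith [hs.1, hs.2, ht.1, ht.2]⟩
      have h1 : |(u : ℝ) - s| = |(t : ℝ) - s| / 2 := by
        have : (u : ℝ) - s = ((t : ℝ) - s) / 2 := by simp only [u]; ring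
        rw [this, abs_div, abs_two]
      have h2 : |(t : ℝ) - u| = |(t : ℝ) - s| / 2 := by
        have : (t : ℝ) - u = ((t : ℝ) - s) / 2 := by simp only [u]; ring
        rw [this, abs_div, abs_two]
      have e := congrFun (congrFun (congrFun (he.trans he'.symm) s) u) t
      have e' : g s t - g' s t = (g s u - g' s u) + (g u t - g' u t) := by
        simp only [delta2] at e
        rw [← sub_eq_zero] at e ⊢
        rw [← e]
        abel
      have i1 := ih s u
      have i2 := ih u t
      rw [h1] at i1
      rw [h2] at i2
      have h3 : |(t : ℝ) - s| / 2 / 2 ^ n = |(t : ℝ) - s| / 2 ^ (n + 1) := by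
        rw [div_div, pow_succ']
      rw [h3] at i1 i2
      rw [e']
      calc _ ≤ _ := norm_add_le _ _
        _ ≤ _ := add_le_add i1 i2
        _ = _ := by rw [pow_succ]; ring
  have lim : ∀ (E x p : ℝ), 0 ≤ x → 1 < p →
      Filter.Tendsto (fun n : ℕ => (2 : ℝ) ^ n * (E * (x / 2 ^ n) ^ p)) Filter.atTop
        (nhds 0) := by
    intro E x p hx hp
    have hq : (2 : ℝ) ^ (1 - p) < 1 :=
      Real.rpow_lt_one_of_one_lt_of_neg one_lt_two (by linarith)
    have h0 := (tendsto_pow_atTop_nhds_zero_of_lt_one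
      (Real.rpow_nonneg zero_le_two (1 - p)) hq).const_mul (E * x ^ p)
    rw [mul_zero] at h0
    refine h0.congr fun n => ?_
    rw [Real.div_rpow hx (by positivity), ← Real.rpow_natCast, ← Real.rpow_mul zero_le_two,
      ← Real.rpow_natCast (2 : ℝ) n, ← Real.rpow_mul zero_le_two]
    have : (2 : ℝ) ^ ((1 - p) * n) = 2 ^ (n : ℝ) / 2 ^ ((n : ℝ) * p) := by
      rw [← Real.rpow_sub zero_lt_two]
      ring_nf
    rw [this]
    ring
  funext s t
  have l := (lim C |(t : ℝ) - s| μ (abs_nonneg _) hμ).add (lim D |(t : ℝ) - s| ν (abs_nonneg _) hν)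
  rw [add_zero] at l
  have := ge_of_tendsto' l fun n => (key n s t).trans (by rw [mul_add])
  exact sub_eq_zero.1 (norm_le_zero_iff.1 this)

end Increments

/-- A path `x` in `ℝ^d` with an area `x2` and a volume `x3`. -/
structure Driver (T : ℝ) (d : ℕ) where
  x : Time T → Vec (Fin d)
  x2 : Time T → Time T → Vec (Fin d × Fin d)
  x3 : Time T → Time T → Vec (Fin d × Fin d × Fin d)

/-- Regularity `(γ, 2γ, 3γ)` and Chen's relations. -/
structure Driver.IsRough {T : ℝ} {d : ℕ} (X : Driver T d) (γ : ℝ) : Prop where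
  mem_x : MemC1 γ X.x
  mem_x2 : MemC2 (2 * γ) X.x2
  mem_x3 : MemC2 (3 * γ) X.x3
  chen2 : ∀ (s u t : Time T) (i j : Fin d),
    delta2 X.x2 s u t (i, j) = delta1 X.x s u i * delta1 X.x u t j
  chen3 : ∀ (s u t : Time T) (i j k : Fin d),
    delta2 X.x3 s u t (i, j, k) =
      X.x2 s u (i, j) * delta1 X.x u t k + delta1 X.x s u i * X.x2 u t (j, k)

/-- The symmetric part of the area is half of the tensor square of the increment of the path. -/
def Driver.IsGeometric {T : ℝ} {d : ℕ} (X : Driver T d) : Prop :=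
  ∀ s t : Time T, s < t → ∀ i j : Fin d,
    (1 / 2 : ℝ) * (X.x2 s t (i, j) + X.x2 s t (j, i)) =
      (1 / 2 : ℝ) * (delta1 X.x s t i * delta1 X.x s t j)

/-- The data `(z, ζ¹, ζ²)` of a weakly controlled path in `ℝ^ι`, the driver having values
in `ℝ^d`. -/
@[ext] structure Triple (T : ℝ) (d : ℕ) (ι : Type) [Fintype ι] where
  z : Time T → Vec ι
  ζ1 : Time T → Vec (ι × Fin d)
  ζ2 : Time T → Vec (ι × Fin d × Fin d)

section Controlled

variable {T : ℝ} {d : ℕ} {ι : Type} [Fintype ι]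

/-- `r^i_{st} = (δz^i)_{st} - (ζ¹_s)^{ij} (δx^j)_{st} - (ζ²_s)^{ijk} (x²_{st})^{kj}`. -/
noncomputable def Triple.r (Z : Triple T d ι) (X : Driver T d) (s t : Time T) : Vec ι :=
  WithLp.toLp 2 fun i =>
    delta1 Z.z s t i - ∑ j, Z.ζ1 s (i, j) * delta1 X.x s t j
      - ∑ j, ∑ k, Z.ζ2 s (i, j, k) * X.x2 s t (k, j)

/-- `ρ^{ij}_{st} = (δ(ζ¹)^{ij})_{st} - (ζ²_s)^{ijk} (δx^k)_{st}`. -/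
noncomputable def Triple.ρ (Z : Triple T d ι) (X : Driver T d) (s t : Time T) :
    Vec (ι × Fin d) :=
  WithLp.toLp 2 fun p =>
    delta1 Z.ζ1 s t p - ∑ k, Z.ζ2 s (p.1, p.2, k) * delta1 X.x s t k

/-- `(z, ζ¹, ζ²)` is a `κ`-weakly controlled path based on `X`. -/
structure Triple.IsControlled (Z : Triple T d ι) (X : Driver T d) (κ : ℝ) : Prop where
  mem_z : MemC1 κ Z.z
  mem_ζ1 : MemC1 κ Z.ζ1
  mem_ζ2 : MemC1 κ Z.ζ2
  mem_r : MemC2 (3 * κ) (Z.r X)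
  mem_ρ : MemC2 (2 * κ) (Z.ρ X)

/-- Membership in `Q_{κ,a,b}(ℝ^ι)`: controlled, with `z_0 = a` and `ζ¹_0 = b`. -/
def Triple.MemQ (Z : Triple T d ι) (X : Driver T d) (κ : ℝ) (a : Vec ι)
    (b : Vec (ι × Fin d)) : Prop :=
  Z.IsControlled X κ ∧ ∀ t : Time T, (t : ℝ) = 0 → Z.z t = a ∧ Z.ζ1 t = b

/-- The partial derivative `∂_p φ` of a real function. -/
noncomputable def pd [DecidableEq ι] (φ : Vec ι → ℝ) (p : ι) (w : Vec ι) : ℝ :=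
  fderiv ℝ φ w (EuclideanSpace.single p 1)

/-- The composition `φ(z)` of a controlled path with a function, as a triple:
`(ζ̂¹)^{mj} = ∂_p φ^m(z) (ζ¹)^{pj}` and
`(ζ̂²)^{mjk} = ∂_p φ^m(z) (ζ²)^{pjk} + ∂_{pq} φ^m(z) (ζ¹)^{pj} (ζ¹)^{qk}`. -/
noncomputable def Triple.comp [DecidableEq ι] {ι' : Type} [Fintype ι'] (φ : Vec ι → Vec ι')
    (Z : Triple T d ι) : Triple T d ι' where
  z t := φ (Z.z t)
  ζ1 t := WithLp.toLp 2 fun m =>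
    ∑ p, pd (fun w => φ w m.1) p (Z.z t) * Z.ζ1 t (p, m.2)
  ζ2 t := WithLp.toLp 2 fun m =>
    (∑ p, pd (fun w => φ w m.1) p (Z.z t) * Z.ζ2 t (p, m.2.1, m.2.2))
      + ∑ p, ∑ q, pd (pd (fun w => φ w m.1) p) q (Z.z t)
          * Z.ζ1 t (p, m.2.1) * Z.ζ1 t (q, m.2.2)

end Controlled

section Integral

variable {T : ℝ} {l d : ℕ}

/-- The argument of `Λ` in the rough integral:
`r^{ij} δx^j + ρ^{ijk} (x²)^{kj} + δ(μ²)^{ijk₁k₂} (x³)^{k₂k₁j}`, a product of increments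
being evaluated at `(s,u)` for the left factor and at `(u,t)` for the right one. -/
noncomputable def sewing (X : Driver T d) (m : Triple T d (Fin l × Fin d))
    (s u t : Time T) : Vec (Fin l) :=
  WithLp.toLp 2 fun i =>
    (∑ j, m.r X s u (i, j) * delta1 X.x u t j)
      + (∑ j, ∑ k, m.ρ X s u ((i, j), k) * X.x2 u t (k, j))
      + ∑ j, ∑ k₁, ∑ k₂, delta1 m.ζ2 s u ((i, j), k₁, k₂) * X.x3 u t (k₂, k₁, j)

/-- `δz = J(m dx)`, where
`J(m dx)^i = m^{ij} δx^j + (μ¹)^{ijk} (x²)^{kj} + (μ²)^{ijk₁k₂} (x³)^{k₂k₁j} + Λ(sewing)^i`. -/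
def IsIntegral (X : Driver T d) (m : Triple T d (Fin l × Fin d)) (z : Time T → Vec (Fin l)) :
    Prop :=
  ∃ L : Time T → Time T → Vec (Fin l), IsLambda (sewing X m) L ∧
    ∀ (s t : Time T) (i : Fin l),
      delta1 z s t i =
        (∑ j, m.z s (i, j) * delta1 X.x s t j)
          + (∑ j, ∑ k, m.ζ1 s ((i, j), k) * X.x2 s t (k, j))
          + (∑ j, ∑ k₁, ∑ k₂, m.ζ2 s ((i, j), k₁, k₂) * X.x3 s t (k₂, k₁, j))
          + L s t i

/-- The triple `Z` is the integral of the controlled path `m`, as a controlled path: its first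
component integrates `m`, and its other components are those of the integral, `m` and `μ¹`. -/
def IsControlledIntegral (X : Driver T d) (κ : ℝ) (m : Triple T d (Fin l × Fin d))
    (Z : Triple T d (Fin l)) : Prop :=
  m.IsControlled X κ ∧ IsIntegral X m Z.z ∧ (∀ t, Z.ζ1 t = m.z t) ∧
    ∀ t i j k, Z.ζ2 t (i, j, k) = m.ζ1 t ((i, j), k)

/-- `Y ∈ Q_{κ,a,σ(a)}(ℝ^l)` solves `δy = J(σ(y) dx)`, `y_0 = a`. -/
def IsSolution (X : Driver T d) (κ : ℝ) (σ : Vec (Fin l) → Vec (Fin l × Fin d))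
    (a : Vec (Fin l)) (Y : Triple T d (Fin l)) : Prop :=
  Y.MemQ X κ a (σ a) ∧ IsControlledIntegral X κ (Y.comp σ) Y

end Integral

/-- `φ ∈ C^4_b`: four times continuously differentiable, bounded with its derivatives up to
order four. -/
def IsCb4 {E F : Type} [NormedAddCommGroup E] [NormedSpace ℝ E] [NormedAddCommGroup F]
    [NormedSpace ℝ F] (φ : E → F) : Prop :=
  ContDiff ℝ 4 φ ∧ ∃ B : ℝ, ∀ k : ℕ, k ≤ 4 → ∀ w, ‖iteratedFDeriv ℝ k φ w‖ ≤ B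

/-- The size of the driver in `C_1^γ × C_2^{2γ} × C_2^{3γ}`. -/
noncomputable def Driver.size {T : ℝ} {d : ℕ} (X : Driver T d) (γ : ℝ) : ℝ≥0∞ :=
  norm1 γ X.x + norm2 (2 * γ) X.x2 + norm2 (3 * γ) X.x3

end RoughDiff

/-!
Over `(s,t)` the equation `dy = σ(y) dx` is approximated by the third order Euler increment
`eulerIncr`. By Chen's relations, by the symmetry of the area and by Taylor's formula, composing
two consecutive Euler steps instead of taking a single one costs only `O(|t - s| ^ (4γ))`, and
`4γ > 1`. The sewing argument then shows that a path whose increments are the Euler increments up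
to some `C₂^{1+}` error has an error of order `4γ` with a universal constant, that such paths
depend in a Lipschitz way on the initial condition and on the driver, and that limits of the Euler
scheme are such paths. The term `Λ` of the rough integral of `σ(y)` is precisely this error: the
solutions are the paths of this kind, equipped with the coefficients `σ(y)` and
`∂_p σ^{ij}(y) σ^{pk}(y)`.
-/

namespace RoughDiff

open Asymptotics Filter Set

section HolderNorms

variable {T : ℝ} {V : Type} [NormedAddCommGroup V]

theorem Time.abs_sub_le (s t : Time T) : |(t : ℝ) - s| ≤ T := by
  rw [abs_le]
  constructor <;> linarith [s.2.1, s.2.2, t.2.1, t.2.2]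

theorem Time.abs_sub_rpow_le {μ : ℝ} (hμ : 0 ≤ μ) (s t : Time T) : |(t : ℝ) - s| ^ μ ≤ T ^ μ :=
  Real.rpow_le_rpow (abs_nonneg _) (Time.abs_sub_le s t) hμ

theorem rpow_le_rpow_sub_mul_rpow {h T μ ν : ℝ} (hh : 0 ≤ h) (hT : h ≤ T) (hμ : 0 ≤ μ)
    (hμν : μ ≤ ν) : h ^ ν ≤ T ^ (ν - μ) * h ^ μ := by
  have hsplit : h ^ ν = h ^ (ν - μ) * h ^ μ := by
    rw [← Real.rpow_add_of_nonneg hh (by linarith) hμ, sub_add_cancel]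
  rw [hsplit]
  gcongr

theorem norm2_le_of_bound {μ C : ℝ} {f : Time T → Time T → V}
    (h : ∀ s t, ‖f s t‖ ≤ C * |(t : ℝ) - s| ^ μ) : norm2 μ f ≤ ENNReal.ofReal C := by
  refine iSup₂_le fun s t => ENNReal.div_le_of_le_mul ?_
  rw [← ENNReal.ofReal_mul' (Real.rpow_nonneg (abs_nonneg _) _), ← ofReal_norm]
  exact ENNReal.ofReal_le_ofReal (h s t)

theorem norm_le_of_norm2_le {μ C : ℝ} (hC : 0 ≤ C) {f : Time T → Time T → V}
    (h : norm2 μ f ≤ ENNReal.ofReal C) (s t : Time T) : ‖f s t‖ ≤ C * |(t : ℝ) - s| ^ μ := by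
  have hst : ‖f s t‖ₑ / ENNReal.ofReal (|(t : ℝ) - s| ^ μ) ≤ ENNReal.ofReal C :=
    (le_iSup₂ (f := fun s t : Time T =>
      ‖f s t‖ₑ / ENNReal.ofReal (|(t : ℝ) - (s : ℝ)| ^ μ)) s t).trans h
  rw [ENNReal.div_le_iff_le_mul (Or.inr ENNReal.ofReal_ne_top) (Or.inl ENNReal.ofReal_ne_top),
    ← ENNReal.ofReal_mul hC, ← ofReal_norm] at hst
  exact (ENNReal.ofReal_le_ofReal_iff
    (mul_nonneg hC (Real.rpow_nonneg (abs_nonneg _) _))).1 hst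

theorem eq_zero_of_bound {μ C : ℝ} (hμ : 0 < μ) {f : Time T → Time T → V}
    (h : ∀ s t, ‖f s t‖ ≤ C * |(t : ℝ) - s| ^ μ) (s : Time T) : f s s = 0 := by
  have hs := h s s
  rwa [sub_self, abs_zero, Real.zero_rpow hμ.ne', mul_zero, norm_le_zero_iff] at hs

theorem memC2_of_bound {μ ν C : ℝ} (hμ : 0 < μ) (hμν : μ ≤ ν) {f : Time T → Time T → V}
    (h : ∀ s t, ‖f s t‖ ≤ C * |(t : ℝ) - s| ^ ν) : MemC2 μ f := by
  refine ⟨eq_zero_of_bound (hμ.trans_le hμν) h, ?_⟩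
  refine (norm2_le_of_bound (C := |C| * T ^ (ν - μ)) fun s t => ?_).trans_lt
    ENNReal.ofReal_lt_top
  calc ‖f s t‖ ≤ |C| * |(t : ℝ) - s| ^ ν := (h s t).trans (by gcongr; exact le_abs_self C)
    _ ≤ |C| * (T ^ (ν - μ) * |(t : ℝ) - s| ^ μ) := by
        gcongr
        exact rpow_le_rpow_sub_mul_rpow (abs_nonneg _) (Time.abs_sub_le s t) hμ.le hμν
    _ = _ := (mul_assoc _ _ _).symm

theorem MemC2.tendsto_zero {β : Type*} {F : Filter β} {μ : ℝ} (hμ : 0 < μ)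
    {f : Time T → Time T → V} (hf : MemC2 μ f) {u v : β → Time T} {s : Time T}
    (hu : Tendsto u F (nhds s)) (hv : Tendsto v F (nhds s)) :
    Tendsto (fun b => f (u b) (v b)) F (nhds 0) := by
  obtain ⟨C, hC⟩ := hf.bound
  refine squeeze_zero_norm (fun b => hC (u b) (v b)) ?_
  have hsub : Tendsto (fun b => |(v b : ℝ) - u b|) F (nhds 0) := by
    simpa using (((continuous_subtype_val.tendsto s).comp hv).sub
      ((continuous_subtype_val.tendsto s).comp hu)).abs
  simpa [Real.zero_rpow hμ.ne'] using (hsub.rpow_const (Or.inr hμ.le)).const_mul C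

theorem memC1_of_bound {μ ν C : ℝ} (hμ : 0 < μ) (hμν : μ ≤ ν) {g : Time T → V}
    (h : ∀ s t, ‖g t - g s‖ ≤ C * |(t : ℝ) - s| ^ ν) : MemC1 μ g := by
  have hδ : MemC2 μ (delta1 g) := memC2_of_bound hμ hμν h
  refine ⟨continuous_iff_continuousAt.2 fun s => ?_, hδ.2⟩
  exact tendsto_sub_nhds_zero_iff.1 (hδ.tendsto_zero hμ tendsto_const_nhds tendsto_id)

/-- Both arguments can be moved since `f_{uv} = f_{us} + f_{st} + f_{tv} + δf_{ust} + δf_{utv}`. -/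
theorem MemC2.continuous_of_delta2 {μ : ℝ} (hμ : 0 < μ) {f : Time T → Time T → V}
    (hf : MemC2 μ f)
    (hδ : Continuous fun p : Time T × Time T × Time T => delta2 f p.1 p.2.1 p.2.2) :
    Continuous fun p : Time T × Time T => f p.1 p.2 := by
  refine continuous_iff_continuousAt.2 fun ⟨s, t⟩ => ?_
  have hu : Tendsto (fun p : Time T × Time T => p.1) (nhds (s, t)) (nhds s) :=
    continuous_fst.tendsto _
  have hv : Tendsto (fun p : Time T × Time T => p.2) (nhds (s, t)) (nhds t) :=
    continuous_snd.tendsto _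
  have hus := hf.tendsto_zero hμ hu tendsto_const_nhds
  have htv := hf.tendsto_zero hμ tendsto_const_nhds hv
  have hδs : Tendsto (fun p : Time T × Time T => delta2 f p.1 s t) (nhds (s, t)) (nhds 0) := by
    have hcont : Continuous fun p : Time T × Time T => delta2 f p.1 s t :=
      hδ.comp (continuous_fst.prodMk (continuous_const (y := (s, t))))
    simpa [delta2, hf.1] using hcont.tendsto (s, t)
  have hδt : Tendsto (fun p : Time T × Time T => delta2 f p.1 t p.2) (nhds (s, t)) (nhds 0) := by
    have hcont : Continuous fun p : Time T × Time T => delta2 f p.1 t p.2 :=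
      hδ.comp (continuous_fst.prodMk (continuous_const.prodMk continuous_snd))
    simpa [delta2, hf.1] using hcont.tendsto (s, t)
  have hsum := (((hus.add_const (f s t)).add htv).add hδs).add hδt
  simp only [zero_add, add_zero] at hsum
  refine hsum.congr fun p => ?_
  simp only [delta2]
  abel

end HolderNorms

section Sewing

/-- The factor `exp (c h ^ α)`, where `c` is such that passing from `h` to `h / 2` gains enough
to absorb a perturbation of relative size `A h ^ α`, see `two_add_mul_halvingWeight_le`. -/
noncomputable def halvingWeight (A α h : ℝ) : ℝ := Real.exp (A / 2 / (1 - 2 ^ (-α)) * h ^ α)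

/-- A solution `m` of the inequality `(2 + A h ^ α) m (h / 2) + h ^ μ ≤ m h`. -/
noncomputable def sewingMajorant (A α μ h : ℝ) : ℝ :=
  h ^ μ * halvingWeight A α h / (1 - 2 ^ (1 - μ))

variable {A α μ h : ℝ}

theorem two_rpow_lt_one {p : ℝ} (hp : p < 0) : (2 : ℝ) ^ p < 1 :=
  Real.rpow_lt_one_of_one_lt_of_neg one_lt_two hp

theorem halvingWeight_coeff_nonneg (hA : 0 ≤ A) (hα : 0 < α) : 0 ≤ A / 2 / (1 - 2 ^ (-α)) :=
  div_nonneg (by positivity) (sub_nonneg.2 (two_rpow_lt_one (neg_lt_zero.2 hα)).le)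

theorem one_le_halvingWeight (hA : 0 ≤ A) (hα : 0 < α) (hh : 0 ≤ h) :
    1 ≤ halvingWeight A α h :=
  Real.one_le_exp (mul_nonneg (halvingWeight_coeff_nonneg hA hα) (by positivity))

theorem halvingWeight_le_halvingWeight (hA : 0 ≤ A) (hα : 0 < α) {h' : ℝ} (hh : 0 ≤ h)
    (hh' : h ≤ h') : halvingWeight A α h ≤ halvingWeight A α h' :=
  Real.exp_le_exp.2 (mul_le_mul_of_nonneg_left (Real.rpow_le_rpow hh hh' hα.le)
    (halvingWeight_coeff_nonneg hA hα))

theorem div_two_rpow (hh : 0 ≤ h) (ν : ℝ) : (h / 2) ^ ν = h ^ ν * 2 ^ (-ν) := by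
  rw [Real.div_rpow hh zero_le_two, Real.rpow_neg zero_le_two, div_eq_mul_inv]

theorem two_add_mul_halvingWeight_le (hα : 0 < α) (hh : 0 ≤ h) :
    (2 + A * h ^ α) * halvingWeight A α (h / 2) ≤ 2 * halvingWeight A α h := by
  have hne : 1 - (2 : ℝ) ^ (-α) ≠ 0 := (sub_pos.2 (two_rpow_lt_one (neg_lt_zero.2 hα))).ne'
  have hexp : 2 + A * h ^ α ≤ 2 * Real.exp (A / 2 * h ^ α) := by
    linarith [Real.add_one_le_exp (A / 2 * h ^ α)]
  have hsplit : Real.exp (A / 2 * h ^ α) * halvingWeight A α (h / 2) = halvingWeight A α h := by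
    rw [halvingWeight, halvingWeight, ← Real.exp_add, div_two_rpow hh]
    congr 1
    field_simp
    ring
  calc _ ≤ 2 * Real.exp (A / 2 * h ^ α) * halvingWeight A α (h / 2) :=
        mul_le_mul_of_nonneg_right hexp (Real.exp_pos _).le
    _ = _ := by rw [mul_assoc, hsplit]

theorem two_add_mul_rpow_mul_halvingWeight_le (hα : 0 < α) (hh : 0 ≤ h) (ν : ℝ) :
    (2 + A * h ^ α) * ((h / 2) ^ ν * halvingWeight A α (h / 2)) ≤
      2 ^ (1 - ν) * (h ^ ν * halvingWeight A α h) := by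
  calc _ = (h / 2) ^ ν * ((2 + A * h ^ α) * halvingWeight A α (h / 2)) := by ring
    _ ≤ (h / 2) ^ ν * (2 * halvingWeight A α h) :=
        mul_le_mul_of_nonneg_left (two_add_mul_halvingWeight_le hα hh) (by positivity)
    _ = _ := by
        rw [div_two_rpow hh, sub_eq_add_neg, Real.rpow_add two_pos, Real.rpow_one]
        ring

theorem sewingMajorant_nonneg (hμ : 1 < μ) (hh : 0 ≤ h) : 0 ≤ sewingMajorant A α μ h :=
  div_nonneg (mul_nonneg (by positivity) (Real.exp_pos _).le)
    (sub_nonneg.2 (two_rpow_lt_one (by linarith)).le)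

theorem sewingMajorant_le_sewingMajorant (hA : 0 ≤ A) (hα : 0 < α) (hμ : 1 < μ) {h' : ℝ}
    (hh : 0 ≤ h) (hh' : h ≤ h') : sewingMajorant A α μ h ≤ sewingMajorant A α μ h' := by
  have hgap : (2 : ℝ) ^ (1 - μ) < 1 := two_rpow_lt_one (by linarith)
  refine div_le_div_of_nonneg_right ?_ (by linarith)
  exact mul_le_mul (Real.rpow_le_rpow hh hh' (by linarith))
    (halvingWeight_le_halvingWeight hA hα hh hh') (Real.exp_pos _).le
    (Real.rpow_nonneg (hh.trans hh') _)

theorem sewingMajorant_half (hA : 0 ≤ A) (hα : 0 < α) (hμ : 1 < μ) (hh : 0 ≤ h) :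
    (2 + A * h ^ α) * sewingMajorant A α μ (h / 2) + h ^ μ ≤ sewingMajorant A α μ h := by
  have hgap : 0 < 1 - (2 : ℝ) ^ (1 - μ) := sub_pos.2 (two_rpow_lt_one (by linarith))
  have hhalf := two_add_mul_rpow_mul_halvingWeight_le (A := A) hα hh μ
  have hone : h ^ μ ≤ h ^ μ * halvingWeight A α h :=
    le_mul_of_one_le_right (by positivity) (one_le_halvingWeight hA hα hh)
  simp only [sewingMajorant]
  rw [← mul_div_assoc, div_add' _ _ _ hgap.ne', div_le_div_iff_of_pos_right hgap]
  have := mul_le_mul_of_nonneg_right hone hgap.le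
  linarith

theorem sewingMajorant_le (hA : 0 ≤ A) (hα : 0 < α) (hμ : 1 < μ) {T : ℝ} (hh : 0 ≤ h)
    (hT : h ≤ T) :
    sewingMajorant A α μ h ≤ halvingWeight A α T / (1 - 2 ^ (1 - μ)) * h ^ μ := by
  have hgap : (2 : ℝ) ^ (1 - μ) < 1 := two_rpow_lt_one (by linarith)
  rw [sewingMajorant, div_mul_eq_mul_div, mul_comm]
  refine div_le_div_of_nonneg_right ?_ (by linarith)
  exact mul_le_mul_of_nonneg_right (halvingWeight_le_halvingWeight hA hα hh hT) (by positivity)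

theorem sewingConst_nonneg (T : ℝ) (hμ : 1 < μ) :
    0 ≤ halvingWeight A α T / (1 - 2 ^ (1 - μ)) :=
  div_nonneg (Real.exp_pos _).le (sub_nonneg.2 (two_rpow_lt_one (by linarith)).le)

section Continuous

variable {T : ℝ}

/-- The midpoint of two times. The interval `Time T` carries no affine structure, so that
Mathlib's `midpoint` does not apply. -/
noncomputable def mid (s t : Time T) : Time T :=
  ⟨((s : ℝ) + t) / 2, by constructor <;> linarith [s.2.1, s.2.2, t.2.1, t.2.2]⟩

theorem abs_mid_sub_left (s t : Time T) : |(mid s t : ℝ) - s| = |(t : ℝ) - s| / 2 := by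
  have : (mid s t : ℝ) - s = ((t : ℝ) - s) / 2 := by simp only [mid]; ring
  rw [this, abs_div, abs_two]

theorem abs_sub_mid_right (s t : Time T) : |(t : ℝ) - mid s t| = |(t : ℝ) - s| / 2 := by
  have : (t : ℝ) - mid s t = ((t : ℝ) - s) / 2 := by simp only [mid]; ring
  rw [this, abs_div, abs_two]

theorem mid_mem {S : Set (Time T)} (hS : S.OrdConnected) {s t : Time T} (hs : s ∈ S)
    (ht : t ∈ S) : mid s t ∈ S := by
  refine hS.uIcc_subset hs ht ?_
  rcases le_total s t with hst | hst
  · have hst' : (s : ℝ) ≤ t := hst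
    rw [uIcc_of_le hst]
    constructor <;> simp only [← Subtype.coe_le_coe, mid] <;> linarith
  · have hst' : (t : ℝ) ≤ s := hst
    rw [uIcc_of_ge hst]
    constructor <;> simp only [← Subtype.coe_le_coe, mid] <;> linarith

theorem le_of_halving (hA : 0 ≤ A) (hα : 0 < α) (hμ : 1 < μ) {S : Set (Time T)}
    (hS : S.OrdConnected) {g : Time T → Time T → ℝ} {B C ν : ℝ} (hB : 0 ≤ B)
    (hhalf : ∀ s ∈ S, ∀ t ∈ S, g s t ≤ (1 + A * |(t : ℝ) - s| ^ α) * g s (mid s t)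
      + g (mid s t) t + B * |(t : ℝ) - s| ^ μ)
    (hsmall : ∀ s ∈ S, ∀ t ∈ S, g s t ≤ C * |(t : ℝ) - s| ^ ν) (n : ℕ) :
    ∀ s ∈ S, ∀ t ∈ S, g s t ≤ B * sewingMajorant A α μ |(t : ℝ) - s|
      + |C| * (2 ^ (1 - ν)) ^ n * (|(t : ℝ) - s| ^ ν * halvingWeight A α |(t : ℝ) - s|) := by
  induction n with
  | zero =>
    intro s hs t ht
    have hmajorant := mul_nonneg hB
      (sewingMajorant_nonneg (A := A) (α := α) hμ (abs_nonneg ((t : ℝ) - s)))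
    have hweight : C * |(t : ℝ) - s| ^ ν ≤
        |C| * (|(t : ℝ) - s| ^ ν * halvingWeight A α |(t : ℝ) - s|) :=
      mul_le_mul (le_abs_self C) (le_mul_of_one_le_right (by positivity)
        (one_le_halvingWeight hA hα (abs_nonneg _))) (by positivity) (abs_nonneg C)
    rw [pow_zero, mul_one]
    linarith [hsmall s hs t ht]
  | succ n ih =>
    intro s hs t ht
    have hleft := ih s hs _ (mid_mem hS hs ht)
    have hright := ih _ (mid_mem hS hs ht) t ht
    have hst := hhalf s hs t ht
    rw [abs_mid_sub_left] at hleft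
    rw [abs_sub_mid_right] at hright
    have h0 : 0 ≤ |(t : ℝ) - s| := abs_nonneg _
    set h := |(t : ℝ) - s|
    have hmajorant := mul_le_mul_of_nonneg_left (sewingMajorant_half hA hα hμ h0) hB
    have hgeometric := mul_le_mul_of_nonneg_left
      (two_add_mul_rpow_mul_halvingWeight_le (A := A) hα h0 ν)
      (show 0 ≤ |C| * ((2 : ℝ) ^ (1 - ν)) ^ n by positivity)
    have hleft' := mul_le_mul_of_nonneg_left hleft (show 0 ≤ 1 + A * h ^ α by positivity)
    rw [pow_succ]
    linarith

theorem exists_sewing_bound (T : ℝ) (hA : 0 ≤ A) (hα : 0 < α) (hμ : 1 < μ) :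
    ∃ K : ℝ, 0 ≤ K ∧ ∀ S : Set (Time T), S.OrdConnected →
      ∀ (g : Time T → Time T → ℝ) (B C ν : ℝ), 0 ≤ B → 1 < ν →
      (∀ s ∈ S, ∀ t ∈ S, g s t ≤ (1 + A * |(t : ℝ) - s| ^ α) * g s (mid s t)
        + g (mid s t) t + B * |(t : ℝ) - s| ^ μ) →
      (∀ s ∈ S, ∀ t ∈ S, g s t ≤ C * |(t : ℝ) - s| ^ ν) →
      ∀ s ∈ S, ∀ t ∈ S, g s t ≤ K * B * |(t : ℝ) - s| ^ μ := by
  refine ⟨halvingWeight A α T / (1 - 2 ^ (1 - μ)), sewingConst_nonneg T hμ,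
    fun S hS g B C ν hB hν hhalf hsmall s hs t ht => ?_⟩
  have hlim := (((tendsto_pow_atTop_nhds_zero_of_lt_one (by positivity)
    (two_rpow_lt_one (sub_neg.2 hν))).const_mul |C|).mul_const
    (|(t : ℝ) - s| ^ ν * halvingWeight A α |(t : ℝ) - s|)).const_add
    (B * sewingMajorant A α μ |(t : ℝ) - s|)
  rw [mul_zero, zero_mul, add_zero] at hlim
  calc g s t ≤ B * sewingMajorant A α μ |(t : ℝ) - s| :=
        ge_of_tendsto' hlim fun n => le_of_halving hA hα hμ hS hB hhalf hsmall n s hs t ht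
    _ ≤ B * (halvingWeight A α T / (1 - 2 ^ (1 - μ)) * |(t : ℝ) - s| ^ μ) :=
        mul_le_mul_of_nonneg_left
          (sewingMajorant_le hA hα hμ (abs_nonneg _) (Time.abs_sub_le s t)) hB
    _ = _ := by ring

end Continuous

section Discrete

theorem le_of_split_at_step (hA : 0 ≤ A) (hμ : 0 ≤ μ) {n : ℕ} {δ B : ℝ} {g : ℕ → ℕ → ℝ}
    (hδ : 0 ≤ δ) (hB : 0 ≤ B) (hstep : ∀ i, g i (i + 1) ≤ 0)
    (hsplit : ∀ i m j, i ≤ m → m ≤ j → j ≤ n →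
      g i j ≤ (1 + A * (((j : ℝ) - i) * δ) ^ α) * g i m + g m j + B * (((j : ℝ) - i) * δ) ^ μ)
    {i m j : ℕ} (him : i ≤ m) (hmj : m + 1 ≤ j) (hj : j ≤ n) :
    g i j ≤ (1 + A * (((j : ℝ) - i) * δ) ^ α) * g i m + g (m + 1) j
      + 2 * B * (((j : ℝ) - i) * δ) ^ μ := by
  have hm0 : 0 ≤ ((j : ℝ) - m) * δ :=
    mul_nonneg (sub_nonneg.2 (Nat.cast_le.2 (by omega))) hδ
  have hfirst := hsplit i m j him (by omega) hj
  have hsecond := hsplit m (m + 1) j (by omega) hmj hj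
  have hzero := mul_nonpos_of_nonneg_of_nonpos
    (show 0 ≤ 1 + A * (((j : ℝ) - m) * δ) ^ α by positivity) (hstep m)
  have hpow : B * (((j : ℝ) - m) * δ) ^ μ ≤ B * (((j : ℝ) - i) * δ) ^ μ := by gcongr
  linarith

theorem le_of_discrete_halving (hA : 0 ≤ A) (hα : 0 < α) (hμ : 1 < μ) {n : ℕ} {δ B : ℝ}
    {g : ℕ → ℕ → ℝ} (hδ : 0 ≤ δ) (hB : 0 ≤ B) (hself : ∀ i, g i i ≤ 0)
    (hstep : ∀ i, g i (i + 1) ≤ 0)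
    (hsplit : ∀ i m j, i ≤ m → m ≤ j → j ≤ n →
      g i j ≤ (1 + A * (((j : ℝ) - i) * δ) ^ α) * g i m + g m j + B * (((j : ℝ) - i) * δ) ^ μ)
    (N : ℕ) : ∀ i j : ℕ, i ≤ j → j ≤ n → j ≤ i + N →
      g i j ≤ 2 * B * sewingMajorant A α μ (((j : ℝ) - i) * δ) := by
  have hlen : ∀ {i j : ℕ}, i ≤ j → 0 ≤ ((j : ℝ) - i) * δ := fun hij =>
    mul_nonneg (sub_nonneg.2 (Nat.cast_le.2 hij)) hδ
  have hnonneg : ∀ {i j : ℕ}, i ≤ j →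
      0 ≤ 2 * B * sewingMajorant A α μ (((j : ℝ) - i) * δ) := fun hij =>
    mul_nonneg (by positivity) (sewingMajorant_nonneg hμ (hlen hij))
  induction N with
  | zero =>
    intro i j hij _ hN
    obtain rfl : i = j := by omega
    exact (hself i).trans (hnonneg hij)
  | succ N ih =>
    intro i j hij hj hN
    rcases Nat.lt_or_ge j (i + 2) with hlt | hge
    · obtain rfl | rfl : j = i ∨ j = i + 1 := by omega
      · exact (hself j).trans (hnonneg hij)
      · exact (hstep i).trans (hnonneg hij)
    have hij0 := hlen hij
    have hhalf : ∀ {p q : ℕ}, p ≤ q → q ≤ n → q ≤ p + N → 2 * q ≤ 2 * p + (j - i) →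
        g p q ≤ 2 * B * sewingMajorant A α μ (((j : ℝ) - i) * δ / 2) := by
      intro p q hpq hq hN' hlen'
      refine (ih p q hpq hq hN').trans (mul_le_mul_of_nonneg_left
        (sewingMajorant_le_sewingMajorant hA hα hμ (hlen hpq) ?_) (by positivity))
      have : (2 : ℝ) * q + i ≤ 2 * p + j := by
        exact_mod_cast (by omega : 2 * q + i ≤ 2 * p + j)
      rw [mul_div_right_comm]
      exact mul_le_mul_of_nonneg_right (by linarith) hδ
    have hsum := le_of_split_at_step hA (by linarith) hδ hB hstep hsplit
      (i := i) (m := i + (j - i) / 2) (j := j) (by omega) (by omega) hj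
    have hleft := mul_le_mul_of_nonneg_left
      (hhalf (p := i) (q := i + (j - i) / 2) (by omega) (by omega) (by omega) (by omega))
      (show 0 ≤ 1 + A * (((j : ℝ) - i) * δ) ^ α by positivity)
    have hright := hhalf (p := i + (j - i) / 2 + 1) (q := j) (by omega) hj (by omega) (by omega)
    have hmajorant := mul_le_mul_of_nonneg_left (sewingMajorant_half hA hα hμ hij0)
      (show 0 ≤ 2 * B by positivity)
    linarith

theorem exists_discrete_sewing_bound (T : ℝ) (hA : 0 ≤ A) (hα : 0 < α) (hμ : 1 < μ) :
    ∃ K : ℝ, 0 ≤ K ∧ ∀ (n : ℕ) (δ B : ℝ) (g : ℕ → ℕ → ℝ), 0 ≤ δ → n * δ ≤ T → 0 ≤ B →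
      (∀ i, g i i ≤ 0) → (∀ i, g i (i + 1) ≤ 0) →
      (∀ i m j, i ≤ m → m ≤ j → j ≤ n → g i j ≤
        (1 + A * (((j : ℝ) - i) * δ) ^ α) * g i m + g m j + B * (((j : ℝ) - i) * δ) ^ μ) →
      ∀ i j : ℕ, i ≤ j → j ≤ n → g i j ≤ K * B * (((j : ℝ) - i) * δ) ^ μ := by
  refine ⟨2 * (halvingWeight A α T / (1 - 2 ^ (1 - μ))),
    mul_nonneg zero_le_two (sewingConst_nonneg T hμ),
    fun n δ B g hδ hT hB hself hstep hsplit i j hij hj => ?_⟩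
  have h0 : 0 ≤ ((j : ℝ) - i) * δ := mul_nonneg (sub_nonneg.2 (Nat.cast_le.2 hij)) hδ
  have hjT : ((j : ℝ) - i) * δ ≤ T := by
    refine le_trans (mul_le_mul_of_nonneg_right ?_ hδ) hT
    linarith [(Nat.cast_le (α := ℝ)).2 hj, (Nat.cast_nonneg i : (0 : ℝ) ≤ i)]
  calc g i j ≤ 2 * B * sewingMajorant A α μ (((j : ℝ) - i) * δ) :=
        le_of_discrete_halving hA hα hμ hδ hB hself hstep hsplit j i j hij hj (by omega)
    _ ≤ 2 * B * (halvingWeight A α T / (1 - 2 ^ (1 - μ)) * (((j : ℝ) - i) * δ) ^ μ) :=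
        mul_le_mul_of_nonneg_left (sewingMajorant_le hA hα hμ h0 hjT) (by positivity)
    _ = _ := by ring

end Discrete

end Sewing

section AlmostFlow

variable {T C α μ : ℝ} {E : Type*} [NormedAddCommGroup E]

/-- The error made in predicting by `φ s t a` the increment over `(s, t)` of a path that goes
from `a` to `b`. -/
def stepError {ι : Type*} (φ : ι → ι → E → E) (s t : ι) (a b : E) : E := b - a - φ s t a

/-- The failure of `φ` to be additive over the consecutive intervals `(s, u)` and `(u, t)`, along
a path that passes through `a` at time `s` and through `b` at time `u`. -/
def flowDefect {ι : Type*} (φ : ι → ι → E → E) (s u t : ι) (a b : E) : E :=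
  φ s u a + φ u t b - φ s t a

/-- Almost flows in the sense of Davie: maps `a ↦ a + φ s t a` that are close to the identity and
compose up to errors of order `μ`. The number `h` bounds the lengths of both intervals. -/
structure IsAlmostFlow (φ : Time T → Time T → E → E) (C α μ : ℝ) : Prop where
  norm_le : ∀ s t a, ‖φ s t a‖ ≤ C * |(t : ℝ) - s| ^ α
  norm_flowDefect_le : ∀ {s u t : Time T} {h : ℝ}, |(u : ℝ) - s| ≤ h → |(t : ℝ) - u| ≤ h →
    h ≤ T → ∀ a b, ‖flowDefect φ s u t a b‖ ≤ C * (h ^ α * ‖stepError φ s u a b‖ + h ^ μ)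

/-- Two almost flows at distance `ε`, as tested on paths whose errors are at most
`K |t - s| ^ μ`. -/
structure AlmostFlowsClose (φ φ' : Time T → Time T → E → E) (K C α μ ε : ℝ) : Prop where
  norm_sub_le : ∀ s t a a', ‖φ s t a - φ' s t a'‖ ≤ C * |(t : ℝ) - s| ^ α * (‖a - a'‖ + ε)
  norm_flowDefect_sub_le : ∀ {s u t : Time T} {h : ℝ}, |(u : ℝ) - s| ≤ h → |(t : ℝ) - u| ≤ h →
    h ≤ T → ∀ a b a' b', ‖stepError φ s u a b‖ ≤ K * h ^ μ → ‖stepError φ' s u a' b'‖ ≤ K * h ^ μ →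
      ‖flowDefect φ s u t a b - flowDefect φ' s u t a' b'‖ ≤
        C * (h ^ α * ‖stepError φ s u a b - stepError φ' s u a' b'‖ + h ^ μ * (‖a - a'‖ + ε))

variable {φ : Time T → Time T → E → E}

theorem stepError_eq_add {ι : Type*} (φ : ι → ι → E → E) (s u t : ι) (a b c : E) :
    stepError φ s t a c =
      stepError φ s u a b + stepError φ u t b c + flowDefect φ s u t a b := by
  simp only [stepError, flowDefect]
  abel

theorem IsAlmostFlow.apply_self (hφ : IsAlmostFlow φ C α μ) (hα : 0 < α) (s : Time T) (a : E) :
    φ s s a = 0 := by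
  have h := hφ.norm_le s s a
  rwa [sub_self, abs_zero, Real.zero_rpow hα.ne', mul_zero, norm_le_zero_iff] at h

theorem IsAlmostFlow.norm_stepError_le_add (hφ : IsAlmostFlow φ C α μ) {s u t : Time T} {h : ℝ}
    (hsu : |(u : ℝ) - s| ≤ h) (hut : |(t : ℝ) - u| ≤ h) (hT : h ≤ T) (a b c : E) :
    ‖stepError φ s t a c‖ ≤
      (1 + C * h ^ α) * ‖stepError φ s u a b‖ + ‖stepError φ u t b c‖ + C * h ^ μ := by
  rw [stepError_eq_add φ s u t a b c]
  linarith [norm_add₃_le (a := stepError φ s u a b) (b := stepError φ u t b c)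
    (c := flowDefect φ s u t a b), hφ.norm_flowDefect_le hsu hut hT a b]

theorem IsAlmostFlow.norm_stepError_symm_le (hφ : IsAlmostFlow φ C α μ) (hα : 0 < α)
    (s t : Time T) (a b : E) :
    ‖stepError φ t s b a‖ ≤
      (1 + C * |(t : ℝ) - s| ^ α) * ‖stepError φ s t a b‖ + C * |(t : ℝ) - s| ^ μ := by
  have hself : stepError φ s s a a = 0 := by
    rw [stepError, hφ.apply_self hα, sub_self, sub_self]
  have hsum := stepError_eq_add φ s t s a b a
  rw [hself] at hsum
  have hsymm : stepError φ t s b a = -(stepError φ s t a b + flowDefect φ s t s a b) := by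
    rw [eq_neg_iff_add_eq_zero, hsum]
    abel
  rw [hsymm, norm_neg]
  linarith [norm_add_le (stepError φ s t a b) (flowDefect φ s t s a b),
    hφ.norm_flowDefect_le le_rfl (abs_sub_comm _ _).le (Time.abs_sub_le s t) a b]

theorem abs_mid_sub_left_le (s t : Time T) : |(mid s t : ℝ) - s| ≤ |(t : ℝ) - s| := by
  linarith [abs_mid_sub_left s t, abs_nonneg ((t : ℝ) - s)]

theorem abs_sub_mid_right_le (s t : Time T) : |(t : ℝ) - mid s t| ≤ |(t : ℝ) - s| := by
  linarith [abs_sub_mid_right s t, abs_nonneg ((t : ℝ) - s)]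

variable (T E) in
theorem exists_stepError_bound (hC : 0 ≤ C) (hα : 0 < α) (hμ : 1 < μ) :
    ∃ K : ℝ, 0 ≤ K ∧ ∀ (φ : Time T → Time T → E → E) (y : Time T → E) (B ν : ℝ),
      IsAlmostFlow φ C α μ → 1 < ν →
      (∀ s t, ‖stepError φ s t (y s) (y t)‖ ≤ B * |(t : ℝ) - s| ^ ν) →
      ∀ s t, ‖stepError φ s t (y s) (y t)‖ ≤ K * |(t : ℝ) - s| ^ μ := by
  obtain ⟨K, hK0, hK⟩ := exists_sewing_bound T hC hα hμ
  refine ⟨K * C, by positivity, fun φ y B ν hφ hν hy s t => ?_⟩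
  refine hK univ ordConnected_univ (fun s t => ‖stepError φ s t (y s) (y t)‖) C B ν hC hν
    (fun s _ t _ => ?_) (fun s _ t _ => hy s t) s trivial t trivial
  exact hφ.norm_stepError_le_add (abs_mid_sub_left_le s t) (abs_sub_mid_right_le s t)
    (Time.abs_sub_le s t) _ _ _

section Stability

variable {K : ℝ}

variable (T E) in
theorem exists_stepError_sub_bound (hC : 0 ≤ C) (hK : 0 ≤ K) (hα : 0 < α) (hμ : 1 < μ) :
    ∃ G : ℝ, 0 ≤ G ∧ ∀ (φ φ' : Time T → Time T → E → E) (y y' : Time T → E) (ε : ℝ), 0 ≤ ε →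
      AlmostFlowsClose φ φ' K C α μ ε →
      (∀ s t, ‖stepError φ s t (y s) (y t)‖ ≤ K * |(t : ℝ) - s| ^ μ) →
      (∀ s t, ‖stepError φ' s t (y' s) (y' t)‖ ≤ K * |(t : ℝ) - s| ^ μ) →
      ∀ (S : Set (Time T)) (W : ℝ), S.OrdConnected → 0 ≤ W → (∀ s ∈ S, ‖y s - y' s‖ ≤ W) →
      ∀ s ∈ S, ∀ t ∈ S, ‖stepError φ s t (y s) (y t) - stepError φ' s t (y' s) (y' t)‖ ≤
        G * (W + ε) * |(t : ℝ) - s| ^ μ := by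
  obtain ⟨G, hG0, hG⟩ := exists_sewing_bound T hC hα hμ
  refine ⟨G * C, by positivity, fun φ φ' y y' ε hε hφ hy hy' S W hS hW hyy' => ?_⟩
  rw [mul_assoc G]
  refine hG S hS (fun s t => ‖stepError φ s t (y s) (y t) - stepError φ' s t (y' s) (y' t)‖)
    (C * (W + ε)) (K + K) μ (by positivity) hμ (fun s hs t _ => ?_) (fun s _ t _ => ?_)
  · set u := mid s t
    have hsmall : K * |(u : ℝ) - s| ^ μ ≤ K * |(t : ℝ) - s| ^ μ :=
      mul_le_mul_of_nonneg_left (Real.rpow_le_rpow (abs_nonneg _) (abs_mid_sub_left_le s t)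
        (zero_le_one.trans hμ.le)) hK
    have hdefect := hφ.norm_flowDefect_sub_le (abs_mid_sub_left_le s t)
      (abs_sub_mid_right_le s t) (Time.abs_sub_le s t) (y s) (y u) (y' s) (y' u)
      ((hy s u).trans hsmall) ((hy' s u).trans hsmall)
    have hdist : C * (|(t : ℝ) - s| ^ μ * (‖y s - y' s‖ + ε)) ≤
        C * (|(t : ℝ) - s| ^ μ * (W + ε)) := by
      gcongr
      exact hyy' s hs
    have hsum : stepError φ s t (y s) (y t) - stepError φ' s t (y' s) (y' t) =
        (stepError φ s u (y s) (y u) - stepError φ' s u (y' s) (y' u))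
        + (stepError φ u t (y u) (y t) - stepError φ' u t (y' u) (y' t))
        + (flowDefect φ s u t (y s) (y u) - flowDefect φ' s u t (y' s) (y' u)) := by
      rw [stepError_eq_add φ s u t _ (y u), stepError_eq_add φ' s u t _ (y' u)]
      abel
    rw [hsum]
    refine norm_add₃_le.trans ?_
    linarith
  · rw [add_mul]
    exact (norm_sub_le _ _).trans (add_le_add (hy s t) (hy' s t))

variable (T E) in
theorem exists_norm_sub_sub_sub_le (hC : 0 ≤ C) (hK : 0 ≤ K) (hα : 0 < α) (hμ : 1 < μ)
    (hαμ : α ≤ μ) :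
    ∃ G : ℝ, 0 ≤ G ∧ ∀ (φ φ' : Time T → Time T → E → E) (y y' : Time T → E) (ε : ℝ), 0 ≤ ε →
      AlmostFlowsClose φ φ' K C α μ ε →
      (∀ s t, ‖stepError φ s t (y s) (y t)‖ ≤ K * |(t : ℝ) - s| ^ μ) →
      (∀ s t, ‖stepError φ' s t (y' s) (y' t)‖ ≤ K * |(t : ℝ) - s| ^ μ) →
      ∀ (S : Set (Time T)) (W : ℝ), S.OrdConnected → 0 ≤ W → (∀ s ∈ S, ‖y s - y' s‖ ≤ W) →
      ∀ s ∈ S, ∀ t ∈ S, ‖(y t - y' t) - (y s - y' s)‖ ≤ G * (W + ε) * |(t : ℝ) - s| ^ α := by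
  obtain ⟨G, hG0, hG⟩ := exists_stepError_sub_bound T E hC hK hα hμ
  refine ⟨C + G * |T ^ (μ - α)|, by positivity,
    fun φ φ' y y' ε hε hφ hy hy' S W hS hW hyy' s hs t ht => ?_⟩
  have herror := hG φ φ' y y' ε hε hφ hy hy' S W hS hW hyy' s hs t ht
  have hincrement : ‖φ s t (y s) - φ' s t (y' s)‖ ≤ C * |(t : ℝ) - s| ^ α * (W + ε) := by
    refine (hφ.norm_sub_le s t _ _).trans ?_
    gcongr
    exact hyy' s hs
  have hpow : G * (W + ε) * |(t : ℝ) - s| ^ μ ≤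
      G * (W + ε) * (|T ^ (μ - α)| * |(t : ℝ) - s| ^ α) := by
    gcongr
    exact (rpow_le_rpow_sub_mul_rpow (abs_nonneg _) (Time.abs_sub_le s t) hα.le hαμ).trans
      (mul_le_mul_of_nonneg_right (le_abs_self _) (by positivity))
  have hsplit : (y t - y' t) - (y s - y' s) = (φ s t (y s) - φ' s t (y' s)) +
      (stepError φ s t (y s) (y t) - stepError φ' s t (y' s) (y' t)) := by
    simp only [stepError]
    abel
  rw [hsplit]
  refine (norm_add_le _ _).trans ?_
  linarith

theorem norm_add_le_two_mul_of_oscillation_le {β : Type*} {S : Set β} {w : β → E} {p : β}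
    {ε B : ℝ} (hp : p ∈ S) (hB : ∀ s ∈ S, ‖w s‖ ≤ B)
    (hosc : ∀ W, 0 ≤ W → (∀ s ∈ S, ‖w s‖ ≤ W) → ∀ t ∈ S, ‖w t - w p‖ ≤ (W + ε) / 2)
    {t : β} (ht : t ∈ S) : ‖w t‖ + ε ≤ 2 * (‖w p‖ + ε) := by
  have hbdd : BddAbove (range fun s : S => ‖w s‖) :=
    ⟨B, forall_mem_range.2 fun s => hB s s.2⟩
  have hle_sup : ∀ s ∈ S, ‖w s‖ ≤ ⨆ s : S, ‖w s‖ := fun s hs => le_ciSup hbdd ⟨s, hs⟩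
  have hsup : ⨆ s : S, ‖w s‖ ≤ ‖w p‖ + ((⨆ s : S, ‖w s‖) + ε) / 2 := by
    have : Nonempty S := ⟨⟨p, hp⟩⟩
    refine ciSup_le fun s => ?_
    linarith [hosc _ ((norm_nonneg _).trans (hle_sup p hp)) hle_sup s s.2,
      norm_le_norm_add_norm_sub' (w s) (w p)]
  linarith [hle_sup t ht]

theorem le_two_pow_mul_of_le_two_mul {f : Time T → ℝ} {δ : ℝ} (hδ : 0 ≤ δ)
    (hf : ∀ s t : Time T, s ≤ t → (t : ℝ) - s ≤ δ → f t ≤ 2 * f s) {o : Time T}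
    (ho : (o : ℝ) = 0) (n : ℕ) : ∀ t : Time T, (t : ℝ) ≤ n * δ → f t ≤ 2 ^ n * f o := by
  induction n with
  | zero =>
    intro t ht
    rw [Nat.cast_zero, zero_mul] at ht
    rw [Subtype.ext (ho.trans (le_antisymm t.2.1 ht)), pow_zero, one_mul]
  | succ n ih =>
    intro t ht
    push_cast at ht
    have hT : 0 ≤ T := t.2.1.trans t.2.2
    let s : Time T := ⟨max (t - δ) 0, le_max_right _ _, max_le (by linarith [t.2.2]) hT⟩
    have hst : s ≤ t := Subtype.coe_le_coe.1 (max_le (by linarith) t.2.1)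
    have hlen : (t : ℝ) - s ≤ δ := by linarith [le_max_left ((t : ℝ) - δ) 0]
    have hs : (s : ℝ) ≤ n * δ := max_le (by linarith) (by positivity)
    calc f t ≤ 2 * f s := hf s t hst hlen
      _ ≤ 2 * (2 ^ n * f o) := by linarith [ih s hs]
      _ = 2 ^ (n + 1) * f o := by ring

theorem exists_nat_mul_div_rpow_le (G T : ℝ) (hα : 0 < α) :
    ∃ n : ℕ, 0 < n ∧ G * (T / n) ^ α ≤ 1 / 2 := by
  have hlim : Tendsto (fun n : ℕ => G * (T / n) ^ α) atTop (nhds (G * 0 ^ α)) :=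
    ((tendsto_const_div_atTop_nhds_zero_nat T).rpow_const (Or.inr hα.le)).const_mul G
  rw [Real.zero_rpow hα.ne', mul_zero] at hlim
  obtain ⟨n, hn, hn0⟩ :=
    ((hlim.eventually_le_const one_half_pos).and (eventually_gt_atTop 0)).exists
  exact ⟨n, hn0, hn⟩

variable (T E) in
theorem exists_uniform_bound_of_local_bound {G : ℝ} (hG : 0 ≤ G) (hα : 0 < α) :
    ∃ N : ℝ, 0 ≤ N ∧ ∀ (w : Time T → E) (ε B : ℝ), 0 ≤ ε → (∀ s, ‖w s‖ ≤ B) →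
      (∀ (S : Set (Time T)) (W : ℝ), S.OrdConnected → 0 ≤ W → (∀ s ∈ S, ‖w s‖ ≤ W) →
        ∀ s ∈ S, ∀ t ∈ S, ‖w t - w s‖ ≤ G * (W + ε) * |(t : ℝ) - s| ^ α) →
      ∀ o : Time T, (o : ℝ) = 0 → ∀ t, ‖w t‖ + ε ≤ N * (‖w o‖ + ε) := by
  obtain ⟨n, hn0, hn⟩ := exists_nat_mul_div_rpow_le G T hα
  refine ⟨2 ^ n, by positivity, fun w ε B hε hB hw o ho t => ?_⟩
  have hT : 0 ≤ T := t.2.1.trans t.2.2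
  have hn0' : (n : ℝ) ≠ 0 := Nat.cast_ne_zero.2 hn0.ne'
  refine le_two_pow_mul_of_le_two_mul (f := fun t => ‖w t‖ + ε) (δ := T / n) (by positivity)
    (fun p q hpq hlen => ?_) ho n t (by rw [mul_div_cancel₀ _ hn0']; exact t.2.2)
  refine norm_add_le_two_mul_of_oscillation_le (left_mem_Icc.2 hpq) (fun s _ => hB s)
    (fun W hW hWs s hs => ?_) (right_mem_Icc.2 hpq)
  have hs' : |(s : ℝ) - p| ≤ T / n := by
    have hps : (p : ℝ) ≤ s := hs.1
    have hsq : (s : ℝ) ≤ q := hs.2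
    rw [abs_of_nonneg (by linarith)]
    linarith
  calc ‖w s - w p‖ ≤ G * (W + ε) * |(s : ℝ) - p| ^ α :=
        hw _ W ordConnected_Icc hW hWs p (left_mem_Icc.2 hpq) s hs
    _ ≤ G * (W + ε) * (T / n) ^ α := by gcongr
    _ = G * (T / n) ^ α * (W + ε) := by ring
    _ ≤ 1 / 2 * (W + ε) := by gcongr
    _ = (W + ε) / 2 := by ring

variable (T E) in
theorem exists_holder_stability (hC : 0 ≤ C) (hK : 0 ≤ K) (hα : 0 < α) (hμ : 1 < μ)
    (hαμ : α ≤ μ) :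
    ∃ c : ℝ, 0 ≤ c ∧ ∀ (φ φ' : Time T → Time T → E → E) (y y' : Time T → E) (ε B : ℝ), 0 ≤ ε →
      AlmostFlowsClose φ φ' K C α μ ε →
      (∀ s t, ‖stepError φ s t (y s) (y t)‖ ≤ K * |(t : ℝ) - s| ^ μ) →
      (∀ s t, ‖stepError φ' s t (y' s) (y' t)‖ ≤ K * |(t : ℝ) - s| ^ μ) →
      (∀ s, ‖y s - y' s‖ ≤ B) → ∀ o : Time T, (o : ℝ) = 0 →
      ∀ s t, ‖(y t - y' t) - (y s - y' s)‖ ≤ c * (‖y o - y' o‖ + ε) * |(t : ℝ) - s| ^ α := by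
  obtain ⟨G, hG0, hG⟩ := exists_norm_sub_sub_sub_le T E hC hK hα hμ hαμ
  obtain ⟨N, hN0, hN⟩ := exists_uniform_bound_of_local_bound T E hG0 hα
  refine ⟨G * N, by positivity, fun φ φ' y y' ε B hε hφ hy hy' hB o ho s t => ?_⟩
  have hlocal := hG φ φ' y y' ε hε hφ hy hy'
  have hglobal := hN (fun t => y t - y' t) ε B hε hB hlocal o ho
  have hW : 0 ≤ N * (‖y o - y' o‖ + ε) - ε := by
    linarith [hglobal s, norm_nonneg (y s - y' s)]
  have hst := hlocal univ _ ordConnected_univ hW (fun s _ => by linarith [hglobal s]) s trivial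
    t trivial
  rwa [sub_add_cancel, ← mul_assoc] at hst

end Stability

section EulerScheme

/-- The point `k T / n` of the regular grid, stopped at `T`. -/
noncomputable def grid (hT : 0 ≤ T) (n k : ℕ) : Time T := projIcc 0 T hT (k * (T / n))

theorem coe_grid (hT : 0 ≤ T) {n k : ℕ} (hk : k ≤ n) : (grid hT n k : ℝ) = k * (T / n) := by
  refine congrArg Subtype.val (projIcc_of_mem hT ⟨by positivity, ?_⟩)
  rw [mul_div_left_comm]
  exact mul_le_of_le_one_right hT
    (div_le_one_of_le₀ (Nat.cast_le.2 hk) (Nat.cast_nonneg n))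

theorem abs_coe_grid_sub (hT : 0 ≤ T) {n i j : ℕ} (hij : i ≤ j) (hj : j ≤ n) :
    |(grid hT n j : ℝ) - grid hT n i| = ((j : ℝ) - i) * (T / n) := by
  rw [coe_grid hT hj, coe_grid hT (hij.trans hj), ← sub_mul, abs_of_nonneg]
  exact mul_nonneg (sub_nonneg.2 (Nat.cast_le.2 hij)) (by positivity)

/-- The index of the last point of the grid before `t`. -/
noncomputable def gridIndex (n : ℕ) (t : Time T) : ℕ := ⌊(t : ℝ) / (T / n)⌋₊

theorem gridIndex_le (n : ℕ) (t : Time T) : gridIndex n t ≤ n := by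
  have hT : 0 ≤ T := t.2.1.trans t.2.2
  refine Nat.floor_le_of_le ?_
  rw [div_div_eq_mul_div, mul_div_right_comm]
  exact mul_le_of_le_one_left (Nat.cast_nonneg n) (div_le_one_of_le₀ t.2.2 hT)

theorem gridIndex_mono (n : ℕ) {s t : Time T} (h : s ≤ t) : gridIndex n s ≤ gridIndex n t := by
  have hT : 0 ≤ T := t.2.1.trans t.2.2
  exact Nat.floor_mono (div_le_div_of_nonneg_right h (by positivity))

theorem abs_grid_gridIndex_sub_le (hT : 0 < T) {n : ℕ} (hn : 0 < n) (t : Time T) :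
    |(grid hT.le n (gridIndex n t) : ℝ) - t| ≤ T / n := by
  have hδ : 0 < T / n := div_pos hT (Nat.cast_pos.2 hn)
  have hfloor : (gridIndex n t : ℝ) * (T / n) ≤ t :=
    (le_div_iff₀ hδ).1 (Nat.floor_le (div_nonneg t.2.1 hδ.le))
  have hceil : (t : ℝ) < ((gridIndex n t : ℝ) + 1) * (T / n) :=
    (div_lt_iff₀ hδ).1 (Nat.lt_floor_add_one _)
  rw [coe_grid hT.le (gridIndex_le n t), abs_le]
  constructor <;> linarith

theorem tendsto_grid_gridIndex (hT : 0 < T) (t : Time T) :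
    Tendsto (fun n : ℕ => grid hT.le n (gridIndex n t)) atTop (nhds t) := by
  rw [tendsto_subtype_rng, tendsto_iff_norm_sub_tendsto_zero]
  refine squeeze_zero' (Eventually.of_forall fun _ => norm_nonneg _) ?_
    (tendsto_const_div_atTop_nhds_zero_nat T)
  filter_upwards [eventually_gt_atTop 0] with n hn
  exact abs_grid_gridIndex_sub_le hT hn t

/-- The Euler scheme of `φ` along the regular grid, as a function of the index of the point. -/
noncomputable def eulerScheme (φ : Time T → Time T → E → E) (hT : 0 ≤ T) (a : E) (n : ℕ) : ℕ → E
  | 0 => a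
  | k + 1 => eulerScheme φ hT a n k
      + φ (grid hT n k) (grid hT n (k + 1)) (eulerScheme φ hT a n k)

theorem stepError_eulerScheme_succ (φ : Time T → Time T → E → E) (hT : 0 ≤ T) (a : E)
    (n i : ℕ) :
    stepError φ (grid hT n i) (grid hT n (i + 1)) (eulerScheme φ hT a n i)
      (eulerScheme φ hT a n (i + 1)) = 0 := by
  rw [stepError, eulerScheme, add_sub_cancel_left, sub_self]

theorem IsAlmostFlow.exists_stepError_eulerScheme_bound (hφ : IsAlmostFlow φ C α μ) (hT : 0 ≤ T)
    (hC : 0 ≤ C) (hα : 0 < α) (hμ : 1 < μ) :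
    ∃ K : ℝ, 0 ≤ K ∧ ∀ (a : E) (n i j : ℕ), i ≤ j → j ≤ n →
      ‖stepError φ (grid hT n i) (grid hT n j) (eulerScheme φ hT a n i)
        (eulerScheme φ hT a n j)‖ ≤ K * |(grid hT n j : ℝ) - grid hT n i| ^ μ := by
  obtain ⟨K, hK0, hK⟩ := exists_discrete_sewing_bound T hC hα hμ
  refine ⟨K * C, by positivity, fun a n i j hij hj => ?_⟩
  have hδ : 0 ≤ T / n := by positivity
  rw [abs_coe_grid_sub hT hij hj]
  refine hK n (T / n) C (fun i j => ‖stepError φ (grid hT n i) (grid hT n j)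
    (eulerScheme φ hT a n i) (eulerScheme φ hT a n j)‖) hδ ?_ hC (fun i => ?_) (fun i => ?_)
    (fun i m j him hmj hj => ?_) i j hij hj
  · rw [mul_div_left_comm]
    exact mul_le_of_le_one_right hT (div_self_le_one _)
  · rw [stepError, hφ.apply_self hα, sub_self, sub_self, norm_zero]
  · rw [stepError_eulerScheme_succ, norm_zero]
  · have him' : (i : ℝ) ≤ m := Nat.cast_le.2 him
    have hmj' : (m : ℝ) ≤ j := Nat.cast_le.2 hmj
    refine hφ.norm_stepError_le_add ?_ ?_ ?_ _ _ _
    · rw [abs_coe_grid_sub hT him (hmj.trans hj)]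
      gcongr
    · rw [abs_coe_grid_sub hT hmj hj]
      gcongr
    · rw [← abs_coe_grid_sub hT (him.trans hmj) hj]
      exact Time.abs_sub_le _ _

theorem IsAlmostFlow.exists_eulerScheme_mem_closedBall (hφ : IsAlmostFlow φ C α μ) (hT : 0 ≤ T)
    (hC : 0 ≤ C) (hα : 0 < α) (hμ : 1 < μ) (a : E) :
    ∃ R : ℝ, ∀ n i : ℕ, i ≤ n → eulerScheme φ hT a n i ∈ Metric.closedBall a R := by
  obtain ⟨K, hK0, hK⟩ := hφ.exists_stepError_eulerScheme_bound hT hC hα hμ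
  refine ⟨K * T ^ μ + C * T ^ α, fun n i hi => ?_⟩
  have herror := (hK a n 0 i (Nat.zero_le i) hi).trans
    (mul_le_mul_of_nonneg_left (Time.abs_sub_rpow_le (zero_le_one.trans hμ.le) _ _) hK0)
  have hincrement := (hφ.norm_le (grid hT n 0) (grid hT n i) a).trans
    (mul_le_mul_of_nonneg_left (Time.abs_sub_rpow_le hα.le _ _) hC)
  have hsplit : eulerScheme φ hT a n i - a = stepError φ (grid hT n 0) (grid hT n i)
      (eulerScheme φ hT a n 0) (eulerScheme φ hT a n i) + φ (grid hT n 0) (grid hT n i) a := by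
    simp only [stepError, eulerScheme]
    abel
  rw [mem_closedBall_iff_norm, hsplit]
  exact (norm_add_le _ _).trans (add_le_add herror hincrement)

theorem exists_tendsto_hyperfilter [ProperSpace E] {u : ℕ → E} {a : E} {R : ℝ}
    (hu : ∀ n, u n ∈ Metric.closedBall a R) : ∃ y, Tendsto u (hyperfilter ℕ) (nhds y) := by
  obtain ⟨y, -, hy⟩ := (isCompact_closedBall a R).ultrafilter_le_nhds
    ((hyperfilter ℕ).map u) (le_principal_iff.2 (mem_map.2 (univ_mem' hu)))
  exact ⟨y, hy⟩

theorem IsAlmostFlow.exists_forward_path [ProperSpace E] (hφ : IsAlmostFlow φ C α μ)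
    (hφc : Continuous fun p : Time T × Time T × E => φ p.1 p.2.1 p.2.2) (hT : 0 < T)
    (hC : 0 ≤ C) (hα : 0 < α) (hμ : 1 < μ) (a : E) :
    ∃ (y : Time T → E) (K : ℝ), (∀ o : Time T, (o : ℝ) = 0 → y o = a) ∧
      ∀ s t, s ≤ t → ‖stepError φ s t (y s) (y t)‖ ≤ K * |(t : ℝ) - s| ^ μ := by
  obtain ⟨K, -, hK⟩ := hφ.exists_stepError_eulerScheme_bound hT.le hC hα hμ
  obtain ⟨R, hR⟩ := hφ.exists_eulerScheme_mem_closedBall hT.le hC hα hμ a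
  choose y hy using fun t : Time T =>
    exists_tendsto_hyperfilter fun n => hR n (gridIndex n t) (gridIndex_le n t)
  refine ⟨y, K, fun o ho => ?_, fun s t hst => ?_⟩
  · refine tendsto_nhds_unique (hy o) ?_
    simp only [gridIndex, ho, zero_div, Nat.floor_zero, eulerScheme, tendsto_const_nhds_iff]
  · have hgrid : ∀ t : Time T,
        Tendsto (fun n : ℕ => grid hT.le n (gridIndex n t)) (hyperfilter ℕ) (nhds t) :=
      fun t => (tendsto_grid_gridIndex hT t).mono_left Nat.hyperfilter_le_atTop
    have herror := (((hy t).sub (hy s)).sub ((hφc.tendsto (s, t, y s)).comp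
      ((hgrid s).prodMk_nhds ((hgrid t).prodMk_nhds (hy s))))).norm
    have hbound := ((((continuous_subtype_val.tendsto t).comp (hgrid t)).sub
      ((continuous_subtype_val.tendsto s).comp (hgrid s))).abs.rpow_const
      (Or.inr (zero_le_one.trans hμ.le))).const_mul K
    exact le_of_tendsto_of_tendsto' herror hbound fun n =>
      hK a n _ _ (gridIndex_mono n hst) (gridIndex_le n t)

theorem IsAlmostFlow.exists_path [ProperSpace E] (hφ : IsAlmostFlow φ C α μ)
    (hφc : Continuous fun p : Time T × Time T × E => φ p.1 p.2.1 p.2.2) (hT : 0 < T)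
    (hC : 0 ≤ C) (hα : 0 < α) (hμ : 1 < μ) (a : E) :
    ∃ (y : Time T → E) (K : ℝ), (∀ o : Time T, (o : ℝ) = 0 → y o = a) ∧
      ∀ s t, ‖stepError φ s t (y s) (y t)‖ ≤ K * |(t : ℝ) - s| ^ μ := by
  obtain ⟨y, K, ha, hK⟩ := hφ.exists_forward_path hφc hT hC hα hμ a
  refine ⟨y, (1 + C * T ^ α) * K + C, ha, fun s t => ?_⟩
  have hforward : ∀ {s t : Time T}, s ≤ t → (1 + C * |(t : ℝ) - s| ^ α) *
      ‖stepError φ s t (y s) (y t)‖ ≤ (1 + C * T ^ α) * (K * |(t : ℝ) - s| ^ μ) := by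
    intro s t hst
    gcongr
    · exact Time.abs_sub_le s t
    · exact hK s t hst
  rcases le_total s t with hst | hts
  · have hone : ‖stepError φ s t (y s) (y t)‖ ≤
        (1 + C * |(t : ℝ) - s| ^ α) * ‖stepError φ s t (y s) (y t)‖ :=
      le_mul_of_one_le_left (norm_nonneg _) (le_add_of_nonneg_right (by positivity))
    have : 0 ≤ C * |(t : ℝ) - s| ^ μ := by positivity
    linarith [hforward hst]
  · have hbackward := hφ.norm_stepError_symm_le hα t s (y t) (y s)
    rw [abs_sub_comm]
    linarith [hforward hts]

end EulerScheme

end AlmostFlow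

section BoundedPartials

variable {ι : Type} [Fintype ι] [DecidableEq ι] {n : ℕ} {F G : Vec ι → ℝ}

/-- `F` is bounded and has bounded iterated partial derivatives up to order `n`. This
coordinatewise form of the class `C^n_b` is the one that is stable under products and under the
partial derivatives `pd`. -/
def HasBoundedPartials : ℕ → (Vec ι → ℝ) → Prop
  | 0, F => F =O[⊤] fun _ => (1 : ℝ)
  | n + 1, F => F =O[⊤] (fun _ => (1 : ℝ)) ∧ Differentiable ℝ F ∧
      ∀ p, HasBoundedPartials n (pd F p)

theorem HasBoundedPartials.isBigO_one (h : HasBoundedPartials n F) :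
    F =O[⊤] fun _ => (1 : ℝ) := by
  cases n with
  | zero => exact h
  | succ n => exact h.1

theorem HasBoundedPartials.of_succ (h : HasBoundedPartials (n + 1) F) :
    HasBoundedPartials n F := by
  induction n generalizing F with
  | zero => exact h.1
  | succ n ih => exact ⟨h.1, h.2.1, fun p => ih (h.2.2 p)⟩

theorem pd_add (hF : Differentiable ℝ F) (hG : Differentiable ℝ G) (p : ι) :
    pd (fun w => F w + G w) p = fun w => pd F p w + pd G p w := by
  funext w
  rw [pd, fderiv_fun_add (hF w) (hG w)]
  rfl

theorem pd_mul (hF : Differentiable ℝ F) (hG : Differentiable ℝ G) (p : ι) :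
    pd (fun w => F w * G w) p = fun w => F w * pd G p w + G w * pd F p w := by
  funext w
  rw [pd, fderiv_fun_mul (hF w) (hG w)]
  rfl

theorem HasBoundedPartials.add (hF : HasBoundedPartials n F) (hG : HasBoundedPartials n G) :
    HasBoundedPartials n (fun w => F w + G w) := by
  induction n generalizing F G with
  | zero => exact IsBigO.add hF hG
  | succ n ih =>
    refine ⟨hF.1.add hG.1, hF.2.1.add hG.2.1, fun p => ?_⟩
    rw [pd_add hF.2.1 hG.2.1]
    exact ih (hF.2.2 p) (hG.2.2 p)

theorem HasBoundedPartials.mul (hF : HasBoundedPartials n F) (hG : HasBoundedPartials n G) :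
    HasBoundedPartials n (fun w => F w * G w) := by
  have hbounded : (fun w => F w * G w) =O[⊤] fun _ => (1 : ℝ) := by
    simpa only [mul_one] using hF.isBigO_one.mul hG.isBigO_one
  induction n generalizing F G with
  | zero => exact hbounded
  | succ n ih =>
    refine ⟨hbounded, hF.2.1.mul hG.2.1, fun p => ?_⟩
    rw [pd_mul hF.2.1 hG.2.1]
    refine (ih hF.of_succ (hG.2.2 p) ?_).add (ih hG.of_succ (hF.2.2 p) ?_)
    · simpa only [mul_one] using hF.1.mul (hG.2.2 p).isBigO_one
    · simpa only [mul_one] using hG.1.mul (hF.2.2 p).isBigO_one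

theorem HasBoundedPartials.zero (n : ℕ) : HasBoundedPartials n (fun _ : Vec ι => (0 : ℝ)) := by
  induction n with
  | zero => exact isBigO_zero _ _
  | succ n ih =>
    refine ⟨isBigO_zero _ _, differentiable_const _, fun p => ?_⟩
    have hpd : pd (fun _ : Vec ι => (0 : ℝ)) p = fun _ => 0 := by
      funext w
      simp [pd]
    rwa [hpd]

theorem HasBoundedPartials.sum {α : Type*} (s : Finset α) {F : α → Vec ι → ℝ}
    (h : ∀ x ∈ s, HasBoundedPartials n (F x)) :
    HasBoundedPartials n (fun w => ∑ x ∈ s, F x w) := by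
  classical
  induction s using Finset.induction_on with
  | empty => simpa using HasBoundedPartials.zero n
  | insert x s hx ih =>
    simp only [Finset.sum_insert hx]
    exact (h x (by simp)).add (ih fun y hy => h y (by simp [hy]))

theorem clm_apply_eq_sum (L : Vec ι →L[ℝ] ℝ) (v : Vec ι) :
    L v = ∑ p, v p * L (EuclideanSpace.single p 1) := by
  conv_lhs => rw [← (EuclideanSpace.basisFun ι ℝ).sum_repr v]
  simp [map_sum]

theorem HasBoundedPartials.exists_lipschitz (h : HasBoundedPartials 1 F) :
    ∃ C : ℝ, ∀ v w, |F v - F w| ≤ C * ‖v - w‖ := by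
  choose B hB using fun p => isBigO_top.1 (h.2.2 p).isBigO_one
  simp only [norm_one, mul_one, Real.norm_eq_abs] at hB
  refine ⟨∑ p, B p, fun v w => ?_⟩
  refine Convex.norm_image_sub_le_of_norm_fderiv_le (𝕜 := ℝ) (s := univ)
    (fun x _ => h.2.1 x) (fun x _ => ?_) convex_univ trivial trivial
  refine ContinuousLinearMap.opNorm_le_bound _
    (Finset.sum_nonneg fun p _ => (abs_nonneg _).trans (hB p 0)) fun u => ?_
  rw [clm_apply_eq_sum, Finset.sum_mul]
  refine (norm_sum_le _ _).trans (Finset.sum_le_sum fun p _ => ?_)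
  rw [norm_mul, mul_comm]
  exact mul_le_mul (hB p x) (PiLp.norm_apply_le u p) (norm_nonneg _)
    ((abs_nonneg _).trans (hB p 0))

theorem contDiff_pd (hF : ContDiff ℝ (n + 1 : ℕ) F) (p : ι) : ContDiff ℝ n (pd F p) :=
  (hF.fderiv_right (m := n) (by norm_cast)).clm_apply contDiff_const

theorem HasBoundedPartials.of_iteratedFDeriv (hF : ContDiff ℝ n F)
    (hb : ∃ B : ℝ, ∀ k : ℕ, k ≤ n → ∀ w, ‖iteratedFDeriv ℝ k F w‖ ≤ B) :
    HasBoundedPartials n F := by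
  obtain ⟨B, hB⟩ := hb
  have hbounded : F =O[⊤] fun _ => (1 : ℝ) :=
    isBigO_top.2 ⟨B, fun w => by simpa using hB 0 (Nat.zero_le _) w⟩
  induction n generalizing F B with
  | zero => exact hbounded
  | succ n ih =>
    refine ⟨hbounded, hF.differentiable (by simp), fun p => ?_⟩
    let L : (Vec ι →L[ℝ] ℝ) →L[ℝ] ℝ :=
      ContinuousLinearMap.apply ℝ ℝ (EuclideanSpace.single p (1 : ℝ))
    have hpd : ∀ k : ℕ, k ≤ n → ∀ w, ‖iteratedFDeriv ℝ k (pd F p) w‖ ≤ ‖L‖ * B := by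
      intro k hk w
      have hc : ContDiff ℝ n (fderiv ℝ F) := hF.fderiv_right (m := n) (by norm_cast)
      refine (L.norm_iteratedFDeriv_comp_left hc.contDiffAt (by exact_mod_cast hk)).trans ?_
      rw [norm_iteratedFDeriv_fderiv]
      exact mul_le_mul_of_nonneg_left (hB _ (by omega) _) (norm_nonneg _)
    exact ih (contDiff_pd hF p) _ hpd
      (isBigO_top.2 ⟨‖L‖ * B, fun w => by simpa using hpd 0 (Nat.zero_le _) w⟩)

theorem pd_pd_comm (hF : ContDiff ℝ 2 F) (p q : ι) : pd (pd F p) q = pd (pd F q) p := by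
  funext w
  have hd : Differentiable ℝ (fderiv ℝ F) :=
    (hF.fderiv_right (m := 1) (by norm_num)).differentiable (by simp)
  have hpd : ∀ p q, pd (pd F p) q w = fderiv ℝ (fderiv ℝ F) w (EuclideanSpace.single q 1)
      (EuclideanSpace.single p 1) := by
    intro p q
    have hp : pd F p = fun v => fderiv ℝ F v (EuclideanSpace.single p 1) := rfl
    rw [hp, pd, fderiv_clm_apply (hd w) (differentiableAt_const _)]
    simp
  rw [hpd, hpd]
  exact (hF.contDiffAt.isSymmSndFDerivAt (by simp)).eq _ _

end BoundedPartials

section PairBigO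

variable {P : Type*}

/-- `f` and `f'` are of order `τ ^ k`, and their difference is of order `τ ^ k * ω`, uniformly in
the parameter. Estimates of this kind are stable under sums and products, so that the size of an
expression and its dependence on the data `ω` are tracked together. -/
structure IsPairBigO (τ ω : P → ℝ) (k : ℕ) (f f' : P → ℝ) : Prop where
  left : f =O[⊤] fun p => τ p ^ k
  right : f' =O[⊤] fun p => τ p ^ k
  sub : (fun p => f p - f' p) =O[⊤] fun p => τ p ^ k * ω p

variable {τ ω : P → ℝ} {k m : ℕ} {f f' g g' : P → ℝ}

theorem IsPairBigO.add (hf : IsPairBigO τ ω k f f') (hg : IsPairBigO τ ω k g g') :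
    IsPairBigO τ ω k (fun p => f p + g p) (fun p => f' p + g' p) where
  left := hf.left.add hg.left
  right := hf.right.add hg.right
  sub := (hf.sub.add hg.sub).congr_left fun p => by ring

theorem IsPairBigO.mul (hf : IsPairBigO τ ω k f f') (hg : IsPairBigO τ ω m g g') :
    IsPairBigO τ ω (k + m) (fun p => f p * g p) (fun p => f' p * g' p) where
  left := (hf.left.mul hg.left).congr_right fun p => by ring
  right := (hf.right.mul hg.right).congr_right fun p => by ring
  sub := by
    have hsub_mul := (hf.sub.mul hg.left).congr_right (g₂ := fun p => τ p ^ (k + m) * ω p)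
      fun p => by ring
    have hmul_sub := (hf.right.mul hg.sub).congr_right (g₂ := fun p => τ p ^ (k + m) * ω p)
      fun p => by ring
    exact (hsub_mul.add hmul_sub).congr_left fun p => by ring

theorem IsPairBigO.of_eq (hf : f =O[⊤] fun p => τ p ^ k) : IsPairBigO τ ω k f f where
  left := hf
  right := hf
  sub := (isBigO_zero (E' := ℝ) _ _).congr_left fun _ => (sub_self _).symm

theorem IsPairBigO.const (τ ω : P → ℝ) (c : ℝ) :
    IsPairBigO τ ω 0 (fun _ => c) (fun _ => c) :=
  .of_eq (isBigO_top.2 ⟨|c|, fun p => by simp⟩)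

theorem IsPairBigO.const_mul (c : ℝ) (hf : IsPairBigO τ ω k f f') :
    IsPairBigO τ ω k (fun p => c * f p) (fun p => c * f' p) := by
  simpa only [zero_add] using (IsPairBigO.const τ ω c).mul hf

theorem IsPairBigO.sum {α : Type*} (s : Finset α) {f f' : α → P → ℝ}
    (h : ∀ x ∈ s, IsPairBigO τ ω k (f x) (f' x)) :
    IsPairBigO τ ω k (fun p => ∑ x ∈ s, f x p) (fun p => ∑ x ∈ s, f' x p) := by
  classical
  induction s using Finset.induction_on with
  | empty => simpa using IsPairBigO.of_eq (τ := τ) (ω := ω) (isBigO_zero _ _)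
  | insert x s hx ih =>
    simp only [Finset.sum_insert hx]
    exact (h x (by simp)).add (ih fun y hy => h y (by simp [hy]))

theorem isBigO_pow_of_le (hτ : τ =O[⊤] fun _ => (1 : ℝ)) (hkm : k ≤ m) :
    (fun p => τ p ^ m) =O[⊤] fun p => τ p ^ k := by
  obtain ⟨n, rfl⟩ := Nat.exists_eq_add_of_le hkm
  have hprod := (isBigO_refl (fun p => τ p ^ k) ⊤).mul (hτ.pow n)
  simpa only [← pow_add, one_pow, mul_one] using hprod

theorem IsPairBigO.of_le (hτ : τ =O[⊤] fun _ => (1 : ℝ)) (hf : IsPairBigO τ ω m f f')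
    (hkm : k ≤ m) : IsPairBigO τ ω k f f' where
  left := hf.left.trans (isBigO_pow_of_le hτ hkm)
  right := hf.right.trans (isBigO_pow_of_le hτ hkm)
  sub := hf.sub.trans ((isBigO_pow_of_le hτ hkm).mul (isBigO_refl _ _))

theorem IsPairBigO.congr {f₁ f₁' : P → ℝ} (hf : IsPairBigO τ ω k f f') (h : ∀ p, f p = f₁ p)
    (h' : ∀ p, f' p = f₁' p) : IsPairBigO τ ω k f₁ f₁' := by
  rwa [← funext h, ← funext h']

theorem IsPairBigO.comp {Q : Type*} (hf : IsPairBigO τ ω k f f') (φ : Q → P) :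
    IsPairBigO (fun q => τ (φ q)) (fun q => ω (φ q)) k (fun q => f (φ q))
      (fun q => f' (φ q)) where
  left := hf.left.comp_tendsto tendsto_top
  right := hf.right.comp_tendsto tendsto_top
  sub := hf.sub.comp_tendsto tendsto_top

theorem isBigO_sub_of_hasDerivAt {f g : P → ℝ → ℝ} {e : P → ℝ}
    (hf : ∀ p θ, HasDerivAt (f p) (g p θ) θ)
    (hg : (fun q : P × Icc (0 : ℝ) 1 => g q.1 q.2) =O[⊤] fun q => e q.1) :
    (fun p => f p 1 - f p 0) =O[⊤] e := by
  obtain ⟨C, hC⟩ := isBigO_top.1 hg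
  exact isBigO_top.2 ⟨C, fun p => norm_image_sub_le_of_norm_deriv_le_segment_01'
    (fun θ _ => (hf p θ).hasDerivWithinAt) fun θ hθ => hC (p, ⟨θ, hθ.1, hθ.2.le⟩)⟩

theorem IsPairBigO.sub_of_hasDerivAt {f f' g g' : P → ℝ → ℝ}
    (hf : ∀ p θ, HasDerivAt (f p) (g p θ) θ) (hf' : ∀ p θ, HasDerivAt (f' p) (g' p θ) θ)
    (hg : IsPairBigO (fun q : P × Icc (0 : ℝ) 1 => τ q.1) (fun q => ω q.1) k
      (fun q => g q.1 q.2) (fun q => g' q.1 q.2)) :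
    IsPairBigO τ ω k (fun p => f p 1 - f p 0) (fun p => f' p 1 - f' p 0) where
  left := isBigO_sub_of_hasDerivAt hf hg.left
  right := isBigO_sub_of_hasDerivAt hf' hg.right
  sub := (isBigO_sub_of_hasDerivAt (f := fun p θ => f p θ - f' p θ)
    (e := fun p => τ p ^ k * ω p) (fun p θ => (hf p θ).sub (hf' p θ)) hg.sub).congr_left
    fun p => by ring

end PairBigO

section Taylor

variable {P : Type*} {ι : Type} [Fintype ι] {τ ω : P → ℝ} {a a' Δ Δ' : P → Vec ι}

theorem isBigO_of_coord {f : P → Vec ι} {e : P → ℝ} (h : ∀ i, (fun p => f p i) =O[⊤] e) :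
    f =O[⊤] e := by
  have hsum : (fun p => ∑ i, ‖f p i‖) =O[⊤] e := IsBigO.fun_sum fun i _ => (h i).norm_left
  refine (isBigO_of_le _ fun p => ?_).trans hsum
  rw [Real.norm_of_nonneg (by positivity), EuclideanSpace.norm_eq,
    Real.sqrt_le_left (by positivity)]
  exact Finset.sum_sq_le_sq_sum_of_nonneg fun i _ => norm_nonneg _

theorem isBigO_line_sub (hτ : τ =O[⊤] fun _ => (1 : ℝ)) (ha : (fun p => a p - a' p) =O[⊤] ω)
    (hΔ : ∀ i, IsPairBigO τ ω 1 (fun p => Δ p i) (fun p => Δ' p i)) :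
    (fun q : P × Icc (0 : ℝ) 1 => (a q.1 + (q.2 : ℝ) • Δ q.1) -
      (a' q.1 + (q.2 : ℝ) • Δ' q.1)) =O[⊤] fun q => ω q.1 := by
  have hΔsub : (fun p => Δ p - Δ' p) =O[⊤] ω :=
    isBigO_of_coord fun i => by simpa using ((hΔ i).of_le hτ (Nat.zero_le 1)).sub
  have hθΔsub : (fun q : P × Icc (0 : ℝ) 1 => (q.2 : ℝ) • (Δ q.1 - Δ' q.1)) =O[⊤]
      fun q => ω q.1 := by
    refine (isBigO_of_le _ fun q => ?_).trans (hΔsub.comp_tendsto (k := Prod.fst) tendsto_top)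
    rw [norm_smul, Real.norm_of_nonneg q.2.2.1]
    exact mul_le_of_le_one_left (norm_nonneg _) q.2.2.2
  refine ((ha.comp_tendsto (k := Prod.fst) tendsto_top).add hθΔsub).congr_left fun q => ?_
  simp only [Function.comp_apply, smul_sub]
  abel

theorem IsPairBigO.smul_line (hΔ : ∀ i, IsPairBigO τ ω 1 (fun p => Δ p i) (fun p => Δ' p i))
    (i : ι) : IsPairBigO (fun q : P × Icc (0 : ℝ) 1 => τ q.1) (fun q => ω q.1) 1
      (fun q => ((q.2 : ℝ) • Δ q.1) i) (fun q => ((q.2 : ℝ) • Δ' q.1) i) := by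
  have hθ : IsPairBigO (fun q : P × Icc (0 : ℝ) 1 => τ q.1) (fun q => ω q.1) 0
      (fun q => (q.2 : ℝ)) (fun q => (q.2 : ℝ)) := by
    refine .of_eq (isBigO_of_le _ fun q => ?_)
    simpa [abs_of_nonneg q.2.2.1] using q.2.2.2
  simpa using hθ.mul ((hΔ i).comp Prod.fst)

variable [DecidableEq ι] {F : Vec ι → ℝ}

theorem hasDerivAt_comp_line (hF : Differentiable ℝ F) (v u : Vec ι) (θ : ℝ) :
    HasDerivAt (fun θ : ℝ => F (v + θ • u)) (∑ p, u p * pd F p (v + θ • u)) θ := by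
  have hline : HasDerivAt (fun θ : ℝ => v + θ • u) u θ := by
    simpa using ((hasDerivAt_id θ).smul_const u).const_add v
  have hcomp := (hF (v + θ • u)).hasFDerivAt.comp_hasDerivAt θ hline
  rwa [clm_apply_eq_sum] at hcomp

theorem hasDerivAt_taylor_one (hF : Differentiable ℝ F) (v u : Vec ι) (θ : ℝ) :
    HasDerivAt (fun θ : ℝ => F (v + θ • u) - θ * ∑ i, u i * pd F i v)
      (∑ i, u i * (pd F i (v + θ • u) - pd F i v)) θ := by
  refine ((hasDerivAt_comp_line hF v u θ).sub
    ((hasDerivAt_id θ).mul_const (∑ i, u i * pd F i v))).congr_deriv ?_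
  simp only [one_mul, mul_sub, Finset.sum_sub_distrib]

theorem hasDerivAt_taylor_two (hF : Differentiable ℝ F) (v u : Vec ι) (θ : ℝ) :
    HasDerivAt (fun θ : ℝ => F (v + θ • u) - θ * (∑ i, u i * pd F i v)
        - θ ^ 2 * ((1 / 2) * ∑ i, u i * ∑ j, u j * pd (pd F i) j v))
      (∑ i, u i * (pd F i (v + θ • u) - pd F i v - ∑ j, (θ • u) j * pd (pd F i) j v)) θ := by
  refine ((hasDerivAt_taylor_one hF v u θ).sub ((hasDerivAt_pow 2 θ).mul_const
    ((1 / 2) * ∑ i, u i * ∑ j, u j * pd (pd F i) j v))).congr_deriv ?_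
  have hquadratic : ∑ i, u i * ∑ j, (θ • u) j * pd (pd F i) j v =
      θ * ∑ i, u i * ∑ j, u j * pd (pd F i) j v := by
    simp only [PiLp.smul_apply, smul_eq_mul, Finset.mul_sum]
    exact Finset.sum_congr rfl fun i _ => Finset.sum_congr rfl fun j _ => by ring
  simp only [mul_sub (u _) (_ - _), Finset.sum_sub_distrib, hquadratic]
  push_cast
  ring

theorem HasBoundedPartials.isPairBigO (hF : HasBoundedPartials 1 F)
    (ha : (fun p => a p - a' p) =O[⊤] ω) :
    IsPairBigO τ ω 0 (fun p => F (a p)) (fun p => F (a' p)) where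
  left := (hF.1.comp_tendsto (k := a) tendsto_top).congr_right fun _ => (pow_zero _).symm
  right := (hF.1.comp_tendsto (k := a') tendsto_top).congr_right fun _ => (pow_zero _).symm
  sub := by
    obtain ⟨C, hC⟩ := hF.exists_lipschitz
    have hsub : (fun p => F (a p) - F (a' p)) =O[⊤] fun p => a p - a' p :=
      isBigO_top.2 ⟨C, fun p => hC _ _⟩
    simpa using hsub.trans ha

theorem HasBoundedPartials.isPairBigO_taylor_zero (hτ : τ =O[⊤] fun _ => (1 : ℝ))
    (hF : HasBoundedPartials 2 F) (ha : (fun p => a p - a' p) =O[⊤] ω)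
    (hΔ : ∀ i, IsPairBigO τ ω 1 (fun p => Δ p i) (fun p => Δ' p i)) :
    IsPairBigO τ ω 1 (fun p => F (a p + Δ p) - F (a p))
      (fun p => F (a' p + Δ' p) - F (a' p)) := by
  have hderiv := IsPairBigO.sub_of_hasDerivAt (τ := τ) (ω := ω) (k := 1)
    (fun p => hasDerivAt_comp_line hF.2.1 (a p) (Δ p))
    (fun p => hasDerivAt_comp_line hF.2.1 (a' p) (Δ' p)) (IsPairBigO.sum _ fun i _ =>
      ((hΔ i).comp Prod.fst).mul ((hF.2.2 i).isPairBigO (isBigO_line_sub hτ ha hΔ)))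
  simpa only [one_smul, zero_smul, add_zero] using hderiv

theorem HasBoundedPartials.isPairBigO_taylor_one (hτ : τ =O[⊤] fun _ => (1 : ℝ))
    (hF : HasBoundedPartials 3 F) (ha : (fun p => a p - a' p) =O[⊤] ω)
    (hΔ : ∀ i, IsPairBigO τ ω 1 (fun p => Δ p i) (fun p => Δ' p i)) :
    IsPairBigO τ ω 2 (fun p => F (a p + Δ p) - F (a p) - ∑ i, Δ p i * pd F i (a p))
      (fun p => F (a' p + Δ' p) - F (a' p) - ∑ i, Δ' p i * pd F i (a' p)) := by
  have hderiv := IsPairBigO.sub_of_hasDerivAt (τ := τ) (ω := ω) (k := 2)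
    (fun p => hasDerivAt_taylor_one hF.2.1 (a p) (Δ p))
    (fun p => hasDerivAt_taylor_one hF.2.1 (a' p) (Δ' p)) (IsPairBigO.sum _ fun i _ =>
      ((hΔ i).comp Prod.fst).mul ((hF.2.2 i).isPairBigO_taylor_zero (hτ.comp_tendsto tendsto_top)
        (ha.comp_tendsto tendsto_top) (IsPairBigO.smul_line hΔ)))
  simpa only [one_smul, zero_smul, add_zero, one_mul, zero_mul, sub_zero, sub_right_comm]
    using hderiv

theorem HasBoundedPartials.isPairBigO_taylor_two (hτ : τ =O[⊤] fun _ => (1 : ℝ))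
    (hF : HasBoundedPartials 4 F) (ha : (fun p => a p - a' p) =O[⊤] ω)
    (hΔ : ∀ i, IsPairBigO τ ω 1 (fun p => Δ p i) (fun p => Δ' p i)) :
    IsPairBigO τ ω 3
      (fun p => F (a p + Δ p) - F (a p) - (∑ i, Δ p i * pd F i (a p))
        - (1 / 2) * ∑ i, Δ p i * ∑ j, Δ p j * pd (pd F i) j (a p))
      (fun p => F (a' p + Δ' p) - F (a' p) - (∑ i, Δ' p i * pd F i (a' p))
        - (1 / 2) * ∑ i, Δ' p i * ∑ j, Δ' p j * pd (pd F i) j (a' p)) := by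
  have hderiv := IsPairBigO.sub_of_hasDerivAt (τ := τ) (ω := ω) (k := 3)
    (fun p => hasDerivAt_taylor_two hF.2.1 (a p) (Δ p))
    (fun p => hasDerivAt_taylor_two hF.2.1 (a' p) (Δ' p)) (IsPairBigO.sum _ fun i _ =>
      ((hΔ i).comp Prod.fst).mul ((hF.2.2 i).isPairBigO_taylor_one (hτ.comp_tendsto tendsto_top)
        (ha.comp_tendsto tendsto_top) (IsPairBigO.smul_line hΔ)))
  refine hderiv.congr (fun p => ?_) (fun p => ?_) <;>
  · simp only [one_smul, zero_smul, add_zero]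
    ring

end Taylor

section EulerScheme

variable {l d : ℕ}

/-- The values of the three components of a driver over a pair of times. -/
structure Incr (d : ℕ) where
  x1 : Vec (Fin d)
  x2 : Vec (Fin d × Fin d)
  x3 : Vec (Fin d × Fin d × Fin d)

/-- The increment of a driver over `(s,t)`. -/
noncomputable def Driver.inc {T : ℝ} (X : Driver T d) (s t : Time T) : Incr d :=
  ⟨delta1 X.x s t, X.x2 s t, X.x3 s t⟩

/-- The relation between path and area in a geometric driver. -/
def Incr.IsGeometric (ξ : Incr d) : Prop :=
  ∀ i j, ξ.x2 (i, j) + ξ.x2 (j, i) = ξ.x1 i * ξ.x1 j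

variable (σ : Vec (Fin l) → Vec (Fin l × Fin d))

/-- The area coefficient `∂_p σ^m σ^{pk}` of the Euler scheme: the first derivative component of
`σ(y)` along a solution `y`. -/
noncomputable def eulerCoeff1 (m : Fin l × Fin d) (k : Fin d) (y : Vec (Fin l)) : ℝ :=
  ∑ p, pd (fun w => σ w m) p y * σ y (p, k)

/-- The volume coefficient `∂_p σ^m ∂_q σ^{pj} σ^{qk} + ∂_{pq} σ^m σ^{pj} σ^{qk}` of the Euler
scheme: the second derivative component of `σ(y)` along a solution `y`. -/
noncomputable def eulerCoeff2 (m : Fin l × Fin d) (j k : Fin d) (y : Vec (Fin l)) : ℝ :=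
  (∑ p, pd (fun w => σ w m) p y * eulerCoeff1 σ (p, j) k y)
    + ∑ p, ∑ q, pd (pd (fun w => σ w m) p) q y * σ y (p, j) * σ y (q, k)

/-- The contribution of the path to the Euler increment. -/
noncomputable def eulerPath (ξ : Incr d) (y : Vec (Fin l)) (i : Fin l) : ℝ :=
  ∑ j, σ y (i, j) * ξ.x1 j

/-- The contribution of the area to the Euler increment. -/
noncomputable def eulerArea (ξ : Incr d) (y : Vec (Fin l)) (i : Fin l) : ℝ :=
  ∑ j, ∑ k, eulerCoeff1 σ (i, j) k y * ξ.x2 (k, j)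

/-- The contribution of the volume to the Euler increment. -/
noncomputable def eulerVolume (ξ : Incr d) (y : Vec (Fin l)) (i : Fin l) : ℝ :=
  ∑ j, ∑ k₁, ∑ k₂, eulerCoeff2 σ (i, j) k₁ k₂ y * ξ.x3 (k₂, k₁, j)

/-- The third order Euler increment of `dy = σ(y) dx` from the point `y`. -/
noncomputable def eulerIncr (ξ : Incr d) (y : Vec (Fin l)) : Vec (Fin l) :=
  WithLp.toLp 2 fun i => eulerPath σ ξ y i + eulerArea σ ξ y i + eulerVolume σ ξ y i

/-- The remainder, between the points `a` and `b`, of the second order expansion of `σ^m` along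
the driver. -/
noncomputable def coeffRem0 (ξ : Incr d) (a b : Vec (Fin l)) (m : Fin l × Fin d) : ℝ :=
  σ b m - σ a m - (∑ k, eulerCoeff1 σ m k a * ξ.x1 k)
    - ∑ j, ∑ k, eulerCoeff2 σ m j k a * ξ.x2 (k, j)

/-- The remainder, between the points `a` and `b`, of the first order expansion of
`eulerCoeff1 σ m j` along the driver. -/
noncomputable def coeffRem1 (ξ : Incr d) (a b : Vec (Fin l)) (m : Fin l × Fin d)
    (j : Fin d) : ℝ :=
  eulerCoeff1 σ m j b - eulerCoeff1 σ m j a - ∑ k, eulerCoeff2 σ m j k a * ξ.x1 k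

/-- The defect of additivity of the Euler increments over two consecutive intervals, with
increments `ξ` and `η` of the driver, when the second one starts from `b` and the first one
from `a`. By Chen's relations it is a sum of products of remainders with `η`. -/
noncomputable def eulerDefect (ξ η : Incr d) (a b : Vec (Fin l)) : Vec (Fin l) :=
  WithLp.toLp 2 fun i =>
    (∑ j, coeffRem0 σ ξ a b (i, j) * η.x1 j)
      + (∑ j, ∑ k, coeffRem1 σ ξ a b (i, j) k * η.x2 (k, j))
      + ∑ j, ∑ k₁, ∑ k₂, (eulerCoeff2 σ (i, j) k₁ k₂ b - eulerCoeff2 σ (i, j) k₁ k₂ a)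
          * η.x3 (k₂, k₁, j)

/-- The coordinatewise form of the regularity of the vector field. -/
structure IsRegular : Prop where
  bounded : ∀ m, HasBoundedPartials 4 fun w => σ w m
  contDiff : ∀ m, ContDiff ℝ 2 fun w => σ w m

variable {σ}

theorem IsCb4.isRegular (hσ : IsCb4 σ) : IsRegular σ := by
  obtain ⟨hc, B, hB⟩ := hσ
  have hcoord : ∀ m, ContDiff ℝ 4 fun w => σ w m := fun m =>
    (EuclideanSpace.proj (𝕜 := ℝ) m).contDiff.comp hc
  refine ⟨fun m => .of_iteratedFDeriv (hcoord m) ?_,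
    fun m => (hcoord m).of_le (by norm_num)⟩
  let L : Vec (Fin l × Fin d) →L[ℝ] ℝ := EuclideanSpace.proj m
  refine ⟨‖L‖ * B, fun k hk w => ?_⟩
  refine (L.norm_iteratedFDeriv_comp_left hc.contDiffAt (by exact_mod_cast hk)).trans ?_
  exact mul_le_mul_of_nonneg_left (hB k hk w) (norm_nonneg _)

theorem IsRegular.bounded_eulerCoeff1 (hσ : IsRegular σ) (m : Fin l × Fin d) (k : Fin d) :
    HasBoundedPartials 3 (eulerCoeff1 σ m k) :=
  .sum _ fun p _ => ((hσ.bounded m).2.2 p).mul (hσ.bounded (p, k)).of_succ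

theorem IsRegular.bounded_eulerCoeff2 (hσ : IsRegular σ) (m : Fin l × Fin d) (j k : Fin d) :
    HasBoundedPartials 2 (eulerCoeff2 σ m j k) :=
  (HasBoundedPartials.sum _ fun p _ =>
    ((hσ.bounded m).2.2 p).of_succ.mul (hσ.bounded_eulerCoeff1 (p, j) k).of_succ).add
  (.sum _ fun p _ => .sum _ fun q _ => ((((hσ.bounded m).2.2 p).2.2 q).mul
    (hσ.bounded (p, j)).of_succ.of_succ).mul (hσ.bounded (q, k)).of_succ.of_succ)

theorem pd_sum {ι : Type} [Fintype ι] [DecidableEq ι] {α : Type*} (s : Finset α)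
    {F : α → Vec ι → ℝ} (hF : ∀ x ∈ s, Differentiable ℝ (F x)) (p : ι) :
    pd (fun w => ∑ x ∈ s, F x w) p = fun w => ∑ x ∈ s, pd (F x) p w := by
  funext w
  simp only [pd]
  rw [fderiv_fun_sum fun x hx => hF x hx w]
  simp

theorem IsRegular.pd_eulerCoeff1 (hσ : IsRegular σ) (m : Fin l × Fin d) (j : Fin d) (q : Fin l)
    (y : Vec (Fin l)) :
    pd (eulerCoeff1 σ m j) q y = ∑ p, (pd (fun w => σ w m) p y * pd (fun w => σ w (p, j)) q y
      + σ y (p, j) * pd (pd (fun w => σ w m) p) q y) := by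
  have hpd : ∀ p, Differentiable ℝ (pd (fun w => σ w m) p) := fun p =>
    ((hσ.bounded m).2.2 p).2.1
  have hσd : ∀ p, Differentiable ℝ fun w => σ w (p, j) := fun p => (hσ.bounded (p, j)).2.1
  refine (congrFun (pd_sum Finset.univ (fun p _ => (hpd p).mul (hσd p)) q) y).trans ?_
  exact Finset.sum_congr rfl fun p _ => congrFun (pd_mul (hpd p) (hσd p) q) y

theorem IsRegular.eulerCoeff2_eq (hσ : IsRegular σ) (m : Fin l × Fin d) (j k : Fin d)
    (y : Vec (Fin l)) :
    eulerCoeff2 σ m j k y = ∑ q, pd (eulerCoeff1 σ m j) q y * σ y (q, k) := by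
  simp only [hσ.pd_eulerCoeff1, eulerCoeff2, Finset.sum_mul, add_mul, Finset.sum_add_distrib,
    eulerCoeff1, Finset.mul_sum]
  congr 1 <;>
  · rw [Finset.sum_comm]
    exact Finset.sum_congr rfl fun q _ => Finset.sum_congr rfl fun p _ => by ring

theorem sum_comm_pairs {α β : Type*} [Fintype α] [Fintype β] (f : α → α → β → β → ℝ) :
    ∑ j, ∑ k, ∑ p, ∑ q, f j k p q = ∑ p, ∑ q, ∑ j, ∑ k, f j k p q := by
  have hprod := Finset.sum_comm (s := Finset.univ) (t := Finset.univ)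
    (f := fun (x : α × α) (y : β × β) => f x.1 x.2 y.1 y.2)
  simpa only [Fintype.sum_prod_type] using hprod

theorem Incr.IsGeometric.sum_mul_area {ξ : Incr d} (hξ : ξ.IsGeometric)
    {H : Fin d → Fin d → ℝ} (hH : ∀ j k, H j k = H k j) :
    ∑ j, ∑ k, H j k * ξ.x2 (k, j) = (1 / 2) * ∑ j, ∑ k, H j k * (ξ.x1 j * ξ.x1 k) := by
  have htranspose : ∑ j, ∑ k, H j k * ξ.x2 (k, j) = ∑ j, ∑ k, H j k * ξ.x2 (j, k) := by
    rw [Finset.sum_comm]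
    exact Finset.sum_congr rfl fun k _ => Finset.sum_congr rfl fun j _ => by rw [hH]
  have hsum : ∑ j, ∑ k, H j k * (ξ.x1 j * ξ.x1 k) =
      (∑ j, ∑ k, H j k * ξ.x2 (j, k)) + ∑ j, ∑ k, H j k * ξ.x2 (k, j) := by
    simp only [← Finset.sum_add_distrib, ← mul_add, hξ _ _]
  rw [hsum, ← htranspose]
  ring

theorem sum_eulerPath_mul_pd (ξ : Incr d) (a : Vec (Fin l)) (m : Fin l × Fin d) :
    ∑ i, eulerPath σ ξ a i * pd (fun w => σ w m) i a = ∑ k, eulerCoeff1 σ m k a * ξ.x1 k := by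
  simp only [eulerPath, eulerCoeff1, Finset.sum_mul]
  rw [Finset.sum_comm]
  exact Finset.sum_congr rfl fun k _ => Finset.sum_congr rfl fun i _ => by ring

theorem IsRegular.sum_eulerPath_mul_pd_eulerCoeff1 (hσ : IsRegular σ) (ξ : Incr d)
    (a : Vec (Fin l)) (m : Fin l × Fin d) (j : Fin d) :
    ∑ i, eulerPath σ ξ a i * pd (eulerCoeff1 σ m j) i a =
      ∑ k, eulerCoeff2 σ m j k a * ξ.x1 k := by
  simp only [eulerPath, hσ.eulerCoeff2_eq, Finset.sum_mul]
  rw [Finset.sum_comm]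
  exact Finset.sum_congr rfl fun k _ => Finset.sum_congr rfl fun i _ => by ring

theorem sum_eulerArea_mul_pd (ξ : Incr d) (a : Vec (Fin l)) (m : Fin l × Fin d) :
    ∑ i, eulerArea σ ξ a i * pd (fun w => σ w m) i a =
      ∑ j, ∑ k, (∑ p, pd (fun w => σ w m) p a * eulerCoeff1 σ (p, j) k a) * ξ.x2 (k, j) := by
  simp only [eulerArea, Finset.sum_mul]
  rw [Finset.sum_comm]
  refine Finset.sum_congr rfl fun j _ => ?_
  rw [Finset.sum_comm]
  exact Finset.sum_congr rfl fun k _ => Finset.sum_congr rfl fun i _ => by ring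

theorem IsRegular.sum_hessian_mul_area (hσ : IsRegular σ) {ξ : Incr d} (hξ : ξ.IsGeometric)
    (a : Vec (Fin l)) (m : Fin l × Fin d) :
    ∑ j, ∑ k, (∑ p, ∑ q, pd (pd (fun w => σ w m) p) q a * σ a (p, j) * σ a (q, k))
        * ξ.x2 (k, j) =
      (1 / 2) * ∑ p, ∑ q, eulerPath σ ξ a p * eulerPath σ ξ a q
        * pd (pd (fun w => σ w m) p) q a := by
  rw [hξ.sum_mul_area]
  · congr 1
    simp only [eulerPath, Finset.sum_mul, Finset.mul_sum]
    rw [sum_comm_pairs]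
    refine Finset.sum_congr rfl fun p _ => Finset.sum_congr rfl fun q _ => ?_
    rw [Finset.sum_comm]
    exact Finset.sum_congr rfl fun k _ => Finset.sum_congr rfl fun j _ => by ring
  · intro j k
    rw [Finset.sum_comm]
    refine Finset.sum_congr rfl fun q _ => Finset.sum_congr rfl fun p _ => ?_
    rw [pd_pd_comm (hσ.contDiff m)]
    ring

theorem IsRegular.sum_eulerCoeff2_mul_area (hσ : IsRegular σ) {ξ : Incr d}
    (hξ : ξ.IsGeometric) (a : Vec (Fin l)) (m : Fin l × Fin d) :
    ∑ j, ∑ k, eulerCoeff2 σ m j k a * ξ.x2 (k, j) =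
      (∑ i, eulerArea σ ξ a i * pd (fun w => σ w m) i a)
      + (1 / 2) * ∑ p, ∑ q, eulerPath σ ξ a p * eulerPath σ ξ a q
          * pd (pd (fun w => σ w m) p) q a := by
  simp only [eulerCoeff2, add_mul, Finset.sum_add_distrib, sum_eulerArea_mul_pd,
    hσ.sum_hessian_mul_area hξ]

-- This is where the driver has to be geometric: `eulerCoeff2` sees the whole area, the Taylor
-- expansion of `σ` only sees the square of the increment of the path.
theorem IsRegular.coeffRem0_eq (hσ : IsRegular σ) {ξ : Incr d} (hξ : ξ.IsGeometric)
    (a v : Vec (Fin l)) (m : Fin l × Fin d) :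
    coeffRem0 σ ξ a (a + v) m =
      (σ (a + v) m - σ a m - (∑ i, v i * pd (fun w => σ w m) i a)
        - (1 / 2) * ∑ i, v i * ∑ j, v j * pd (pd (fun w => σ w m) i) j a)
      + (∑ i, (v i - eulerPath σ ξ a i - eulerArea σ ξ a i) * pd (fun w => σ w m) i a)
      + (1 / 2) * ∑ i, ∑ j, (v i * v j - eulerPath σ ξ a i * eulerPath σ ξ a j)
          * pd (pd (fun w => σ w m) i) j a := by
  have hquadratic : ∑ i, v i * ∑ j, v j * pd (pd (fun w => σ w m) i) j a =
      ∑ i, ∑ j, v i * v j * pd (pd (fun w => σ w m) i) j a := by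
    simp only [Finset.mul_sum, mul_assoc]
  simp only [coeffRem0, sub_mul, Finset.sum_sub_distrib, sum_eulerPath_mul_pd,
    hσ.sum_eulerCoeff2_mul_area hξ, hquadratic]
  ring

theorem IsRegular.coeffRem1_eq (hσ : IsRegular σ) (ξ : Incr d) (a v : Vec (Fin l))
    (m : Fin l × Fin d) (j : Fin d) :
    coeffRem1 σ ξ a (a + v) m j =
      (eulerCoeff1 σ m j (a + v) - eulerCoeff1 σ m j a - ∑ i, v i * pd (eulerCoeff1 σ m j) i a)
      + ∑ i, (v i - eulerPath σ ξ a i) * pd (eulerCoeff1 σ m j) i a := by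
  simp only [coeffRem1, sub_mul, Finset.sum_sub_distrib, hσ.sum_eulerPath_mul_pd_eulerCoeff1]
  ring

end EulerScheme

section EulerOrders

variable {P : Type*} {l d : ℕ} {σ : Vec (Fin l) → Vec (Fin l × Fin d)} {τ ω : P → ℝ}
  {ξ ξ' η η' : P → Incr d} {a a' J J' : P → Vec (Fin l)}

/-- Two families of increments with components of orders `τ`, `τ ^ 2` and `τ ^ 3`, which are
`ω`-close. -/
structure IsPairBigOIncr (τ ω : P → ℝ) (ξ ξ' : P → Incr d) : Prop where
  x1 : ∀ i, IsPairBigO τ ω 1 (fun p => (ξ p).x1 i) fun p => (ξ' p).x1 i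
  x2 : ∀ i, IsPairBigO τ ω 2 (fun p => (ξ p).x2 i) fun p => (ξ' p).x2 i
  x3 : ∀ i, IsPairBigO τ ω 3 (fun p => (ξ p).x3 i) fun p => (ξ' p).x3 i

theorem IsRegular.isPairBigO (hσ : IsRegular σ) (ha : (fun p => a p - a' p) =O[⊤] ω)
    (m : Fin l × Fin d) : IsPairBigO τ ω 0 (fun p => σ (a p) m) (fun p => σ (a' p) m) :=
  (hσ.bounded m).of_succ.of_succ.of_succ.isPairBigO ha

theorem IsRegular.isPairBigO_eulerPath (hσ : IsRegular σ)
    (ha : (fun p => a p - a' p) =O[⊤] ω) (hξ : IsPairBigOIncr τ ω ξ ξ') (i : Fin l) :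
    IsPairBigO τ ω 1 (fun p => eulerPath σ (ξ p) (a p) i)
      (fun p => eulerPath σ (ξ' p) (a' p) i) :=
  .sum _ fun k _ => by simpa only [zero_add] using (hσ.isPairBigO ha (i, k)).mul (hξ.x1 k)

theorem IsRegular.isPairBigO_eulerArea (hσ : IsRegular σ)
    (ha : (fun p => a p - a' p) =O[⊤] ω) (hξ : IsPairBigOIncr τ ω ξ ξ') (i : Fin l) :
    IsPairBigO τ ω 2 (fun p => eulerArea σ (ξ p) (a p) i)
      (fun p => eulerArea σ (ξ' p) (a' p) i) :=
  .sum _ fun j _ => .sum _ fun k _ => by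
    simpa only [zero_add] using
      ((hσ.bounded_eulerCoeff1 (i, j) k).of_succ.of_succ.isPairBigO ha).mul (hξ.x2 (k, j))

theorem IsRegular.isPairBigO_eulerVolume (hσ : IsRegular σ)
    (ha : (fun p => a p - a' p) =O[⊤] ω) (hξ : IsPairBigOIncr τ ω ξ ξ') (i : Fin l) :
    IsPairBigO τ ω 3 (fun p => eulerVolume σ (ξ p) (a p) i)
      (fun p => eulerVolume σ (ξ' p) (a' p) i) :=
  .sum _ fun j _ => .sum _ fun k₁ _ => .sum _ fun k₂ _ => by
    simpa only [zero_add] using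
      ((hσ.bounded_eulerCoeff2 (i, j) k₁ k₂).of_succ.isPairBigO ha).mul (hξ.x3 (k₂, k₁, j))

variable (hτ : τ =O[⊤] fun _ => (1 : ℝ)) (hσ : IsRegular σ)
  (ha : (fun p => a p - a' p) =O[⊤] ω) (hξ : IsPairBigOIncr τ ω ξ ξ')

include hτ hσ ha hξ

theorem isPairBigO_eulerIncr (i : Fin l) :
    IsPairBigO τ ω 1 (fun p => eulerIncr σ (ξ p) (a p) i)
      (fun p => eulerIncr σ (ξ' p) (a' p) i) :=
  ((hσ.isPairBigO_eulerPath ha hξ i).add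
    ((hσ.isPairBigO_eulerArea ha hξ i).of_le hτ (by norm_num))).add
      ((hσ.isPairBigO_eulerVolume ha hξ i).of_le hτ (by norm_num))

variable (hJ : ∀ i, IsPairBigO τ ω 3 (fun p => J p i) (fun p => J' p i))

include hJ

theorem isPairBigO_step (i : Fin l) :
    IsPairBigO τ ω 1 (fun p => (eulerIncr σ (ξ p) (a p) + J p) i)
      (fun p => (eulerIncr σ (ξ' p) (a' p) + J' p) i) :=
  (isPairBigO_eulerIncr hτ hσ ha hξ i).add ((hJ i).of_le hτ (by norm_num))

theorem isPairBigO_step_sub_eulerPath (i : Fin l) :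
    IsPairBigO τ ω 2
      (fun p => (eulerIncr σ (ξ p) (a p) + J p) i - eulerPath σ (ξ p) (a p) i)
      (fun p => (eulerIncr σ (ξ' p) (a' p) + J' p) i - eulerPath σ (ξ' p) (a' p) i) := by
  refine (((hσ.isPairBigO_eulerArea ha hξ i).add ((hσ.isPairBigO_eulerVolume ha hξ i).of_le hτ
    (by norm_num))).add ((hJ i).of_le hτ (by norm_num))).congr (fun p => ?_) (fun p => ?_) <;>
  · simp only [eulerIncr, PiLp.add_apply]
    ring

omit hτ in
theorem isPairBigO_step_sub_eulerPath_sub_eulerArea (i : Fin l) :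
    IsPairBigO τ ω 3
      (fun p => (eulerIncr σ (ξ p) (a p) + J p) i - eulerPath σ (ξ p) (a p) i
        - eulerArea σ (ξ p) (a p) i)
      (fun p => (eulerIncr σ (ξ' p) (a' p) + J' p) i - eulerPath σ (ξ' p) (a' p) i
        - eulerArea σ (ξ' p) (a' p) i) := by
  refine ((hσ.isPairBigO_eulerVolume ha hξ i).add (hJ i)).congr (fun p => ?_) (fun p => ?_) <;>
  · simp only [eulerIncr, PiLp.add_apply]
    ring

theorem isPairBigO_step_mul_sub_eulerPath_mul (i j : Fin l) :
    IsPairBigO τ ω 3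
      (fun p => (eulerIncr σ (ξ p) (a p) + J p) i * (eulerIncr σ (ξ p) (a p) + J p) j
        - eulerPath σ (ξ p) (a p) i * eulerPath σ (ξ p) (a p) j)
      (fun p => (eulerIncr σ (ξ' p) (a' p) + J' p) i * (eulerIncr σ (ξ' p) (a' p) + J' p) j
        - eulerPath σ (ξ' p) (a' p) i * eulerPath σ (ξ' p) (a' p) j) :=
  (((isPairBigO_step hτ hσ ha hξ hJ i).mul (isPairBigO_step_sub_eulerPath hτ hσ ha hξ hJ j)).add
    ((isPairBigO_step_sub_eulerPath hτ hσ ha hξ hJ i).mul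
      (hσ.isPairBigO_eulerPath ha hξ j))).congr (fun p => by ring) (fun p => by ring)

theorem isPairBigO_coeffRem0 (hg : ∀ p, (ξ p).IsGeometric) (hg' : ∀ p, (ξ' p).IsGeometric)
    (m : Fin l × Fin d) :
    IsPairBigO τ ω 3
      (fun p => coeffRem0 σ (ξ p) (a p) (a p + (eulerIncr σ (ξ p) (a p) + J p)) m)
      (fun p => coeffRem0 σ (ξ' p) (a' p) (a' p + (eulerIncr σ (ξ' p) (a' p) + J' p)) m) := by
  simp only [hσ.coeffRem0_eq (hg _), hσ.coeffRem0_eq (hg' _)]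
  refine (((hσ.bounded m).isPairBigO_taylor_two hτ ha (isPairBigO_step hτ hσ ha hξ hJ)).add
    (.sum _ fun i _ => ?_)).add (.const_mul _ (.sum _ fun i _ => .sum _ fun j _ => ?_))
  · exact (isPairBigO_step_sub_eulerPath_sub_eulerArea hσ ha hξ hJ i).mul
      (((hσ.bounded m).2.2 i).of_succ.of_succ.isPairBigO ha)
  · exact (isPairBigO_step_mul_sub_eulerPath_mul hτ hσ ha hξ hJ i j).mul
      ((((hσ.bounded m).2.2 i).2.2 j).of_succ.isPairBigO ha)

theorem isPairBigO_coeffRem1 (m : Fin l × Fin d) (j : Fin d) :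
    IsPairBigO τ ω 2
      (fun p => coeffRem1 σ (ξ p) (a p) (a p + (eulerIncr σ (ξ p) (a p) + J p)) m j)
      (fun p => coeffRem1 σ (ξ' p) (a' p) (a' p + (eulerIncr σ (ξ' p) (a' p) + J' p)) m j) := by
  simp only [hσ.coeffRem1_eq]
  exact ((hσ.bounded_eulerCoeff1 m j).isPairBigO_taylor_one hτ ha
    (isPairBigO_step hτ hσ ha hξ hJ)).add (.sum _ fun i _ =>
      (isPairBigO_step_sub_eulerPath hτ hσ ha hξ hJ i).mul
        (((hσ.bounded_eulerCoeff1 m j).2.2 i).of_succ.isPairBigO ha))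

theorem isPairBigO_eulerDefect (hg : ∀ p, (ξ p).IsGeometric) (hg' : ∀ p, (ξ' p).IsGeometric)
    (hη : IsPairBigOIncr τ ω η η') (i : Fin l) :
    IsPairBigO τ ω 4
      (fun p => eulerDefect σ (ξ p) (η p) (a p) (a p + (eulerIncr σ (ξ p) (a p) + J p)) i)
      (fun p => eulerDefect σ (ξ' p) (η' p) (a' p)
        (a' p + (eulerIncr σ (ξ' p) (a' p) + J' p)) i) := by
  refine ((IsPairBigO.sum _ fun j _ => ?_).add (.sum _ fun j _ => .sum _ fun k _ => ?_)).add
    (.sum _ fun j _ => .sum _ fun k₁ _ => .sum _ fun k₂ _ => ?_)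
  · exact (isPairBigO_coeffRem0 hτ hσ ha hξ hJ hg hg' _).mul (hη.x1 j)
  · exact (isPairBigO_coeffRem1 hτ hσ ha hξ hJ _ _).mul (hη.x2 _)
  · exact ((hσ.bounded_eulerCoeff2 _ _ _).isPairBigO_taylor_zero hτ ha
      (isPairBigO_step hτ hσ ha hξ hJ)).mul (hη.x3 _)

end EulerOrders

section EulerEstimates

variable {l d : ℕ} {σ : Vec (Fin l) → Vec (Fin l × Fin d)} {N Θ : ℝ}

instance : Sub (Incr d) := ⟨fun ξ ξ' => ⟨ξ.x1 - ξ'.x1, ξ.x2 - ξ'.x2, ξ.x3 - ξ'.x3⟩⟩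

/-- The components of `ξ` are at most `M τ`, `M τ ^ 2` and `M τ ^ 3`; here `τ` stands for
`|t - s| ^ γ`. -/
structure Incr.BoundedBy (ξ : Incr d) (M τ : ℝ) : Prop where
  x1 : ‖ξ.x1‖ ≤ M * τ
  x2 : ‖ξ.x2‖ ≤ M * τ ^ 2
  x3 : ‖ξ.x3‖ ≤ M * τ ^ 3

theorem Incr.BoundedBy.mono {ξ : Incr d} {M M' τ τ' : ℝ} (h : ξ.BoundedBy M τ) (hM : 0 ≤ M)
    (hMM' : M ≤ M') (hτ : 0 ≤ τ) (hττ' : τ ≤ τ') : ξ.BoundedBy M' τ' :=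
  have hM' : 0 ≤ M' := hM.trans hMM'
  ⟨h.x1.trans (by gcongr), h.x2.trans (by gcongr), h.x3.trans (by gcongr)⟩

theorem Incr.boundedBy_sub_self (ξ : Incr d) {M τ : ℝ} (hM : 0 ≤ M) (hτ : 0 ≤ τ) :
    (ξ - ξ).BoundedBy M τ where
  x1 := (norm_sub_eq_zero_iff.2 rfl : ‖ξ.x1 - ξ.x1‖ = 0).trans_le (by positivity)
  x2 := (norm_sub_eq_zero_iff.2 rfl : ‖ξ.x2 - ξ.x2‖ = 0).trans_le (by positivity)
  x3 := (norm_sub_eq_zero_iff.2 rfl : ‖ξ.x3 - ξ.x3‖ = 0).trans_le (by positivity)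

/-- A pair of increments of size `N`, the distance between which is at most `ω`, over an interval
of size `τ`. -/
structure Incr.PairBoundedBy (ξ ξ' : Incr d) (N τ ω : ℝ) : Prop where
  left : ξ.BoundedBy N τ
  right : ξ'.BoundedBy N τ
  sub : (ξ - ξ').BoundedBy ω τ
  geometric_left : ξ.IsGeometric
  geometric_right : ξ'.IsGeometric

theorem Incr.PairBoundedBy.mono {ξ ξ' : Incr d} {N N' τ τ' ω ω' : ℝ}
    (h : ξ.PairBoundedBy ξ' N τ ω) (hN : 0 ≤ N) (hNN' : N ≤ N') (hτ : 0 ≤ τ) (hττ' : τ ≤ τ')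
    (hω : 0 ≤ ω) (hωω' : ω ≤ ω') : ξ.PairBoundedBy ξ' N' τ' ω' :=
  ⟨h.left.mono hN hNN' hτ hττ', h.right.mono hN hNN' hτ hττ', h.sub.mono hω hωω' hτ hττ',
    h.geometric_left, h.geometric_right⟩

/-- Two perturbed Euler steps, from `a` to `a + (eulerIncr σ ξ a + J)` and from `a'` to
`a' + (eulerIncr σ ξ' a' + J')`, followed by the increments `η` and `η'`, with the quantities that
bound them. This is the type over which the estimates of the Euler scheme are uniform. -/
structure EulerStepPair (l d : ℕ) (N Θ : ℝ) where
  τ : ℝ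
  ω : ℝ
  ξ : Incr d
  ξ' : Incr d
  η : Incr d
  η' : Incr d
  a : Vec (Fin l)
  a' : Vec (Fin l)
  J : Vec (Fin l)
  J' : Vec (Fin l)
  τ_nonneg : 0 ≤ τ
  τ_le : τ ≤ Θ
  ω_nonneg : 0 ≤ ω
  bound_ξ : ξ.PairBoundedBy ξ' N τ ω
  bound_η : η.PairBoundedBy η' N τ ω
  norm_sub_le : ‖a - a'‖ ≤ ω
  norm_J_le : ‖J‖ ≤ N * τ ^ 3
  norm_J'_le : ‖J'‖ ≤ N * τ ^ 3
  norm_J_sub_le : ‖J - J'‖ ≤ ω * τ ^ 3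

section PairBigO

variable {P : Type*} {τ ω : P → ℝ} {k : ℕ} {ι : Type} [Fintype ι] {f f' : P → Vec ι}

theorem isPairBigO_of_norm_le (hτ : ∀ p, 0 ≤ τ p) (hω : ∀ p, 0 ≤ ω p)
    (hf : ∀ p, ‖f p‖ ≤ N * τ p ^ k) (hf' : ∀ p, ‖f' p‖ ≤ N * τ p ^ k)
    (hsub : ∀ p, ‖f p - f' p‖ ≤ ω p * τ p ^ k) (i : ι) :
    IsPairBigO τ ω k (fun p => f p i) (fun p => f' p i) where
  left := isBigO_top.2 ⟨N, fun p => by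
    rw [Real.norm_of_nonneg (pow_nonneg (hτ p) k)]
    exact (PiLp.norm_apply_le (f p) i).trans (hf p)⟩
  right := isBigO_top.2 ⟨N, fun p => by
    rw [Real.norm_of_nonneg (pow_nonneg (hτ p) k)]
    exact (PiLp.norm_apply_le (f' p) i).trans (hf' p)⟩
  sub := isBigO_top.2 ⟨1, fun p => by
    rw [Real.norm_of_nonneg (mul_nonneg (pow_nonneg (hτ p) k) (hω p)), one_mul, mul_comm]
    exact (PiLp.norm_apply_le (f p - f' p) i).trans (hsub p)⟩

theorem isPairBigOIncr_of_pairBoundedBy {ξ ξ' : P → Incr d} (hτ : ∀ p, 0 ≤ τ p)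
    (hω : ∀ p, 0 ≤ ω p) (hξ : ∀ p, (ξ p).PairBoundedBy (ξ' p) N (τ p) (ω p)) :
    IsPairBigOIncr τ ω ξ ξ' where
  x1 := isPairBigO_of_norm_le (N := N) hτ hω
    (fun p => by simpa only [pow_one] using (hξ p).left.x1)
    (fun p => by simpa only [pow_one] using (hξ p).right.x1)
    (fun p => (hξ p).sub.x1.trans_eq (by rw [pow_one]))
  x2 := isPairBigO_of_norm_le hτ hω (fun p => (hξ p).left.x2) (fun p => (hξ p).right.x2)
    (fun p => (hξ p).sub.x2)
  x3 := isPairBigO_of_norm_le hτ hω (fun p => (hξ p).left.x3) (fun p => (hξ p).right.x3)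
    (fun p => (hξ p).sub.x3)

theorem exists_norm_le_of_isPairBigO (hτ : ∀ p, 0 ≤ τ p) (hω : ∀ p, 0 ≤ ω p)
    (h : ∀ i, IsPairBigO τ ω k (fun p => f p i) (fun p => f' p i)) :
    ∃ C : ℝ, 0 ≤ C ∧ ∀ p, ‖f p‖ ≤ C * τ p ^ k ∧ ‖f p - f' p‖ ≤ C * (τ p ^ k * ω p) := by
  obtain ⟨C, hC⟩ := isBigO_top.1 (isBigO_of_coord fun i => (h i).left)
  obtain ⟨D, hD⟩ := isBigO_top.1
    (isBigO_of_coord (f := fun p => f p - f' p) fun i => (h i).sub)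
  refine ⟨max 0 (max C D), le_max_left _ _, fun p => ?_⟩
  have hτk : 0 ≤ τ p ^ k := pow_nonneg (hτ p) k
  have hτω : 0 ≤ τ p ^ k * ω p := mul_nonneg hτk (hω p)
  have hCp := hC p
  have hDp := hD p
  rw [Real.norm_of_nonneg hτk] at hCp
  rw [Real.norm_of_nonneg hτω] at hDp
  exact ⟨hCp.trans (mul_le_mul_of_nonneg_right (by simp) hτk),
    hDp.trans (mul_le_mul_of_nonneg_right (by simp) hτω)⟩

end PairBigO

theorem EulerStepPair.isBigO_τ :
    (fun S : EulerStepPair l d N Θ => S.τ) =O[⊤] fun _ => (1 : ℝ) :=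
  isBigO_top.2 ⟨Θ, fun S => by simpa [abs_of_nonneg S.τ_nonneg] using S.τ_le⟩

theorem EulerStepPair.isBigO_sub :
    (fun S : EulerStepPair l d N Θ => S.a - S.a') =O[⊤] fun S => S.ω :=
  isBigO_top.2 ⟨1, fun S => by simpa [abs_of_nonneg S.ω_nonneg] using S.norm_sub_le⟩

theorem EulerStepPair.isPairBigOIncr_ξ :
    IsPairBigOIncr (fun S : EulerStepPair l d N Θ => S.τ) (fun S => S.ω) (fun S => S.ξ)
      fun S => S.ξ' :=
  isPairBigOIncr_of_pairBoundedBy (fun S => S.τ_nonneg) (fun S => S.ω_nonneg)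
    fun S => S.bound_ξ

theorem exists_norm_eulerIncr_le (hσ : IsRegular σ) (N Θ : ℝ) :
    ∃ C : ℝ, 0 ≤ C ∧ ∀ S : EulerStepPair l d N Θ, ‖eulerIncr σ S.ξ S.a‖ ≤ C * S.τ ∧
      ‖eulerIncr σ S.ξ S.a - eulerIncr σ S.ξ' S.a'‖ ≤ C * (S.τ * S.ω) := by
  simpa only [pow_one] using exists_norm_le_of_isPairBigO
    (fun S : EulerStepPair l d N Θ => S.τ_nonneg) (fun S => S.ω_nonneg)
    (isPairBigO_eulerIncr EulerStepPair.isBigO_τ hσ EulerStepPair.isBigO_sub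
      EulerStepPair.isPairBigOIncr_ξ)

theorem exists_norm_eulerDefect_le (hσ : IsRegular σ) (N Θ : ℝ) :
    ∃ C : ℝ, 0 ≤ C ∧ ∀ S : EulerStepPair l d N Θ,
      ‖eulerDefect σ S.ξ S.η S.a (S.a + (eulerIncr σ S.ξ S.a + S.J))‖ ≤ C * S.τ ^ 4 ∧
      ‖eulerDefect σ S.ξ S.η S.a (S.a + (eulerIncr σ S.ξ S.a + S.J)) -
        eulerDefect σ S.ξ' S.η' S.a' (S.a' + (eulerIncr σ S.ξ' S.a' + S.J'))‖ ≤
          C * (S.τ ^ 4 * S.ω) :=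
  exists_norm_le_of_isPairBigO (fun S : EulerStepPair l d N Θ => S.τ_nonneg)
    (fun S => S.ω_nonneg) (isPairBigO_eulerDefect EulerStepPair.isBigO_τ hσ
      EulerStepPair.isBigO_sub EulerStepPair.isPairBigOIncr_ξ
      (isPairBigO_of_norm_le (fun S => S.τ_nonneg) (fun S => S.ω_nonneg)
        (fun S => S.norm_J_le) (fun S => S.norm_J'_le) fun S => S.norm_J_sub_le)
      (fun S => S.bound_ξ.geometric_left) (fun S => S.bound_ξ.geometric_right)
      (isPairBigOIncr_of_pairBoundedBy (fun S => S.τ_nonneg) (fun S => S.ω_nonneg)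
        fun S => S.bound_η))

theorem Incr.pairBoundedBy_self {ξ : Incr d} {τ ω : ℝ} (hξ : ξ.BoundedBy N τ)
    (hg : ξ.IsGeometric) (hτ : 0 ≤ τ) (hω : 0 ≤ ω) : ξ.PairBoundedBy ξ N τ ω :=
  ⟨hξ, hξ, ξ.boundedBy_sub_self hω hτ, hg, hg⟩

theorem eulerDefect_sub_eulerDefect (ξ η : Incr d) (a b c : Vec (Fin l)) :
    eulerDefect σ ξ η a b - eulerDefect σ ξ η a c = eulerIncr σ η b - eulerIncr σ η c := by
  ext i
  simp only [eulerDefect, eulerIncr, eulerPath, eulerArea, eulerVolume, coeffRem0, coeffRem1,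
    PiLp.sub_apply, sub_mul, Finset.sum_sub_distrib]
  ring

theorem exists_norm_eulerIncr_sub_le (hσ : IsRegular σ) (hN : 0 ≤ N) (Θ : ℝ) :
    ∃ C : ℝ, 0 ≤ C ∧ ∀ τ : ℝ, 0 ≤ τ → τ ≤ Θ → ∀ (ξ ξ' : Incr d) (ε : ℝ), 0 ≤ ε →
      ξ.PairBoundedBy ξ' N τ ε → ∀ a a' : Vec (Fin l),
        ‖eulerIncr σ ξ a - eulerIncr σ ξ' a'‖ ≤ C * (τ * (‖a - a'‖ + ε)) := by
  obtain ⟨C, hC0, hC⟩ := exists_norm_eulerIncr_le hσ N Θ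
  refine ⟨C, hC0, fun τ hτ hτΘ ξ ξ' ε hε hξ a a' => ?_⟩
  have hω : 0 ≤ ‖a - a'‖ + ε := by positivity
  have hξω : ξ.PairBoundedBy ξ' N τ (‖a - a'‖ + ε) :=
    hξ.mono hN le_rfl hτ le_rfl hε (le_add_of_nonneg_left (norm_nonneg _))
  exact (hC ⟨τ, ‖a - a'‖ + ε, ξ, ξ', ξ, ξ', a, a', 0, 0, hτ, hτΘ, hω, hξω, hξω,
    le_add_of_nonneg_right hε, by rw [norm_zero]; positivity, by rw [norm_zero]; positivity,
    by rw [sub_zero, norm_zero]; positivity⟩).2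

theorem exists_norm_eulerDefect_sub_le (hσ : IsRegular σ) (hN : 0 ≤ N) (Θ : ℝ) :
    ∃ C : ℝ, ∀ τ : ℝ, 0 ≤ τ → τ ≤ Θ → ∀ (ξ ξ' η η' : Incr d) (ε : ℝ), 0 ≤ ε →
      ξ.PairBoundedBy ξ' N τ ε → η.PairBoundedBy η' N τ ε → ∀ a a' J J' : Vec (Fin l),
        ‖J‖ ≤ N * τ ^ 3 → ‖J'‖ ≤ N * τ ^ 3 →
          ‖eulerDefect σ ξ η a (a + (eulerIncr σ ξ a + J)) -
            eulerDefect σ ξ' η' a' (a' + (eulerIncr σ ξ' a' + J'))‖ ≤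
              C * (τ * ‖J - J'‖ + τ ^ 4 * (‖a - a'‖ + ε)) := by
  obtain ⟨C, -, hC⟩ := exists_norm_eulerDefect_le hσ N Θ
  refine ⟨C, fun τ hτ hτΘ ξ ξ' η η' ε hε hξ hη a a' J J' hJ hJ' => ?_⟩
  have hdiv : ‖J - J'‖ / τ ^ 3 * τ ^ 3 = ‖J - J'‖ := div_mul_cancel_of_imp fun hτ0 => by
    rw [hτ0, mul_zero, norm_le_zero_iff] at hJ hJ'
    rw [hJ, hJ', sub_zero, norm_zero]
  set ω := ‖a - a'‖ + ε + ‖J - J'‖ / τ ^ 3 with hω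
  have hεω : ε ≤ ω := by
    have : 0 ≤ ‖a - a'‖ + ‖J - J'‖ / τ ^ 3 := by positivity
    linarith
  have hsub : ‖a - a'‖ ≤ ω := by
    have : 0 ≤ ε + ‖J - J'‖ / τ ^ 3 := by positivity
    linarith
  have hJω : ‖J - J'‖ ≤ ω * τ ^ 3 := by
    rw [hω, add_mul, hdiv]
    exact le_add_of_nonneg_left (by positivity)
  have hτω : τ * ‖J - J'‖ + τ ^ 4 * (‖a - a'‖ + ε) = τ ^ 4 * ω := by
    rw [hω]
    linear_combination (-τ) * hdiv
  rw [hτω]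
  exact (hC ⟨τ, ω, ξ, ξ', η, η', a, a', J, J', hτ, hτΘ, hε.trans hεω,
    hξ.mono hN le_rfl hτ le_rfl hε hεω, hη.mono hN le_rfl hτ le_rfl hε hεω, hsub, hJ, hJ',
    hJω⟩).2

theorem exists_norm_eulerDefect_le_add (hσ : IsRegular σ) (hN : 0 ≤ N) (Θ : ℝ) :
    ∃ C : ℝ, ∀ τ : ℝ, 0 ≤ τ → τ ≤ Θ → ∀ ξ η : Incr d, ξ.BoundedBy N τ →
      η.BoundedBy N τ → ξ.IsGeometric → η.IsGeometric → ∀ a b : Vec (Fin l),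
        ‖eulerDefect σ ξ η a b‖ ≤ C * (τ * ‖b - a - eulerIncr σ ξ a‖ + τ ^ 4) := by
  obtain ⟨C, hC0, hC⟩ := exists_norm_eulerDefect_le hσ N Θ
  obtain ⟨D, hD0, hD⟩ := exists_norm_eulerIncr_sub_le (l := l) hσ hN Θ
  refine ⟨C + D, fun τ hτ hτΘ ξ η hξ hη hgξ hgη a b => ?_⟩
  set c := a + (eulerIncr σ ξ a + 0) with hc
  have hexact : ‖eulerDefect σ ξ η a c‖ ≤ C * τ ^ 4 :=
    (hC ⟨τ, 0, ξ, ξ, η, η, a, a, 0, 0, hτ, hτΘ, le_rfl, Incr.pairBoundedBy_self hξ hgξ hτ le_rfl,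
      Incr.pairBoundedBy_self hη hgη hτ le_rfl, by simp, by rw [norm_zero]; positivity,
      by rw [norm_zero]; positivity, by simp⟩).1
  have hperturbed : ‖eulerDefect σ ξ η a b - eulerDefect σ ξ η a c‖ ≤
      D * (τ * ‖b - a - eulerIncr σ ξ a‖) := by
    rw [eulerDefect_sub_eulerDefect, sub_sub b]
    simpa only [add_zero, hc] using
      hD τ hτ hτΘ η η 0 le_rfl (Incr.pairBoundedBy_self hη hgη hτ le_rfl) b c
  have hDτ : 0 ≤ D * τ ^ 4 := by positivity
  have hCτ : 0 ≤ C * (τ * ‖b - a - eulerIncr σ ξ a‖) := by positivity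
  have htriangle := norm_add_le (eulerDefect σ ξ η a b - eulerDefect σ ξ η a c)
    (eulerDefect σ ξ η a c)
  rw [sub_add_cancel] at htriangle
  linarith

end EulerEstimates

section Drivers

variable {T : ℝ} {l d : ℕ} {σ : Vec (Fin l) → Vec (Fin l × Fin d)} {X X' : Driver T d} {γ : ℝ}

theorem rpow_pow_eq {h : ℝ} (hh : 0 ≤ h) (γ : ℝ) (n : ℕ) : (h ^ γ) ^ n = h ^ ((n : ℝ) * γ) := by
  rw [mul_comm, Real.rpow_mul_natCast hh]

theorem Incr.boundedBy_of_norm2_le {g : Time T → Time T → Incr d} {M : ℝ} (hM : 0 ≤ M)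
    (h1 : norm2 γ (fun s t => (g s t).x1) ≤ ENNReal.ofReal M)
    (h2 : norm2 (2 * γ) (fun s t => (g s t).x2) ≤ ENNReal.ofReal M)
    (h3 : norm2 (3 * γ) (fun s t => (g s t).x3) ≤ ENNReal.ofReal M) (s t : Time T) :
    (g s t).BoundedBy M (|(t : ℝ) - s| ^ γ) where
  x1 := norm_le_of_norm2_le hM h1 s t
  x2 := by
    rw [rpow_pow_eq (abs_nonneg _)]
    exact_mod_cast norm_le_of_norm2_le hM h2 s t
  x3 := by
    rw [rpow_pow_eq (abs_nonneg _)]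
    exact_mod_cast norm_le_of_norm2_le hM h3 s t

theorem Driver.inc_boundedBy_of_size_le {M : ℝ≥0} (hM : X.size γ ≤ M) (s t : Time T) :
    (X.inc s t).BoundedBy M (|(t : ℝ) - s| ^ γ) := by
  rw [← ENNReal.ofReal_coe_nnreal] at hM
  have h1 : norm1 γ X.x ≤ ENNReal.ofReal M := (le_add_right le_self_add).trans hM
  have h2 : norm2 (2 * γ) X.x2 ≤ ENNReal.ofReal M := (le_add_right le_add_self).trans hM
  have h3 : norm2 (3 * γ) X.x3 ≤ ENNReal.ofReal M := le_add_self.trans hM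
  exact Incr.boundedBy_of_norm2_le (g := X.inc) M.coe_nonneg h1 h2 h3 s t

theorem Driver.IsRough.size_le (hX : X.IsRough γ) : X.size γ ≤ (X.size γ).toNNReal :=
  (ENNReal.coe_toNNReal (ENNReal.add_ne_top.2
    ⟨ENNReal.add_ne_top.2 ⟨hX.mem_x.2.ne, hX.mem_x2.2.ne⟩, hX.mem_x3.2.ne⟩)).ge

theorem Driver.inc_sub_inc_boundedBy {ε : ℝ} (hε : 0 ≤ ε)
    (h : norm1 γ (fun t => X.x t - X'.x t) + norm2 (2 * γ) (fun s t => X.x2 s t - X'.x2 s t) +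
      norm2 (3 * γ) (fun s t => X.x3 s t - X'.x3 s t) ≤ ENNReal.ofReal ε) (s t : Time T) :
    (X.inc s t - X'.inc s t).BoundedBy ε (|(t : ℝ) - s| ^ γ) := by
  have hdelta1 : delta1 (fun t => X.x t - X'.x t) =
      fun s t => delta1 X.x s t - delta1 X'.x s t := by
    funext s t
    exact sub_sub_sub_comm _ _ _ _
  rw [norm1, hdelta1] at h
  exact Incr.boundedBy_of_norm2_le (g := fun s t => X.inc s t - X'.inc s t) hε
    ((le_add_right le_self_add).trans h) ((le_add_right le_add_self).trans h)
    (le_add_self.trans h) s t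

theorem Driver.IsRough.x2_apply (hX : X.IsRough γ) (s u t : Time T) (i j : Fin d) :
    X.x2 s t (i, j) =
      X.x2 s u (i, j) + X.x2 u t (i, j) + delta1 X.x s u i * delta1 X.x u t j := by
  rw [← hX.chen2]
  simp only [delta2, PiLp.sub_apply]
  ring

theorem Driver.IsRough.x3_apply (hX : X.IsRough γ) (s u t : Time T) (i j k : Fin d) :
    X.x3 s t (i, j, k) = X.x3 s u (i, j, k) + X.x3 u t (i, j, k)
      + X.x2 s u (i, j) * delta1 X.x u t k + delta1 X.x s u i * X.x2 u t (j, k) := by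
  rw [add_assoc _ (X.x2 s u (i, j) * _), ← hX.chen3]
  simp only [delta2, PiLp.sub_apply]
  ring

theorem Driver.IsRough.inc_isGeometric (hX : X.IsRough γ) (hg : X.IsGeometric) (s t : Time T) :
    (X.inc s t).IsGeometric := by
  intro i j
  change X.x2 s t (i, j) + X.x2 s t (j, i) = delta1 X.x s t i * delta1 X.x s t j
  rcases lt_trichotomy s t with hst | rfl | hts
  · linarith [hg s t hst i j]
  · simp [hX.mem_x2.1, delta1]
  · have hflip := hg t s hts i j
    have hij := hX.x2_apply s t s i j
    have hji := hX.x2_apply s t s j i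
    rw [hX.mem_x2.1] at hij hji
    simp only [delta1, PiLp.sub_apply, PiLp.zero_apply] at hflip hij hji ⊢
    linarith

/-- The Euler scheme of `dy = σ(y) dx` as a family of maps: it sends `a` at time `s` to
`a + X.eulerFlow σ s t a` at time `t`. -/
noncomputable def Driver.eulerFlow (X : Driver T d) (σ : Vec (Fin l) → Vec (Fin l × Fin d))
    (s t : Time T) (a : Vec (Fin l)) : Vec (Fin l) :=
  eulerIncr σ (X.inc s t) a

theorem Driver.IsRough.flowDefect_eulerFlow (hX : X.IsRough γ) (s u t : Time T)
    (a b : Vec (Fin l)) :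
    flowDefect (X.eulerFlow σ) s u t a b = eulerDefect σ (X.inc s u) (X.inc u t) a b := by
  ext i
  have hpath : ∀ j, delta1 X.x s t j = delta1 X.x s u j + delta1 X.x u t j := fun j => by
    simp only [delta1, PiLp.sub_apply]
    ring
  simp only [flowDefect, Driver.eulerFlow, eulerIncr, eulerPath, eulerArea, eulerVolume,
    eulerDefect, coeffRem0, coeffRem1, Driver.inc, PiLp.add_apply, PiLp.sub_apply, hpath,
    hX.x2_apply s u t, hX.x3_apply s u t, sub_mul, mul_add, Finset.sum_sub_distrib,
    Finset.sum_add_distrib, Finset.sum_mul, ← mul_assoc]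
  ring

theorem add_eulerFlow_add_stepError (X : Driver T d) (s t : Time T) (a b : Vec (Fin l)) :
    a + (eulerIncr σ (X.inc s t) a + stepError (X.eulerFlow σ) s t a b) = b := by
  simp only [stepError, Driver.eulerFlow]
  abel

theorem continuous_of_coord {α ι : Type*} [TopologicalSpace α]
    {f : α → EuclideanSpace ℝ ι} (hf : ∀ i, Continuous fun x => f x i) : Continuous f :=
  (PiLp.continuous_toLp 2 _).comp (continuous_pi hf)

theorem Driver.IsRough.continuous_x2 (hX : X.IsRough γ) (hγ : 0 < γ) :
    Continuous fun p : Time T × Time T => X.x2 p.1 p.2 := by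
  have hx := hX.mem_x.1
  refine hX.mem_x2.continuous_of_delta2 (by linarith) (continuous_of_coord fun ⟨i, j⟩ => ?_)
  simp only [hX.chen2, delta1]
  fun_prop

theorem Driver.IsRough.continuous_x3 (hX : X.IsRough γ) (hγ : 0 < γ) :
    Continuous fun p : Time T × Time T => X.x3 p.1 p.2 := by
  have hx := hX.mem_x.1
  have hx2 := hX.continuous_x2 hγ
  refine hX.mem_x3.continuous_of_delta2 (by linarith) (continuous_of_coord fun ⟨i, j, k⟩ => ?_)
  simp only [hX.chen3, delta1]
  fun_prop

theorem Driver.IsRough.continuous_eulerFlow (hX : X.IsRough γ) (hγ : 0 < γ) (hσ : IsRegular σ) :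
    Continuous fun p : Time T × Time T × Vec (Fin l) => X.eulerFlow σ p.1 p.2.1 p.2.2 := by
  have hx := hX.mem_x.1
  have htimes : Continuous fun p : Time T × Time T × Vec (Fin l) => (p.1, p.2.1) :=
    continuous_fst.prodMk continuous_snd.fst
  have hx2 : ∀ m, Continuous fun p : Time T × Time T × Vec (Fin l) => X.x2 p.1 p.2.1 m :=
    fun m => (continuous_apply m).comp
      ((PiLp.continuous_ofLp 2 _).comp ((hX.continuous_x2 hγ).comp htimes))
  have hx3 : ∀ m, Continuous fun p : Time T × Time T × Vec (Fin l) => X.x3 p.1 p.2.1 m :=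
    fun m => (continuous_apply m).comp
      ((PiLp.continuous_ofLp 2 _).comp ((hX.continuous_x3 hγ).comp htimes))
  have hcoeff : ∀ {F : Vec (Fin l) → ℝ} {n : ℕ}, HasBoundedPartials (n + 1) F →
      Continuous fun p : Time T × Time T × Vec (Fin l) => F p.2.2 := fun hF =>
    hF.2.1.continuous.comp continuous_snd.snd
  refine continuous_of_coord fun i => ((continuous_finsetSum _ fun j _ => ?_).add
    (continuous_finsetSum _ fun j _ => continuous_finsetSum _ fun k _ => ?_)).add
    (continuous_finsetSum _ fun j _ => continuous_finsetSum _ fun k₁ _ =>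
      continuous_finsetSum _ fun k₂ _ => ?_)
  · exact (hcoeff (hσ.bounded (i, j))).mul (by simp only [Driver.inc, delta1]; fun_prop)
  · exact (hcoeff (hσ.bounded_eulerCoeff1 (i, j) k)).mul (hx2 (k, j))
  · exact (hcoeff (hσ.bounded_eulerCoeff2 (i, j) k₁ k₂)).mul (hx3 (k₂, k₁, j))

variable (T) in
theorem exists_isAlmostFlow (hσ : IsRegular σ) (hγ : 0 ≤ γ) (M : ℝ≥0) :
    ∃ C : ℝ, 0 ≤ C ∧ ∀ X : Driver T d, X.IsRough γ → X.IsGeometric → X.size γ ≤ M →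
      IsAlmostFlow (X.eulerFlow σ) C γ (4 * γ) := by
  obtain ⟨C, hC0, hC⟩ := exists_norm_eulerIncr_le (l := l) (d := d) hσ M (T ^ γ)
  obtain ⟨D, hD⟩ := exists_norm_eulerDefect_le_add (l := l) (d := d) hσ M.coe_nonneg (T ^ γ)
  refine ⟨max C D, hC0.trans (le_max_left C D), fun X hX hg hM => ⟨fun s t a => ?_, ?_⟩⟩
  · have hτ : 0 ≤ |(t : ℝ) - s| ^ γ := Real.rpow_nonneg (abs_nonneg _) _
    have hξ := Incr.pairBoundedBy_self (X.inc_boundedBy_of_size_le hM s t)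
      (hX.inc_isGeometric hg s t) hτ le_rfl
    refine ((hC ⟨|(t : ℝ) - s| ^ γ, 0, X.inc s t, X.inc s t, X.inc s t, X.inc s t, a, a, 0, 0, hτ,
      Time.abs_sub_rpow_le hγ s t, le_rfl, hξ, hξ, by simp, by rw [norm_zero]; positivity,
      by rw [norm_zero]; positivity, by simp⟩).1).trans ?_
    gcongr
    exact le_max_left C D
  · intro s u t h hsu hut hT a b
    have hh : 0 ≤ h := (abs_nonneg _).trans hsu
    have hbound : ∀ v w : Time T, |(w : ℝ) - v| ≤ h → (X.inc v w).BoundedBy M (h ^ γ) :=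
      fun v w hvw => (X.inc_boundedBy_of_size_le hM v w).mono M.coe_nonneg le_rfl
        (Real.rpow_nonneg (abs_nonneg _) _) (Real.rpow_le_rpow (abs_nonneg _) hvw hγ)
    have hdefect := hD (h ^ γ) (Real.rpow_nonneg hh _) (Real.rpow_le_rpow hh hT hγ) _ _
      (hbound s u hsu) (hbound u t hut) (hX.inc_isGeometric hg s u) (hX.inc_isGeometric hg u t) a b
    rw [rpow_pow_eq hh, Nat.cast_ofNat] at hdefect
    rw [hX.flowDefect_eulerFlow]
    refine hdefect.trans (mul_le_mul_of_nonneg_right (le_max_right C D) ?_)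
    positivity

theorem exists_almostFlowsClose (hT : 0 ≤ T) (hσ : IsRegular σ) (hγ : 0 ≤ γ) (M : ℝ≥0) {K : ℝ}
    (hK : 0 ≤ K) :
    ∃ C : ℝ, 0 ≤ C ∧ ∀ X X' : Driver T d, X.IsRough γ → X.IsGeometric → X'.IsRough γ →
      X'.IsGeometric → X.size γ ≤ M → X'.size γ ≤ M → ∀ ε : ℝ, 0 ≤ ε →
        (∀ s t, (X.inc s t - X'.inc s t).BoundedBy ε (|(t : ℝ) - s| ^ γ)) →
          AlmostFlowsClose (X.eulerFlow σ) (X'.eulerFlow σ) K C γ (4 * γ) ε := by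
  set Θ := T ^ γ
  have hΘ0 : 0 ≤ Θ := Real.rpow_nonneg hT γ
  obtain ⟨C, hC0, hC⟩ := exists_norm_eulerIncr_sub_le (l := l) (d := d) hσ M.coe_nonneg Θ
  obtain ⟨D, hD⟩ := exists_norm_eulerDefect_sub_le (l := l) (d := d) hσ
    (add_nonneg M.coe_nonneg (mul_nonneg hK hΘ0)) Θ
  refine ⟨max C D, hC0.trans (le_max_left C D), fun X X' hX hg hX' hg' hM hM' ε hε hsub => ?_⟩
  have hpair : ∀ s t, (X.inc s t).PairBoundedBy (X'.inc s t) M (|(t : ℝ) - s| ^ γ) ε := fun s t =>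
    ⟨X.inc_boundedBy_of_size_le hM s t, X'.inc_boundedBy_of_size_le hM' s t, hsub s t,
      hX.inc_isGeometric hg s t, hX'.inc_isGeometric hg' s t⟩
  refine ⟨fun s t a a' => ?_, fun {s u t h} hsu hut hhT a b a' b' hJ hJ' => ?_⟩
  · have hτ : 0 ≤ |(t : ℝ) - s| ^ γ := Real.rpow_nonneg (abs_nonneg _) _
    rw [mul_assoc]
    refine (hC _ hτ (Time.abs_sub_rpow_le hγ s t) _ _ ε hε (hpair s t) a a').trans
      (mul_le_mul_of_nonneg_right (le_max_left C D) ?_)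
    positivity
  · have hh : 0 ≤ h := (abs_nonneg _).trans hsu
    have hτ : 0 ≤ h ^ γ := Real.rpow_nonneg hh γ
    have hτΘ : h ^ γ ≤ Θ := Real.rpow_le_rpow hh hhT hγ
    have hmono : ∀ v w : Time T, |(w : ℝ) - v| ≤ h →
        (X.inc v w).PairBoundedBy (X'.inc v w) (M + K * Θ) (h ^ γ) ε := fun v w hvw =>
      (hpair v w).mono M.coe_nonneg (le_add_of_nonneg_right (by positivity))
        (Real.rpow_nonneg (abs_nonneg _) _) (Real.rpow_le_rpow (abs_nonneg _) hvw hγ) hε le_rfl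
    have h4 : h ^ (4 * γ) = (h ^ γ) ^ 4 := by rw [rpow_pow_eq hh, Nat.cast_ofNat]
    have herror : K * h ^ (4 * γ) ≤ (M + K * Θ) * (h ^ γ) ^ 3 := calc
      K * h ^ (4 * γ) = K * h ^ γ * (h ^ γ) ^ 3 := by rw [h4]; ring
      _ ≤ (M + K * Θ) * (h ^ γ) ^ 3 := by
        gcongr
        exact (mul_le_mul_of_nonneg_left hτΘ hK).trans (le_add_of_nonneg_left M.coe_nonneg)
    have hdefect := hD _ hτ hτΘ _ _ _ _ ε hε (hmono s u hsu) (hmono u t hut) a a' _ _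
      (hJ.trans herror) (hJ'.trans herror)
    rw [add_eulerFlow_add_stepError, add_eulerFlow_add_stepError] at hdefect
    rw [hX.flowDefect_eulerFlow, hX'.flowDefect_eulerFlow, h4]
    refine hdefect.trans (mul_le_mul_of_nonneg_right (le_max_right C D) ?_)
    positivity

end Drivers

section Solutions

variable {T : ℝ} {l d : ℕ} {σ : Vec (Fin l) → Vec (Fin l × Fin d)} {X : Driver T d} {γ κ : ℝ}
  {a : Vec (Fin l)} {Y Y' : Triple T d (Fin l)}

/-- `Y` is the lift of its first component to a triple prescribed by the equation
`dy = σ(y) dx`. -/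
structure IsAdapted (σ : Vec (Fin l) → Vec (Fin l × Fin d)) (Y : Triple T d (Fin l)) :
    Prop where
  ζ1 : ∀ t, Y.ζ1 t = σ (Y.z t)
  ζ2 : ∀ t i j k, Y.ζ2 t (i, j, k) = eulerCoeff1 σ (i, j) k (Y.z t)

theorem IsAdapted.comp_ζ1 (h : IsAdapted σ Y) (t : Time T) (m : Fin l × Fin d) (k : Fin d) :
    (Y.comp σ).ζ1 t (m, k) = eulerCoeff1 σ m k (Y.z t) := by
  simp only [Triple.comp, eulerCoeff1, h.ζ1]

theorem IsAdapted.comp_ζ2 (h : IsAdapted σ Y) (t : Time T) (m : Fin l × Fin d) (j k : Fin d) :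
    (Y.comp σ).ζ2 t (m, j, k) = eulerCoeff2 σ m j k (Y.z t) := by
  simp only [Triple.comp, eulerCoeff2, h.ζ1, h.ζ2]

theorem IsAdapted.comp_r (h : IsAdapted σ Y) (X : Driver T d) (s t : Time T)
    (m : Fin l × Fin d) :
    (Y.comp σ).r X s t m = coeffRem0 σ (X.inc s t) (Y.z s) (Y.z t) m := by
  simp only [Triple.r, coeffRem0, h.comp_ζ1, h.comp_ζ2]
  rfl

theorem IsAdapted.comp_ρ (h : IsAdapted σ Y) (X : Driver T d) (s t : Time T)
    (m : Fin l × Fin d) (j : Fin d) :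
    (Y.comp σ).ρ X s t (m, j) = coeffRem1 σ (X.inc s t) (Y.z s) (Y.z t) m j := by
  simp only [Triple.ρ, coeffRem1, delta1, PiLp.sub_apply, h.comp_ζ1, h.comp_ζ2]
  rfl

theorem IsAdapted.sewing_comp (h : IsAdapted σ Y) (X : Driver T d) (s u t : Time T) :
    sewing X (Y.comp σ) s u t = eulerDefect σ (X.inc s u) (X.inc u t) (Y.z s) (Y.z u) := by
  simp only [sewing, eulerDefect, h.comp_r, h.comp_ρ, delta1, PiLp.sub_apply, h.comp_ζ2]
  rfl

theorem IsAdapted.ext (hY : IsAdapted σ Y) (hY' : IsAdapted σ Y') (hz : ∀ t, Y.z t = Y'.z t) :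
    Y = Y' := by
  refine Triple.ext (funext hz) (funext fun t => ?_) (funext fun t => ?_)
  · rw [hY.ζ1, hY'.ζ1, hz]
  · ext ⟨i, j, k⟩
    rw [hY.ζ2, hY'.ζ2, hz]

theorem IsSolution.isAdapted (h : IsSolution X κ σ a Y) : IsAdapted σ Y := by
  obtain ⟨-, -, -, hζ1, hζ2⟩ := h
  have hζ1 : ∀ t, Y.ζ1 t = σ (Y.z t) := hζ1
  refine ⟨hζ1, fun t i j k => ?_⟩
  rw [hζ2]
  simp only [Triple.comp, eulerCoeff1, hζ1]

theorem IsSolution.z_zero (h : IsSolution X κ σ a Y) (t : Time T) (ht : (t : ℝ) = 0) :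
    Y.z t = a :=
  (h.1.2 t ht).1

theorem IsSolution.continuous_z (h : IsSolution X κ σ a Y) : Continuous Y.z :=
  h.1.1.mem_z.1

theorem IsSolution.memC2OnePlus_stepError (h : IsSolution X κ σ a Y) :
    MemC2OnePlus fun s t => stepError (X.eulerFlow σ) s t (Y.z s) (Y.z t) := by
  obtain ⟨L, hL, hintegral⟩ := h.2.2.1
  have hLe : (fun s t => stepError (X.eulerFlow σ) s t (Y.z s) (Y.z t)) = L := by
    funext s t
    ext i
    have hi := hintegral s t i
    simp only [h.isAdapted.comp_ζ1, h.isAdapted.comp_ζ2] at hi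
    change delta1 Y.z s t i - eulerIncr σ (X.inc s t) (Y.z s) i = _
    rw [hi]
    simp only [eulerIncr, eulerPath, eulerArea, eulerVolume, Triple.comp, Driver.inc]
    ring
  rw [hLe]
  exact hL.1

variable (T) in
theorem exists_norm_stepError_le (hσ : IsRegular σ) (hγ : 1 / 4 < γ) (M : ℝ≥0) :
    ∃ K : ℝ, 0 ≤ K ∧ ∀ (X : Driver T d) (κ : ℝ) (a : Vec (Fin l)) (Y : Triple T d (Fin l)),
      X.IsRough γ → X.IsGeometric → X.size γ ≤ M → IsSolution X κ σ a Y → ∀ s t,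
        ‖stepError (X.eulerFlow σ) s t (Y.z s) (Y.z t)‖ ≤ K * |(t : ℝ) - s| ^ (4 * γ) := by
  have hγ0 : 0 < γ := by linarith
  obtain ⟨C, hC0, hC⟩ := exists_isAlmostFlow T hσ hγ0.le M
  obtain ⟨K, hK0, hK⟩ := exists_stepError_bound T (Vec (Fin l)) hC0 hγ0
    (show 1 < 4 * γ by linarith)
  refine ⟨K, hK0, fun X κ a Y hX hg hM hY => ?_⟩
  obtain ⟨ν, hν, herror⟩ := hY.memC2OnePlus_stepError
  obtain ⟨B, hB⟩ := herror.bound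
  exact hK (X.eulerFlow σ) Y.z B ν (hC X hX hg hM) hν hB

theorem IsSolution.exists_norm_sub_le {X' : Driver T d} {a' : Vec (Fin l)}
    (hY : IsSolution X κ σ a Y) (hY' : IsSolution X' κ σ a' Y') :
    ∃ B : ℝ, ∀ s, ‖Y.z s - Y'.z s‖ ≤ B := by
  obtain ⟨B, hB⟩ := (isCompact_range (hY.continuous_z.sub hY'.continuous_z).norm).bddAbove
  exact ⟨B, fun s => hB ⟨s, rfl⟩⟩

theorem exists_norm_delta1_sub_le (hT : 0 < T) (hσ : IsRegular σ) (hγ : 1 / 4 < γ) (M : ℝ≥0) :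
    ∃ c : ℝ, 0 ≤ c ∧ ∀ X X' : Driver T d, X.IsRough γ → X.IsGeometric →
      X'.IsRough γ → X'.IsGeometric → X.size γ ≤ M → X'.size γ ≤ M →
      ∀ ε : ℝ, 0 ≤ ε → (∀ s t, (X.inc s t - X'.inc s t).BoundedBy ε (|(t : ℝ) - s| ^ γ)) →
      ∀ (κ : ℝ) (a a' : Vec (Fin l)) (Y Y' : Triple T d (Fin l)),
        IsSolution X κ σ a Y → IsSolution X' κ σ a' Y' → ∀ s t,
          ‖delta1 (fun t => Y.z t - Y'.z t) s t‖ ≤ c * (‖a - a'‖ + ε) * |(t : ℝ) - s| ^ γ := by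
  have hγ0 : 0 < γ := by linarith
  obtain ⟨K, hK0, hK⟩ := exists_norm_stepError_le (l := l) (d := d) T hσ hγ M
  obtain ⟨C, hC0, hC⟩ := exists_almostFlowsClose (l := l) (d := d) hT.le hσ hγ0.le M hK0
  obtain ⟨c, hc0, hc⟩ := exists_holder_stability T (Vec (Fin l)) hC0 hK0 hγ0
    (show 1 < 4 * γ by linarith) (by linarith)
  refine ⟨c, hc0, fun X X' hX hg hX' hg' hM hM' ε hε hsub κ a a' Y Y' hY hY' => ?_⟩
  obtain ⟨B, hB⟩ := hY.exists_norm_sub_le hY'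
  have hholder := hc (X.eulerFlow σ) (X'.eulerFlow σ) Y.z Y'.z ε B hε
    (hC X X' hX hg hX' hg' hM hM' ε hε hsub) (hK X κ a Y hX hg hM hY)
    (hK X' κ a' Y' hX' hg' hM' hY') hB ⟨0, le_rfl, hT.le⟩ rfl
  rwa [hY.z_zero _ rfl, hY'.z_zero _ rfl] at hholder

theorem exists_lipschitz (hT : 0 < T) (hσ : IsRegular σ) (hγ : 1 / 4 < γ) (hκ : 0 ≤ κ)
    (hκγ : κ ≤ γ) (M : ℝ≥0) :
    ∃ c : ℝ≥0, 0 < c ∧ ∀ X X' : Driver T d, X.IsRough γ → X.IsGeometric →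
        X'.IsRough γ → X'.IsGeometric → X.size γ ≤ M → X'.size γ ≤ M →
        ∀ (a a' : Vec (Fin l)) (Y Y' : Triple T d (Fin l)),
          IsSolution X κ σ a Y → IsSolution X' κ σ a' Y' →
          norm1 κ (fun t => Y.z t - Y'.z t) ≤
            c * (‖a - a'‖ₑ + norm1 γ (fun t => X.x t - X'.x t)
              + norm2 (2 * γ) (fun s t => X.x2 s t - X'.x2 s t)
              + norm2 (3 * γ) (fun s t => X.x3 s t - X'.x3 s t)) := by
  obtain ⟨C, hC0, hC⟩ := exists_norm_delta1_sub_le (l := l) (d := d) hT hσ hγ M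
  have hc : 0 < C * T ^ (γ - κ) + 1 := by positivity
  refine ⟨(C * T ^ (γ - κ) + 1).toNNReal, Real.toNNReal_pos.2 hc, ?_⟩
  intro X X' hX hg hX' hg' hM hM' a a' Y Y' hY hY'
  rw [add_assoc, add_assoc, ← add_assoc (norm1 γ _)]
  set n := norm1 γ (fun t => X.x t - X'.x t) + norm2 (2 * γ) (fun s t => X.x2 s t - X'.x2 s t) +
    norm2 (3 * γ) (fun s t => X.x3 s t - X'.x3 s t) with hn
  rcases eq_or_ne n ∞ with htop | htop
  · rw [htop, add_top, ENNReal.mul_top (by simpa using hc)]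
    exact le_top
  have hε : ENNReal.ofReal n.toReal = n := ENNReal.ofReal_toReal htop
  have hε0 : 0 ≤ n.toReal := ENNReal.toReal_nonneg
  have hholder : ∀ s t : Time T, ‖delta1 (fun t => Y.z t - Y'.z t) s t‖ ≤
      (C * T ^ (γ - κ) + 1) * (‖a - a'‖ + n.toReal) * |(t : ℝ) - s| ^ κ := fun s t => calc
    _ ≤ C * (‖a - a'‖ + n.toReal) * |(t : ℝ) - s| ^ γ :=
      hC X X' hX hg hX' hg' hM hM' _ hε0
        (Driver.inc_sub_inc_boundedBy hε0 (hn.symm.trans hε.symm).le) κ a a' Y Y' hY hY' s t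
    _ ≤ C * (‖a - a'‖ + n.toReal) * (T ^ (γ - κ) * |(t : ℝ) - s| ^ κ) := by
      gcongr
      exact rpow_le_rpow_sub_mul_rpow (abs_nonneg _) (Time.abs_sub_le s t) hκ hκγ
    _ = C * T ^ (γ - κ) * (‖a - a'‖ + n.toReal) * |(t : ℝ) - s| ^ κ := by ring
    _ ≤ _ := by
      gcongr
      exact le_add_of_nonneg_right zero_le_one
  refine (norm2_le_of_bound hholder).trans_eq ?_
  rw [ENNReal.ofReal_mul hc.le, ENNReal.ofReal_add (norm_nonneg _) hε0, hε, ofReal_norm]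
  rfl

theorem IsSolution.unique (hT : 0 < T) (hσ : IsRegular σ) (hγ : 1 / 4 < γ)
    (hX : X.IsRough γ) (hg : X.IsGeometric) (hY : IsSolution X κ σ a Y)
    (hY' : IsSolution X κ σ a Y') : Y = Y' := by
  refine hY.isAdapted.ext hY'.isAdapted fun t => sub_eq_zero.1 ?_
  obtain ⟨c, -, hc⟩ := exists_norm_delta1_sub_le (l := l) (d := d) hT hσ hγ (X.size γ).toNNReal
  have hzero := hc X X hX hg hX hg hX.size_le hX.size_le 0 le_rfl
    (fun s t => (X.inc s t).boundedBy_sub_self le_rfl (Real.rpow_nonneg (abs_nonneg _) _))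
    κ a a Y Y' hY hY' ⟨0, le_rfl, hT.le⟩ t
  rwa [sub_self, norm_zero, add_zero, mul_zero, zero_mul, norm_le_zero_iff, delta1,
    hY.z_zero ⟨0, le_rfl, hT.le⟩ rfl, hY'.z_zero ⟨0, le_rfl, hT.le⟩ rfl, sub_self,
    sub_zero] at hzero

end Solutions

section Existence

variable {T : ℝ} {l d : ℕ} {σ : Vec (Fin l) → Vec (Fin l × Fin d)} {X : Driver T d} {γ κ K : ℝ}
  {y : Time T → Vec (Fin l)}

/-- The size `|t - s| ^ γ` of the path of a `γ`-rough driver over `(s,t)`. -/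
noncomputable def timeGap (γ : ℝ) (p : Time T × Time T) : ℝ :=
  |(p.2 : ℝ) - p.1| ^ γ

theorem timeGap_nonneg (γ : ℝ) (p : Time T × Time T) : 0 ≤ timeGap γ p :=
  Real.rpow_nonneg (abs_nonneg _) _

theorem timeGap_pow (γ : ℝ) (p : Time T × Time T) (n : ℕ) :
    timeGap γ p ^ n = |(p.2 : ℝ) - p.1| ^ (n * γ) :=
  rpow_pow_eq (abs_nonneg _) γ n

theorem isBigO_timeGap (hγ : 0 ≤ γ) : timeGap (T := T) γ =O[⊤] fun _ => (1 : ℝ) :=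
  isBigO_top.2 ⟨T ^ γ, fun p => by
    rw [Real.norm_of_nonneg (timeGap_nonneg γ p), norm_one, mul_one]
    exact Time.abs_sub_rpow_le hγ _ _⟩

theorem memC2_of_isBigO {ι : Type} [Fintype ι] {μ : ℝ} (n : ℕ) (hμ : 0 < μ) (hμn : μ ≤ n * γ)
    {f : Time T → Time T → Vec ι}
    (h : ∀ i, (fun p : Time T × Time T => f p.1 p.2 i) =O[⊤] fun p => timeGap γ p ^ n) :
    MemC2 μ f := by
  obtain ⟨C, hC⟩ := isBigO_top.1 (isBigO_of_coord (f := fun p : Time T × Time T => f p.1 p.2) h)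
  refine memC2_of_bound (C := C) hμ hμn fun s t => ?_
  have hst := hC (s, t)
  rwa [Real.norm_of_nonneg (pow_nonneg (timeGap_nonneg γ _) n), timeGap_pow] at hst

theorem memC1_of_isBigO {ι : Type} [Fintype ι] {μ : ℝ} (hμ : 0 < μ) (hμγ : μ ≤ γ)
    {f : Time T → Vec ι}
    (h : ∀ i, (fun p : Time T × Time T => f p.2 i - f p.1 i) =O[⊤] fun p => timeGap γ p ^ 1) :
    MemC1 μ f := by
  have hdelta1 : MemC2 γ (delta1 f) := memC2_of_isBigO 1 (hμ.trans_le hμγ) (by simp) h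
  obtain ⟨C, hC⟩ := hdelta1.bound
  exact memC1_of_bound hμ hμγ hC

theorem Driver.IsRough.isPairBigOIncr (hX : X.IsRough γ) (hg : X.IsGeometric) :
    IsPairBigOIncr (timeGap γ) (fun _ => 0) (fun p => X.inc p.1 p.2) fun p => X.inc p.1 p.2 :=
  isPairBigOIncr_of_pairBoundedBy (timeGap_nonneg γ) (fun _ => le_rfl) fun p =>
    Incr.pairBoundedBy_self (Driver.inc_boundedBy_of_size_le hX.size_le p.1 p.2)
      (hX.inc_isGeometric hg p.1 p.2) (timeGap_nonneg γ p) le_rfl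

theorem isBigO_sub_self (y : Time T → Vec (Fin l)) :
    (fun p : Time T × Time T => y p.1 - y p.1) =O[⊤] fun _ => (0 : ℝ) := by
  simpa only [sub_self] using isBigO_zero (E' := Vec (Fin l)) (fun _ : Time T × Time T => (0 : ℝ)) ⊤

section Orders

variable (hσ : IsRegular σ) (hγ : 0 ≤ γ) (hX : X.IsRough γ) (hg : X.IsGeometric)
  (hy : ∀ s t, ‖stepError (X.eulerFlow σ) s t (y s) (y t)‖ ≤ K * |(t : ℝ) - s| ^ (4 * γ))

include hγ hy

theorem isPairBigO_stepError (i : Fin l) :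
    IsPairBigO (timeGap γ) (fun _ => 0) 3
      (fun p : Time T × Time T => stepError (X.eulerFlow σ) p.1 p.2 (y p.1) (y p.2) i)
      (fun p => stepError (X.eulerFlow σ) p.1 p.2 (y p.1) (y p.2) i) := by
  have hbound : ∀ p : Time T × Time T,
      ‖stepError (X.eulerFlow σ) p.1 p.2 (y p.1) (y p.2)‖ ≤ K * timeGap γ p ^ 4 := fun p => by
    rw [timeGap_pow]
    exact_mod_cast hy p.1 p.2
  exact (isPairBigO_of_norm_le (timeGap_nonneg γ) (fun _ => le_rfl) hbound hbound
    (fun p => by simp) i).of_le (isBigO_timeGap hγ) (by norm_num)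

include hσ hX hg

theorem isBigO_sub_along (i : Fin l) :
    (fun p : Time T × Time T => y p.2 i - y p.1 i) =O[⊤] fun p => timeGap γ p ^ 1 := by
  have hstep := (isPairBigO_step (isBigO_timeGap hγ) hσ (isBigO_sub_self y)
    (hX.isPairBigOIncr hg) (isPairBigO_stepError hγ hy) i).left
  refine hstep.congr_left fun p => ?_
  rw [eq_sub_iff_add_eq', ← PiLp.add_apply, add_eulerFlow_add_stepError]

theorem isBigO_comp_sub_along {F : Vec (Fin l) → ℝ} (hF : HasBoundedPartials 2 F) :
    (fun p : Time T × Time T => F (y p.2) - F (y p.1)) =O[⊤] fun p => timeGap γ p ^ 1 := by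
  simpa only [add_eulerFlow_add_stepError] using
    (hF.isPairBigO_taylor_zero (isBigO_timeGap hγ) (isBigO_sub_self y)
      (isPairBigO_step (isBigO_timeGap hγ) hσ (isBigO_sub_self y) (hX.isPairBigOIncr hg)
        (isPairBigO_stepError hγ hy))).left

theorem isBigO_coeffRem0_along (m : Fin l × Fin d) :
    (fun p : Time T × Time T => coeffRem0 σ (X.inc p.1 p.2) (y p.1) (y p.2) m) =O[⊤]
      fun p => timeGap γ p ^ 3 := by
  simpa only [add_eulerFlow_add_stepError] using
    (isPairBigO_coeffRem0 (isBigO_timeGap hγ) hσ (isBigO_sub_self y) (hX.isPairBigOIncr hg)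
      (isPairBigO_stepError hγ hy) (fun p => hX.inc_isGeometric hg p.1 p.2)
      (fun p => hX.inc_isGeometric hg p.1 p.2) m).left

theorem isBigO_coeffRem1_along (m : Fin l × Fin d) (j : Fin d) :
    (fun p : Time T × Time T => coeffRem1 σ (X.inc p.1 p.2) (y p.1) (y p.2) m j) =O[⊤]
      fun p => timeGap γ p ^ 2 := by
  simpa only [add_eulerFlow_add_stepError] using
    (isPairBigO_coeffRem1 (isBigO_timeGap hγ) hσ (isBigO_sub_self y) (hX.isPairBigOIncr hg)
      (isPairBigO_stepError hγ hy) m j).left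

end Orders

/-- The lift of a path to a triple prescribed by the equation `dy = σ(y) dx`. -/
noncomputable def liftPath (σ : Vec (Fin l) → Vec (Fin l × Fin d)) (y : Time T → Vec (Fin l)) :
    Triple T d (Fin l) where
  z := y
  ζ1 t := σ (y t)
  ζ2 t := WithLp.toLp 2 fun p => eulerCoeff1 σ (p.1, p.2.1) p.2.2 (y t)

theorem isAdapted_liftPath (σ : Vec (Fin l) → Vec (Fin l × Fin d)) (y : Time T → Vec (Fin l)) :
    IsAdapted σ (liftPath σ y) :=
  ⟨fun _ => rfl, fun _ _ _ _ => rfl⟩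

theorem liftPath_r (s t : Time T) (i : Fin l) :
    (liftPath σ y).r X s t i = eulerVolume σ (X.inc s t) (y s) i +
      stepError (X.eulerFlow σ) s t (y s) (y t) i := by
  simp only [Triple.r, liftPath, stepError, Driver.eulerFlow, eulerIncr, eulerPath, eulerArea,
    delta1, Driver.inc, PiLp.sub_apply]
  ring

theorem liftPath_ρ (s t : Time T) (m : Fin l × Fin d) :
    (liftPath σ y).ρ X s t m = coeffRem0 σ (X.inc s t) (y s) (y t) m +
      ∑ j, ∑ k, eulerCoeff2 σ m j k (y s) * (X.inc s t).x2 (k, j) := by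
  simp only [Triple.ρ, liftPath, coeffRem0, delta1, Driver.inc, PiLp.sub_apply]
  ring

theorem IsRegular.isBigO_area_mul_eulerCoeff2 (hσ : IsRegular σ) (hX : X.IsRough γ)
    (hg : X.IsGeometric) (m : Fin l × Fin d) :
    (fun p : Time T × Time T => ∑ j, ∑ k, eulerCoeff2 σ m j k (y p.1) * (X.inc p.1 p.2).x2 (k, j))
      =O[⊤] fun p => timeGap γ p ^ 2 := by
  refine .fun_sum fun j _ => .fun_sum fun k _ => ?_
  have hcoeff := (hσ.bounded_eulerCoeff2 m j k).of_succ.isPairBigO (τ := timeGap γ)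
    (isBigO_sub_self y)
  simpa only [zero_add] using (hcoeff.mul ((hX.isPairBigOIncr hg).x2 (k, j))).left

section Solution

variable (hσ : IsRegular σ) (hγ : 1 / 4 < γ) (hκ : 0 < κ) (hκγ : κ ≤ γ) (hX : X.IsRough γ)
  (hg : X.IsGeometric)
  (hy : ∀ s t, ‖stepError (X.eulerFlow σ) s t (y s) (y t)‖ ≤ K * |(t : ℝ) - s| ^ (4 * γ))

include hσ hκ hκγ hX hg hy

theorem isControlled_liftPath : (liftPath σ y).IsControlled X κ := by
  have hγ : 0 ≤ γ := hκ.le.trans hκγ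
  refine ⟨memC1_of_isBigO hκ hκγ (isBigO_sub_along hσ hγ hX hg hy),
    memC1_of_isBigO hκ hκγ fun m => isBigO_comp_sub_along hσ hγ hX hg hy
      (hσ.bounded m).of_succ.of_succ,
    memC1_of_isBigO hκ hκγ fun p => isBigO_comp_sub_along hσ hγ hX hg hy
      (hσ.bounded_eulerCoeff1 (p.1, p.2.1) p.2.2).of_succ,
    memC2_of_isBigO (γ := γ) 3 (by linarith) (by push_cast; linarith) fun i => ?_,
    memC2_of_isBigO (γ := γ) 2 (by linarith) (by push_cast; linarith) fun m => ?_⟩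
  · simp only [liftPath_r]
    exact (hσ.isPairBigO_eulerVolume (isBigO_sub_self y) (hX.isPairBigOIncr hg) i).left.add
      (isPairBigO_stepError hγ hy i).left
  · simp only [liftPath_ρ]
    exact ((isBigO_coeffRem0_along hσ hγ hX hg hy m).trans
      (isBigO_pow_of_le (isBigO_timeGap hγ) (by norm_num))).add
      (hσ.isBigO_area_mul_eulerCoeff2 hX hg m)

theorem isControlled_liftPath_comp : ((liftPath σ y).comp σ).IsControlled X κ := by
  have hγ : 0 ≤ γ := hκ.le.trans hκγ
  have hlift := isAdapted_liftPath σ y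
  refine ⟨(isControlled_liftPath hσ hκ hκγ hX hg hy).mem_ζ1,
    memC1_of_isBigO hκ hκγ fun ⟨m, j⟩ => ?_,
    memC1_of_isBigO hκ hκγ fun ⟨m, j, k⟩ => ?_,
    memC2_of_isBigO (γ := γ) 3 (by linarith) (by push_cast; linarith) fun m => ?_,
    memC2_of_isBigO (γ := γ) 2 (by linarith) (by push_cast; linarith) fun ⟨m, j⟩ => ?_⟩
  · simp only [hlift.comp_ζ1]
    exact isBigO_comp_sub_along hσ hγ hX hg hy (hσ.bounded_eulerCoeff1 m j).of_succ
  · simp only [hlift.comp_ζ2]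
    exact isBigO_comp_sub_along hσ hγ hX hg hy (hσ.bounded_eulerCoeff2 m j k)
  · simp only [hlift.comp_r]
    exact isBigO_coeffRem0_along hσ hγ hX hg hy m
  · simp only [hlift.comp_ρ]
    exact isBigO_coeffRem1_along hσ hγ hX hg hy m j

omit hσ hκ hκγ hg in
include hγ in
theorem isIntegral_liftPath : IsIntegral X ((liftPath σ y).comp σ) y := by
  have hlift := isAdapted_liftPath σ y
  refine ⟨fun s t => stepError (X.eulerFlow σ) s t (y s) (y t),
    ⟨⟨4 * γ, by linarith, memC2_of_bound (by linarith) le_rfl hy⟩, ?_⟩, fun s t i => ?_⟩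
  · funext s u t
    rw [hlift.sewing_comp, delta2, stepError_eq_add _ s u t (y s) (y u) (y t),
      hX.flowDefect_eulerFlow]
    change _ = eulerDefect σ (X.inc s u) (X.inc u t) (y s) (y u)
    abel
  · simp only [hlift.comp_ζ1, hlift.comp_ζ2]
    simp only [stepError, Driver.eulerFlow, eulerIncr, eulerPath, eulerArea, eulerVolume, delta1,
      Driver.inc, PiLp.sub_apply, liftPath, Triple.comp]
    ring

include hγ in
theorem isSolution_liftPath {a : Vec (Fin l)} (ha : ∀ t : Time T, (t : ℝ) = 0 → y t = a) :
    IsSolution X κ σ a (liftPath σ y) :=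
  ⟨⟨isControlled_liftPath hσ hκ hκγ hX hg hy, fun t ht => ⟨ha t ht, congrArg σ (ha t ht)⟩⟩,
    isControlled_liftPath_comp hσ hκ hκγ hX hg hy, isIntegral_liftPath hγ hX hy, fun _ => rfl,
    fun t i j k => ((isAdapted_liftPath σ y).comp_ζ1 t (i, j) k).symm⟩

end Solution

theorem exists_isSolution (hT : 0 < T) (hσ : IsRegular σ) (hγ : 1 / 4 < γ) (hκ : 0 < κ)
    (hκγ : κ ≤ γ) (hX : X.IsRough γ) (hg : X.IsGeometric) (a : Vec (Fin l)) :
    ∃ Y, IsSolution X κ σ a Y := by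
  obtain ⟨C, hC0, hC⟩ := exists_isAlmostFlow T hσ (hκ.le.trans hκγ) (X.size γ).toNNReal
  obtain ⟨y, K, ha, hy⟩ := (hC X hX hg hX.size_le).exists_path
    (hX.continuous_eulerFlow (hκ.trans_le hκγ) hσ) hT hC0 (hκ.trans_le hκγ) (by linarith) a
  exact ⟨liftPath σ y, isSolution_liftPath hσ hγ hκ hκγ hX hg hy ha⟩

end Existence

end RoughDiff

theorem theoremt2p1_general (l d : ℕ) (T : ℝ) (hT : 0 < T) (γ κ : ℝ) (hγ : 1 / 4 < γ)
    (hκ : 0 < κ) (hκγ : κ ≤ γ)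
    (σ : RoughDiff.Vec (Fin l) → RoughDiff.Vec (Fin l × Fin d)) (hσ : RoughDiff.IsCb4 σ) :
    (∀ X : RoughDiff.Driver T d, X.IsRough γ → X.IsGeometric →
      ∀ a : RoughDiff.Vec (Fin l),
        ∃! Y : RoughDiff.Triple T d (Fin l), RoughDiff.IsSolution X κ σ a Y) ∧
    (∀ M : NNReal, ∃ c : NNReal, 0 < c ∧
      ∀ X X' : RoughDiff.Driver T d, X.IsRough γ → X.IsGeometric →
        X'.IsRough γ → X'.IsGeometric → X.size γ ≤ M → X'.size γ ≤ M →
        ∀ (a a' : RoughDiff.Vec (Fin l)) (Y Y' : RoughDiff.Triple T d (Fin l)),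
          RoughDiff.IsSolution X κ σ a Y → RoughDiff.IsSolution X' κ σ a' Y' →
          RoughDiff.norm1 κ (fun t => Y.z t - Y'.z t) ≤
            c * (‖a - a'‖ₑ + RoughDiff.norm1 γ (fun t => X.x t - X'.x t)
              + RoughDiff.norm2 (2 * γ) (fun s t => X.x2 s t - X'.x2 s t)
              + RoughDiff.norm2 (3 * γ) (fun s t => X.x3 s t - X'.x3 s t))) :=
  ⟨fun _ hX hg a => existsUnique_of_exists_of_unique
      (RoughDiff.exists_isSolution hT hσ.isRegular hγ hκ hκγ hX hg a)
      fun _ _ hY hY' => hY.unique hT hσ.isRegular hγ hX hg hY',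
    RoughDiff.exists_lipschitz hT hσ.isRegular hγ hκ.le hκγ⟩

theorem theoremt2p1 (l d : ℕ) (T : ℝ) (hT : 0 < T) (γ κ : ℝ) (hγ : 1 / 4 < γ)
    (hκ : 0 < κ) (hκγ : κ < γ) (hκγ' : 1 < 3 * κ + γ)
    (σ : RoughDiff.Vec (Fin l) → RoughDiff.Vec (Fin l × Fin d)) (hσ : RoughDiff.IsCb4 σ) :
    (∀ X : RoughDiff.Driver T d, X.IsRough γ → X.IsGeometric →
      ∀ a : RoughDiff.Vec (Fin l),
        ∃! Y : RoughDiff.Triple T d (Fin l), RoughDiff.IsSolution X κ σ a Y) ∧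
    (∀ M : NNReal, ∃ c : NNReal, 0 < c ∧
      ∀ X X' : RoughDiff.Driver T d, X.IsRough γ → X.IsGeometric →
        X'.IsRough γ → X'.IsGeometric → X.size γ ≤ M → X'.size γ ≤ M →
        ∀ (a a' : RoughDiff.Vec (Fin l)) (Y Y' : RoughDiff.Triple T d (Fin l)),
          RoughDiff.IsSolution X κ σ a Y → RoughDiff.IsSolution X' κ σ a' Y' →
          RoughDiff.norm1 κ (fun t => Y.z t - Y'.z t) ≤
            c * (‖a - a'‖ₑ + RoughDiff.norm1 γ (fun t => X.x t - X'.x t)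
              + RoughDiff.norm2 (2 * γ) (fun s t => X.x2 s t - X'.x2 s t)
              + RoughDiff.norm2 (3 * γ) (fun s t => X.x3 s t - X'.x3 s t))) :=
  theoremt2p1_general l d T hT γ κ hγ hκ hκγ.le σ hσ
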